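/- Let $G$ be a real reductive group, that is, a finite covering group of an open subgroup of the group $G_{\mathbb R}$ of real points of a reductive linear algebraic group defined over $\mathbb R$, where $G_{\mathbb R}\subset GL(m,\mathbb R)$ is realized as a Zariski closed subgroup stable under transposition. Let $K\subset G$ be the maximal compact subgroup of elements mapping to orthogonal matrices, $\theta$ the Cartan involution covering $g\mapsto (g^T)^{-1}$, $\mathfrak a$ a maximal abelian subspace of the $-1$ eigenspace of $\theta$ on $Lie(G)$, $A=\exp\mathfrak a$, and $N$ the maximal unipotent subgroup whose Lie algebra is the sum of the root spaces of $\mathfrak a$ for a system $\Phi(N)$ of positive roots, so that $G=\theta(N)AK$ is an Iwasawa decomposition. For $a\in A$ put $a^{\rho}=(\det Ad(a)|_{Lie(N)})^{1/2}$. For $g=vak$ with $v\in\theta(N)$, $a\in A$, $k\in K$ put $a(g)=a$. Let $A^{+}=\{a\in A\mid a^{\alpha}\ge 1 \text{ for all }\alpha\in\Phi(N)\}$; then $G=KA^{+}K$, and for $k_1,k_2\in K$, $a\in A^{+}$ put $\|k_1ak_2\|=a^{\rho}$, which is well defined. Call $G$ tame if $$\int_{[N,N]}a(n)^{-\rho}\,(1+\log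 a(n)^{\rho})^{d}\,dn<\infty\quad\text{for all } d>0 .$$ A subgroup $P$ of $G$ is parabolic if it contains a conjugate of the normalizer of $N$ in $G$ and is its own normalizer, and it is standard if moreover $N\subset P$. Its unipotent radical $N_P$ is the largest normal subgroup of $P$ that consists of unipotent elements (exponentials of nilpotent elements of $Lie(G)$). Lemma. If $G$ is tame and $P$ is a standard parabolic subgroup of $G$, then for every $d\in\mathbb R$ $$\int_{[N_P,N_P]}a(n)^{-\rho}\,(1+\log\|n\|)^{d}\,dn<\infty .$$ Here $[\cdot,\cdot]$ denotes the commutator subgroup and $dn$ is Haar measure. -/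

import Mathlib

open MeasureTheory
open scoped Matrix ENNReal

noncomputable section

/-- A real reductive group in the sense of Wallach: a finite covering group `G` of an open subgroup
of `algGroup`, where `algGroup` is the group of real points of a reductive linear algebraic group
defined over `ℝ`, realised (as is always possible) as a Zariski closed subgroup of `GL(m, ℝ)` that
is stable under transposition.  The realisation fixes the Cartan involution `g ↦ (gᵀ)⁻¹`. -/
structure RealReductiveGroup (G : Type*) [Group G] [TopologicalSpace G] [IsTopologicalGroup G]
    (m : ℕ) where
  algGroup : Subgroup (GL (Fin m) ℝ)
  zariskiClosed : ∃ S : Set (MvPolynomial (Fin m × Fin m) ℝ), ∀ g : GL (Fin m) ℝ,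
    g ∈ algGroup ↔
      ∀ f ∈ S, MvPolynomial.eval (fun ij => (g : Matrix (Fin m) (Fin m) ℝ) ij.1 ij.2) f = 0
  symmetric : ∀ g ∈ algGroup, ∃ h ∈ algGroup,
    (h : Matrix (Fin m) (Fin m) ℝ) = (g : Matrix (Fin m) (Fin m) ℝ)ᵀ
  proj : G →* algGroup
  isOpen_range : IsOpen (Set.range proj)
  isCoveringMapOn : IsCoveringMapOn proj (Set.range proj)
  finite_ker : (proj.ker : Set G).Finite

namespace RealReductiveGroup

variable {G : Type*} [Group G] [TopologicalSpace G] [IsTopologicalGroup G] {m : ℕ}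
  (R : RealReductiveGroup G m)

/-- The matrix of the image of `g` in `GL(m, ℝ)`. -/
def mat (g : G) : Matrix (Fin m) (Fin m) ℝ := ((R.proj g : GL (Fin m) ℝ) : Matrix _ _ ℝ)

lemma mat_mul (g h : G) : R.mat (g * h) = R.mat g * R.mat h := by simp [mat]

lemma mat_one : R.mat 1 = 1 := by simp [mat]

/-- `Lie(G)`, as a set of `m × m` matrices. -/
def lie : Set (Matrix (Fin m) (Fin m) ℝ) :=
  {X | ∀ t : ℝ, ∃ g ∈ R.algGroup, (g : Matrix (Fin m) (Fin m) ℝ) = NormedSpace.exp (t • X)}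

/-- The adjoint action of `G` (on all matrices; it preserves `Lie(G)`). -/
def Ad (g : G) : Matrix (Fin m) (Fin m) ℝ →ₗ[ℝ] Matrix (Fin m) (Fin m) ℝ :=
  LinearMap.mulLeft ℝ (R.mat g) ∘ₗ LinearMap.mulRight ℝ (R.mat g⁻¹)

lemma Ad_apply (g : G) (X : Matrix (Fin m) (Fin m) ℝ) :
    R.Ad g X = R.mat g * (X * R.mat g⁻¹) := rfl

/-- `g = exp X`, where `exp` is the exponential map of the Lie group `G`: `g` is the value at time
`1` of the one-parameter subgroup of `G` with velocity `X`. -/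
def IsExp (X : Matrix (Fin m) (Fin m) ℝ) (g : G) : Prop :=
  ∃ γ : ℝ → G, Continuous γ ∧ (∀ s t, γ (s + t) = γ s * γ t) ∧
    (∀ t, R.mat (γ t) = NormedSpace.exp (t • X)) ∧ γ 1 = g

/-- The connected Lie subgroup of `G` whose Lie algebra is `𝔥`, for a Lie subalgebra `𝔥` of
`Lie(G)`: the subgroup generated by `exp 𝔥`. -/
def analyticSubgroup (𝔥 : Set (Matrix (Fin m) (Fin m) ℝ)) : Subgroup G :=
  Subgroup.closure {g | ∃ X ∈ 𝔥, R.IsExp X g}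

/-- The maximal compact subgroup fixed by the Cartan involution: the elements of `G` that map to
orthogonal matrices. -/
def K : Subgroup G where
  carrier := {g | R.mat g * (R.mat g)ᵀ = 1}
  mul_mem' := by
    intro a b ha hb
    simp only [Set.mem_ofPred_eq] at *
    rw [mat_mul, Matrix.transpose_mul, Matrix.mul_assoc, ← Matrix.mul_assoc (R.mat b), hb,
      Matrix.one_mul, ha]
  one_mem' := by simp [mat_one]
  inv_mem' := by
    intro a ha
    simp only [Set.mem_ofPred_eq] at *
    have h1 : R.mat a⁻¹ * R.mat a = 1 := by rw [← mat_mul, inv_mul_cancel, mat_one]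
    have h2 : R.mat a⁻¹ = (R.mat a)ᵀ := by
      calc R.mat a⁻¹ = R.mat a⁻¹ * (R.mat a * (R.mat a)ᵀ) := by rw [ha, Matrix.mul_one]
        _ = (R.mat a)ᵀ := by rw [← Matrix.mul_assoc, h1, Matrix.one_mul]
    rw [h2, Matrix.transpose_transpose, ← h2, h1]

/-- `α`-weight space of `𝔞` in `Lie(G)`. -/
def weightSpace (𝔞 : Submodule ℝ (Matrix (Fin m) (Fin m) ℝ)) (α : Module.Dual ℝ 𝔞) :
    Set (Matrix (Fin m) (Fin m) ℝ) :=
  {X | X ∈ R.lie ∧ ∀ Y : 𝔞, (Y : Matrix (Fin m) (Fin m) ℝ) * X - X * Y = α Y • X}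

/-- The restricted roots of `(Lie(G), 𝔞)`. -/
def IsRoot (𝔞 : Submodule ℝ (Matrix (Fin m) (Fin m) ℝ)) (α : Module.Dual ℝ 𝔞) : Prop :=
  α ≠ 0 ∧ ∃ X ∈ R.weightSpace 𝔞 α, X ≠ 0

/-- The choices that determine an Iwasawa decomposition (with `K` given): a maximal abelian
subspace `𝔞` of the `-1` eigenspace of the Cartan involution on `Lie(G)`, and a system of positive
roots, the roots that are positive on a regular element `H` of `𝔞`. -/
structure IwasawaDatum where
  𝔞 : Submodule ℝ (Matrix (Fin m) (Fin m) ℝ)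
  mem_lie : ∀ Y ∈ 𝔞, Y ∈ R.lie
  symm : ∀ Y ∈ 𝔞, Yᵀ = Y
  comm : ∀ Y ∈ 𝔞, ∀ Z ∈ 𝔞, Y * Z = Z * Y
  maximal : ∀ Z ∈ R.lie, Zᵀ = Z → (∀ Y ∈ 𝔞, Y * Z = Z * Y) → Z ∈ 𝔞
  H : 𝔞
  regular : ∀ α : Module.Dual ℝ 𝔞, R.IsRoot 𝔞 α → α H ≠ 0

/-- An element of `G` is unipotent if it is the exponential of a nilpotent element of `Lie(G)`. -/
def IsUnipotent (g : G) : Prop := ∃ X ∈ R.lie, IsNilpotent X ∧ R.IsExp X g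

/-- The unipotent radical of `P`: the largest normal subgroup of `P` all of whose elements are
unipotent. -/
def unipotentRadical (P : Subgroup G) : Subgroup G :=
  sSup {U | U ≤ P ∧ P ≤ Subgroup.normalizer (U : Set G) ∧ ∀ u ∈ U, R.IsUnipotent u}

namespace IwasawaDatum

variable {R} (D : R.IwasawaDatum)

/-- `Φ(N)`: the positive roots. -/
def posRoots : Set (Module.Dual ℝ D.𝔞) := {α | R.IsRoot D.𝔞 α ∧ 0 < α D.H}

/-- `Lie(N)`: the sum of the positive root spaces. -/
def 𝔫 : Submodule ℝ (Matrix (Fin m) (Fin m) ℝ) :=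
  Submodule.span ℝ {X | ∃ α ∈ D.posRoots, X ∈ R.weightSpace D.𝔞 α}

/-- The maximal unipotent subgroup `N`. -/
def N : Subgroup G := R.analyticSubgroup (D.𝔫 : Set (Matrix (Fin m) (Fin m) ℝ))

/-- `θ(N)`, the image of `N` under the Cartan involution: its Lie algebra is
`{-Xᵀ | X ∈ Lie(N)}`. -/
def thetaN : Subgroup G := R.analyticSubgroup {Y | ∃ X ∈ D.𝔫, Y = -Xᵀ}

/-- The identity component `A` of the maximal `ℝ`-split torus. -/
def A : Subgroup G := R.analyticSubgroup (D.𝔞 : Set (Matrix (Fin m) (Fin m) ℝ))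

lemma mat_exp_mul {Y X : Matrix (Fin m) (Fin m) ℝ} {c : ℝ} (h : Y * X - X * Y = c • X) :
    NormedSpace.exp Y * X = Real.exp c • (X * NormedSpace.exp Y) := by
  let _ : NormedRing (Matrix (Fin m) (Fin m) ℝ) := Matrix.linftyOpNormedRing
  let _ : NormedAlgebra ℝ (Matrix (Fin m) (Fin m) ℝ) := Matrix.linftyOpNormedAlgebra
  let _ : NormedAlgebra ℚ (Matrix (Fin m) (Fin m) ℝ) := NormedAlgebra.restrictScalars ℚ ℝ _
  have h1 : SemiconjBy X (Y + algebraMap ℝ _ c) Y := by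
    unfold SemiconjBy
    rw [mul_add, ← Algebra.commutes, ← Algebra.smul_def, ← h]
    abel
  have h2 := h1.exp_right
  rw [NormedSpace.exp_add_of_commute (Algebra.commutes c Y).symm,
    ← NormedSpace.algebraMap_exp_comm] at h2
  unfold SemiconjBy at h2
  refine h2.symm.trans ?_
  rw [← Real.exp_eq_exp_ℝ, ← mul_assoc, ← Algebra.commutes, ← Algebra.smul_def]
  rfl

/-- `A` acts by scalars on each root space. -/
lemma Ad_weightSpace {a : G} (ha : a ∈ D.A) (α : Module.Dual ℝ D.𝔞) :
    ∃ c : ℝ, c ≠ 0 ∧ ∀ X ∈ R.weightSpace D.𝔞 α, R.Ad a X = c • X := by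
  have key : ∀ (a : G) (c : ℝ) (X : Matrix (Fin m) (Fin m) ℝ),
      R.mat a * X = c • (X * R.mat a) → R.Ad a X = c • X := by
    intro a c X h
    rw [Ad_apply, ← mul_assoc, h, smul_mul_assoc, mul_assoc, ← mat_mul, mul_inv_cancel, mat_one,
      mul_one]
  induction ha using Subgroup.closure_induction with
  | mem x hx =>
    obtain ⟨Y, hY, γ, -, -, hγ, rfl⟩ := hx
    refine ⟨Real.exp (α ⟨Y, hY⟩), (Real.exp_pos _).ne', fun X hX => key _ _ _ ?_⟩
    have := mat_exp_mul (hX.2 ⟨Y, hY⟩)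
    rw [hγ, one_smul, this]
  | one => exact ⟨1, one_ne_zero, fun X _ => key _ _ _ (by simp [mat_one])⟩
  | mul x y _ _ hx hy =>
    obtain ⟨c, hc, h⟩ := hx
    obtain ⟨d, hd, h'⟩ := hy
    refine ⟨d * c, mul_ne_zero hd hc, fun X hX => ?_⟩
    have : R.Ad (x * y) X = R.Ad x (R.Ad y X) := by
      simp only [Ad_apply, mul_inv_rev, mat_mul, mul_assoc]
    rw [this, h' X hX, map_smul, h X hX, smul_smul]
  | inv x _ hx =>
    obtain ⟨c, hc, h⟩ := hx
    refine ⟨c⁻¹, inv_ne_zero hc, fun X hX => ?_⟩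
    have h1 : R.Ad x⁻¹ (R.Ad x X) = X := by
      have e : R.mat x⁻¹ * R.mat x = 1 := by rw [← mat_mul, inv_mul_cancel, mat_one]
      simp only [Ad_apply, inv_inv]
      rw [mul_assoc, mul_assoc X, e, mul_one, ← mul_assoc, e, one_mul]
    rw [h X hX, map_smul] at h1
    rw [eq_inv_smul_iff₀ hc, h1]

lemma Ad_mem_𝔫 (a : D.A) : ∀ X ∈ D.𝔫, R.Ad a X ∈ D.𝔫 := by
  intro X hX
  induction hX using Submodule.span_induction with
  | mem x hx =>
    obtain ⟨α, hα, hx⟩ := hx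
    obtain ⟨c, -, h⟩ := D.Ad_weightSpace a.2 α
    rw [h x hx]
    exact D.𝔫.smul_mem _ (Submodule.subset_span ⟨α, hα, hx⟩)
  | zero => simp
  | add x y _ _ hx hy => rw [map_add]; exact D.𝔫.add_mem hx hy
  | smul c x _ hx => rw [map_smul]; exact D.𝔫.smul_mem _ hx

/-- `a ^ ρ = (det (Ad(a) on Lie(N))) ^ (1/2)` for `a ∈ A`. -/
def powRho (a : D.A) : ℝ :=
  Real.sqrt (LinearMap.det ((R.Ad (a : G)).restrict (D.Ad_mem_𝔫 a)))

open Classical in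
/-- The factor `a(g) ∈ A` of `g` in the Iwasawa decomposition `G = θ(N) A K`. -/
def aPart (g : G) : D.A :=
  if h : ∃ a : D.A, ∃ v ∈ D.thetaN, ∃ k ∈ R.K, g = v * a * k then h.choose else 1

/-- `A⁺ = {a ∈ A | a ^ α ≥ 1 for all α ∈ Φ(N)}`, where `(exp Y) ^ α = e ^ (α(Y))`. -/
def APlus : Set D.A :=
  {a | ∃ Y : D.𝔞, R.IsExp (Y : Matrix (Fin m) (Fin m) ℝ) (a : G) ∧
    ∀ α ∈ D.posRoots, 1 ≤ Real.exp (α Y)}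

open Classical in
/-- The norm `‖g‖ = a ^ ρ` for `g = k₁ a k₂` with `k₁, k₂ ∈ K` and `a ∈ A⁺`
(`G = K A⁺ K`, and the value does not depend on the decomposition). -/
def gnorm (g : G) : ℝ :=
  if h : ∃ a ∈ D.APlus, ∃ k₁ ∈ R.K, ∃ k₂ ∈ R.K, g = k₁ * (a : G) * k₂ then D.powRho h.choose
  else 1

/-- `G` is tame: `∫_{[N,N]} a(n)^{-ρ} (1 + log a(n)^ρ)^d dn < ∞` for all `d > 0`, with respect to
Haar measure on `[N, N]`. -/
def IsTame [MeasurableSpace G] : Prop :=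
  ∀ μ : Measure ↥⁅D.N, D.N⁆, μ.IsHaarMeasure → ∀ d : ℝ, 0 < d →
    ∫⁻ n, ENNReal.ofReal ((D.powRho (D.aPart (n : G)))⁻¹ *
      (1 + Real.log (D.powRho (D.aPart (n : G)))) ^ d) ∂μ < ∞

/-- `P` is a standard parabolic subgroup: it contains a conjugate of the normalizer of `N`, it is
its own normalizer, and it contains `N`. -/
structure IsStandardParabolic (P : Subgroup G) : Prop where
  contains_conj : ∃ g : G, ∀ x ∈ Subgroup.normalizer (D.N : Set G), g * x * g⁻¹ ∈ P
  self_normalizing : Subgroup.normalizer (P : Set G) = P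
  N_le : D.N ≤ P

end IwasawaDatum

end RealReductiveGroup

end

noncomputable section

namespace RealReductiveGroup

open scoped Matrix.Norms.Frobenius
open Polynomial Filter Topology

variable {m : ℕ}

/-! ### Exponential and logarithm of nilpotent and unipotent matrices -/

/-! Two properties of a(g)^ρ carry the proof, and both come from one formula, `gram_eq`: a(g)^{4ρ}
is the Gram determinant of Ad(gᵀ) restricted to Lie(N), for the inner product tr(XᵀY). Indeed, if g
= vak then gᵀ = kᵀaᵀvᵀ; here vᵀ acts on Lie(N) with determinant 1, aᵀ = a acts with determinant
a^{2ρ}, and kᵀ acts isometrically. The existence of the decomposition g = vak (`exists_iwasawa`) is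
proved by minimising a proper function on θ(N)A.

First property: right translation by x changes the Gram determinant by a factor bounded in terms of
the matrix norms of x and x⁻¹, so a(gx)^ρ and a(g)^ρ are comparable, uniformly for x in a compact
set (`exists_powRho_aPart_mul_le`).

Second property: on N the function a(n)^ρ is at least 1 and dominates a power of the size of n. For
n = exp X the compression of Ad(nᵀ) to Lie(N) has determinant 1, so the Gram determinant exceeds 1
by an amount that controls the component of Ad(nᵀ) perpendicular to Lie(N). Write a large Xᵀ as the
image of a unit vector under conjugation by exp(-sH). Relative to the part inside Lie(N), the
perpendicular part then gains a factor exponential in s, while ‖X‖ grows at most exponentially in s;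
hence log(1 + ‖X‖) ≤ C(1 + log a(n)^ρ) up to constants (`exists_log_norm_le`). As n is polynomial in
X, log ‖n‖ obeys the same bound (`exists_log_gnorm_le`), and the integrand is at most a constant
times the tameness integrand with exponent max(d, 1).

It remains to pass from [N,N] to [N_P,N_P]. A group of unipotent elements normalised by N lies in N
(`le_N_of_unipotent`), so N_P ⊂ N. Both N_P and the commutator subgroups are exponentials of linear
subspaces (`exists_unipotentRadical_eq`, `exists_commutator_eq`), so [N_P,N_P] is closed in the
locally compact group [N,N]. Finally a packing argument
(`lintegral_comp_lt_top_of_isClosedEmbedding`) shows that a function with the first property that is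
integrable over a group is integrable over every closed subgroup. -/

lemma matrix_pow_eq_zero {X : Matrix (Fin m) (Fin m) ℝ} (hX : IsNilpotent X) : X ^ m = 0 := by
  have h1 : IsNilpotent (Matrix.toLin' X) := by
    obtain ⟨k, hk⟩ := hX
    exact ⟨k, by rw [← Matrix.toLin'_pow, hk, map_zero]⟩
  have h2 := LinearMap.aeval_self_charpoly (Matrix.toLin' X)
  rw [h1.charpoly_eq_X_pow_finrank] at h2
  simp only [map_pow, aeval_X, Module.finrank_fin_fun] at h2
  rw [← Matrix.toLin'_pow] at h2
  exact Matrix.toLin'.injective (by rw [h2, map_zero])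

lemma exp_eq_sum_of_pow_eq_zero {X : Matrix (Fin m) (Fin m) ℝ} {k : ℕ} (h : X ^ k = 0) :
    NormedSpace.exp X = ∑ i ∈ Finset.range k, ((i.factorial : ℝ)⁻¹) • X ^ i := by
  rw [NormedSpace.exp_eq_tsum ℝ]
  refine tsum_eq_sum fun b hb => ?_
  rw [Finset.mem_range, not_lt] at hb
  rw [pow_eq_zero_of_le hb h, smul_zero]

/-- The exponential series truncated at degree `m + 2`. -/
def truncExp (m : ℕ) : ℝ[X] := ∑ i ∈ Finset.range (m + 2), C ((i.factorial : ℝ)⁻¹) * X ^ i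

lemma aeval_truncExp {Y : Matrix (Fin m) (Fin m) ℝ} (hY : IsNilpotent Y) :
    aeval Y (truncExp m) = NormedSpace.exp Y := by
  rw [exp_eq_sum_of_pow_eq_zero (k := m + 2) (pow_eq_zero_of_le (by omega) (matrix_pow_eq_zero hY))]
  simp [truncExp, Algebra.smul_def]

/-- For a nilpotent matrix `m` terms of the series already suffice; the two extra ones guarantee
that 1 and X occur even when `m` is 0 or 1. -/
lemma truncExp_eq (m : ℕ) : ∃ e : ℝ[X], truncExp m = 1 + X + X ^ 2 * e := by
  refine ⟨∑ i ∈ Finset.range m, C (((i + 2).factorial : ℝ)⁻¹) * X ^ i, ?_⟩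
  rw [truncExp, Finset.sum_range_succ', Finset.sum_range_succ', Finset.mul_sum]
  simp only [Nat.factorial_zero, Nat.factorial_one, Nat.cast_one, inv_one, map_one, pow_zero,
    zero_add, mul_one, one_mul, pow_one]
  rw [add_comm, add_comm _ X, ← add_assoc]
  congr 1
  exact Finset.sum_congr rfl fun i _ => by ring

lemma isNilpotent_aeval_X_mul {x : Matrix (Fin m) (Fin m) ℝ} (hx : IsNilpotent x) (p : ℝ[X]) :
    IsNilpotent (aeval x (X * p)) := by
  rw [map_mul, aeval_X]
  exact Commute.isNilpotent_mul_right (by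
    have := Commute.all (X : ℝ[X]) p
    simpa using this.map (aeval x)) hx

lemma exp_add_of_commute' {A B : Matrix (Fin m) (Fin m) ℝ} (h : Commute A B) :
    NormedSpace.exp (A + B) = NormedSpace.exp A * NormedSpace.exp B :=
  Matrix.exp_add_of_commute A B h

lemma exp_neg_mul_exp (A : Matrix (Fin m) (Fin m) ℝ) :
    NormedSpace.exp (-A) * NormedSpace.exp A = 1 := by
  rw [← exp_add_of_commute' (Commute.neg_left (Commute.refl A)), neg_add_cancel,
    NormedSpace.exp_zero]

lemma exp_mul_exp_neg (A : Matrix (Fin m) (Fin m) ℝ) :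
    NormedSpace.exp A * NormedSpace.exp (-A) = 1 := by
  simpa using exp_neg_mul_exp (-A)

/-- Successive approximation of log(1 + x): if the error is 1 + y with y = x^(k+2) r(x), adding y to
the approximate logarithm replaces it by exp(-y)(1 + y) = 1 + O(y²), of higher order in x. All
corrections are polynomials in x, so they commute. -/
lemma exp_log_approx (m k : ℕ) : ∃ s r : ℝ[X], ∀ x : Matrix (Fin m) (Fin m) ℝ, IsNilpotent x →
    NormedSpace.exp (-aeval x (X * (1 + X * s))) * (1 + x) = 1 + aeval x (X ^ (k + 2) * r) := by
  obtain ⟨e, he⟩ := truncExp_eq m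
  induction k with
  | zero =>
    refine ⟨0, -1 + e.comp (-X) * (1 + X), fun x hx => ?_⟩
    rw [← map_neg, ← aeval_truncExp (by
      rw [map_neg]; exact (isNilpotent_aeval_X_mul hx _).neg), ← aeval_comp, he]
    nth_rewrite 2 [show x = aeval x (X : ℝ[X]) by simp]
    rw [← map_one (aeval x (R := ℝ)), ← map_add, ← map_mul, ← map_add]
    congr 1
    simp
    ring
  | succ k ih =>
    obtain ⟨s, r, h⟩ := ih
    refine ⟨s + X ^ k * r, X ^ (k + 1) * r * r * (-1 +
      e.comp (-(X ^ (k + 2) * r)) * (1 + X ^ (k + 2) * r)), fun x hx => ?_⟩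
    have hn : IsNilpotent (aeval x (-(X ^ (k + 2) * r))) := by
      have := (isNilpotent_aeval_X_mul hx (-(X ^ (k + 1) * r)))
      convert this using 2
      ring
    have e1 : -aeval x (X * (1 + X * (s + X ^ k * r))) =
        aeval x (-(X ^ (k + 2) * r)) + -aeval x (X * (1 + X * s)) := by
      rw [← map_neg, ← map_neg, ← map_add]
      congr 1
      ring
    have hc : Commute (aeval x (-(X ^ (k + 2) * r))) (-aeval x (X * (1 + X * s))) :=
      ((Commute.all (-(X ^ (k + 2) * r)) (X * (1 + X * s))).map (aeval (R := ℝ) x)).neg_right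
    rw [e1, exp_add_of_commute' hc, mul_assoc, h x hx,
      ← aeval_truncExp hn, ← aeval_comp, he]
    rw [← map_one (aeval x (R := ℝ)), ← map_add, ← map_mul, ← map_add]
    congr 1
    simp
    ring

lemma exists_logPoly (m : ℕ) : ∃ s : ℝ[X], ∀ x : Matrix (Fin m) (Fin m) ℝ, IsNilpotent x →
    NormedSpace.exp (aeval x (X * (1 + X * s))) = 1 + x := by
  obtain ⟨s, r, h⟩ := exp_log_approx m m
  refine ⟨s, fun x hx => ?_⟩
  have h1 := h x hx
  rw [map_mul (aeval (R := ℝ) x) (X ^ (m + 2)), map_pow, aeval_X,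
    pow_eq_zero_of_le (by omega) (matrix_pow_eq_zero hx), zero_mul, add_zero] at h1
  calc _ = NormedSpace.exp (aeval x (X * (1 + X * s))) *
      (NormedSpace.exp (-aeval x (X * (1 + X * s))) * (1 + x)) := by rw [h1, mul_one]
    _ = _ := by rw [← mul_assoc, exp_mul_exp_neg, one_mul]

/-- The cofactor `s` in the logarithm polynomial `X (1 + X s)`. -/
def logCofactor (m : ℕ) : ℝ[X] := (exists_logPoly m).choose

/-- The logarithm of a unipotent matrix, as a polynomial in the matrix. -/
def logU (g : Matrix (Fin m) (Fin m) ℝ) : Matrix (Fin m) (Fin m) ℝ :=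
  aeval (g - 1) (X * (1 + X * logCofactor m))

lemma exp_logU {g : Matrix (Fin m) (Fin m) ℝ} (hg : IsNilpotent (g - 1)) :
    NormedSpace.exp (logU g) = g := by
  rw [logU, logCofactor, (exists_logPoly m).choose_spec _ hg]
  abel

lemma isNilpotent_logU {g : Matrix (Fin m) (Fin m) ℝ} (hg : IsNilpotent (g - 1)) :
    IsNilpotent (logU g) := isNilpotent_aeval_X_mul hg _

lemma exp_sub_one_eq {Y : Matrix (Fin m) (Fin m) ℝ} (hY : IsNilpotent Y) :
    ∃ e : ℝ[X], NormedSpace.exp Y - 1 = aeval Y (X * (1 + X * e)) := by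
  obtain ⟨e, he⟩ := truncExp_eq m
  refine ⟨e, ?_⟩
  rw [← aeval_truncExp hY, he, ← map_one (aeval Y (R := ℝ)), ← map_sub]
  congr 1
  ring

lemma isNilpotent_exp_sub_one {Y : Matrix (Fin m) (Fin m) ℝ} (hY : IsNilpotent Y) :
    IsNilpotent (NormedSpace.exp Y - 1) := by
  obtain ⟨e, he⟩ := exp_sub_one_eq hY
  rw [he]
  exact isNilpotent_aeval_X_mul hY _

/-- exp Y - 1 is Y times 1 plus a nilpotent matrix, hence Y times a unit. -/
lemma eq_zero_of_exp_eq_one {Y : Matrix (Fin m) (Fin m) ℝ} (hY : IsNilpotent Y)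
    (h : NormedSpace.exp Y = 1) : Y = 0 := by
  obtain ⟨e, he⟩ := exp_sub_one_eq hY
  rw [h, sub_self, map_mul (aeval (R := ℝ) Y), aeval_X] at he
  have hu : IsUnit (aeval Y (1 + X * e)) := by
    rw [map_add, map_one]
    exact (isNilpotent_aeval_X_mul hY e).isUnit_one_add
  exact (hu.mul_left_eq_zero).mp he.symm

/-- `logU (exp Y)` is a polynomial in Y, so it commutes with Y; the difference is nilpotent with
exponential 1. -/
lemma logU_exp {Y : Matrix (Fin m) (Fin m) ℝ} (hY : IsNilpotent Y) :
    logU (NormedSpace.exp Y) = Y := by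
  have h1 := isNilpotent_exp_sub_one hY
  obtain ⟨e, he⟩ := exp_sub_one_eq hY
  have hc : Commute (logU (NormedSpace.exp Y)) Y := by
    rw [logU, he, ← aeval_comp]
    have := (Commute.all ((X * (1 + X * logCofactor m)).comp (X * (1 + X * e))) X).map (aeval (R := ℝ) Y)
    simpa using this
  have h2 : NormedSpace.exp (logU (NormedSpace.exp Y) + -Y) = 1 := by
    rw [exp_add_of_commute' hc.neg_right, exp_logU h1, exp_mul_exp_neg]
  have h3 := eq_zero_of_exp_eq_one (by
    rw [← sub_eq_add_neg]
    exact hc.isNilpotent_sub (isNilpotent_logU h1) hY) h2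
  rwa [add_neg_eq_zero] at h3

lemma exp_injOn_nilpotent {X Y : Matrix (Fin m) (Fin m) ℝ} (hX : IsNilpotent X)
    (hY : IsNilpotent Y) (h : NormedSpace.exp X = NormedSpace.exp Y) : X = Y := by
  rw [← logU_exp hX, h, logU_exp hY]

lemma continuous_logU : Continuous (logU : Matrix (Fin m) (Fin m) ℝ → _) := by
  unfold logU
  exact (Polynomial.continuous_aeval _).comp (continuous_id.sub continuous_const)

lemma continuous_mexp : Continuous (NormedSpace.exp : Matrix (Fin m) (Fin m) ℝ → _) :=
  let _ : NormedAlgebra ℚ (Matrix (Fin m) (Fin m) ℝ) := NormedAlgebra.restrictScalars ℚ ℝ _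
  NormedSpace.exp_continuous

lemma hasDerivAt_mexp (A : Matrix (Fin m) (Fin m) ℝ) (t : ℝ) :
    HasDerivAt (fun t : ℝ => NormedSpace.exp (t • A)) (NormedSpace.exp (t • A) * A) t :=
  hasDerivAt_exp_smul_const A t

/-! ### The Trotter formula -/

lemma hasDerivAt_mul_exp (A B : Matrix (Fin m) (Fin m) ℝ) :
    HasDerivAt (fun t : ℝ => NormedSpace.exp (t • A) * NormedSpace.exp (t • B)) (A + B) 0 := by
  have h := (hasDerivAt_mexp A 0).mul (hasDerivAt_mexp B 0)
  rw [show NormedSpace.exp ((0 : ℝ) • A) * A * NormedSpace.exp ((0 : ℝ) • B) +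
    NormedSpace.exp ((0 : ℝ) • A) * (NormedSpace.exp ((0 : ℝ) • B) * B) = A + B by simp] at h
  exact h

/-- The factor ‖1‖ is needed because the Frobenius norm of the identity is √m. Splitting x = 1 + (x
- 1) at each step keeps it from accumulating. -/
lemma norm_one_add_pow_le {x : Matrix (Fin m) (Fin m) ℝ} {ε : ℝ} (hx : ‖x - 1‖ ≤ ε) (n : ℕ) :
    ‖x ^ n‖ ≤ (1 + ε) ^ n * ‖(1 : Matrix (Fin m) (Fin m) ℝ)‖ := by
  induction n with
  | zero => simp
  | succ n ih =>
    have e : x ^ (n + 1) = x ^ n + (x - 1) * x ^ n := by rw [pow_succ']; noncomm_ring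
    have hε : 0 ≤ ε := (norm_nonneg _).trans hx
    calc ‖x ^ (n + 1)‖ ≤ ‖x ^ n‖ + ‖x - 1‖ * ‖x ^ n‖ := by
          rw [e]; exact (norm_add_le _ _).trans (by gcongr; exact norm_mul_le _ _)
      _ = (1 + ‖x - 1‖) * ‖x ^ n‖ := by ring
      _ ≤ (1 + ε) * ((1 + ε) ^ n * ‖(1 : Matrix (Fin m) (Fin m) ℝ)‖) := by gcongr
      _ = _ := by ring

lemma norm_pow_sub_pow_le {x y : Matrix (Fin m) (Fin m) ℝ} {ε : ℝ} (hx : ‖x - 1‖ ≤ ε)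
    (hy : ‖y - 1‖ ≤ ε) (n : ℕ) : ‖x ^ n - y ^ n‖ ≤
      n * ‖x - y‖ * ((1 + ε) ^ n * ‖(1 : Matrix (Fin m) (Fin m) ℝ)‖) := by
  have hε : 0 ≤ ε := (norm_nonneg _).trans hx
  induction n with
  | zero => simp
  | succ n ih =>
    have e : x ^ (n + 1) - y ^ (n + 1) =
        ((x ^ n - y ^ n) + (x - 1) * (x ^ n - y ^ n)) + (x - y) * y ^ n := by
      rw [pow_succ', pow_succ']; noncomm_ring
    have hyn := norm_one_add_pow_le hy n
    set N := ‖(1 : Matrix (Fin m) (Fin m) ℝ)‖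
    have hN : 0 ≤ N := norm_nonneg _
    have h1 : (1 + ε) ^ n ≤ (1 + ε) ^ (n + 1) := pow_le_pow_right₀ (by linarith) (by omega)
    calc ‖x ^ (n + 1) - y ^ (n + 1)‖
        ≤ (‖x ^ n - y ^ n‖ + ‖x - 1‖ * ‖x ^ n - y ^ n‖) + ‖x - y‖ * ‖y ^ n‖ := by
          rw [e]
          exact (norm_add_le _ _).trans (add_le_add ((norm_add_le _ _).trans (by
            gcongr; exact norm_mul_le _ _)) (norm_mul_le _ _))
      _ = (1 + ‖x - 1‖) * ‖x ^ n - y ^ n‖ + ‖x - y‖ * ‖y ^ n‖ := by ring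
      _ ≤ (1 + ε) * (n * ‖x - y‖ * ((1 + ε) ^ n * N)) + ‖x - y‖ * ((1 + ε) ^ n * N) := by
          gcongr
      _ ≤ (1 + ε) * (n * ‖x - y‖ * ((1 + ε) ^ n * N)) + ‖x - y‖ * ((1 + ε) ^ (n + 1) * N) := by
          gcongr
      _ = _ := by push_cast; ring

/-- If a curve `c` of matrices has `c 0 = 1` and derivative `L` at `0`, then `c (1/n) ^ n` tends
to `exp L`. -/
lemma tendsto_pow_exp_of_hasDerivAt {c : ℝ → Matrix (Fin m) (Fin m) ℝ}
    {L : Matrix (Fin m) (Fin m) ℝ} (h0 : c 0 = 1) (hc : HasDerivAt c L 0) :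
    Tendsto (fun n : ℕ => c ((n : ℝ)⁻¹) ^ n) atTop (𝓝 (NormedSpace.exp L)) := by
  have hlim : ∀ {c : ℝ → Matrix (Fin m) (Fin m) ℝ}, c 0 = 1 → HasDerivAt c L 0 →
      Tendsto (fun n : ℕ => (n : ℝ) • (c ((n : ℝ)⁻¹) - 1)) atTop (𝓝 L) := by
    intro c h0 hc
    have h1 := hc.tendsto_slope_zero_right
    have h2 : Tendsto (fun n : ℕ => ((n : ℝ)⁻¹)) atTop (𝓝[>] 0) := by
      refine tendsto_nhdsWithin_iff.mpr ⟨tendsto_inv_atTop_nhds_zero_nat, ?_⟩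
      filter_upwards [eventually_gt_atTop 0] with n hn
      exact inv_pos.mpr (show (0 : ℝ) < n from Nat.cast_pos.mpr hn)
    refine (h1.comp h2).congr fun n => ?_
    simp [h0]
  have hx := hlim h0 hc
  have hd : HasDerivAt (fun t : ℝ => NormedSpace.exp (t • L)) L 0 := by
    simpa using hasDerivAt_mexp L 0
  have hy := hlim (by simp) hd
  have hxy : Tendsto (fun n : ℕ => n * ‖c ((n : ℝ)⁻¹) - NormedSpace.exp ((n : ℝ)⁻¹ • L)‖) atTop
      (𝓝 0) := by
    have := (hx.sub hy).norm
    rw [sub_self, norm_zero] at this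
    refine this.congr fun n => ?_
    rw [← smul_sub, norm_smul, sub_sub_sub_cancel_right]
    simp
  set N := ‖(1 : Matrix (Fin m) (Fin m) ℝ)‖
  -- Both bases are within (‖L‖ + 1)/n of 1, so their powers up to n are bounded by a multiple of
  -- exp(‖L‖ + 1), and the difference of the n-th powers is at most a constant times n · o(1/n).
  have hbd : ∀ᶠ n : ℕ in atTop, ‖c ((n : ℝ)⁻¹) ^ n - NormedSpace.exp L‖ ≤
      n * ‖c ((n : ℝ)⁻¹) - NormedSpace.exp ((n : ℝ)⁻¹ • L)‖ * (Real.exp (‖L‖ + 1) * N) := by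
    filter_upwards [hx.norm.eventually (ge_mem_nhds (lt_add_one ‖L‖)),
      hy.norm.eventually (ge_mem_nhds (lt_add_one ‖L‖)), eventually_gt_atTop 0] with n h1 h2 hn
    have hn' : (0 : ℝ) < n := by exact_mod_cast hn
    rw [norm_smul, Real.norm_of_nonneg hn'.le, ← le_div_iff₀' hn'] at h1 h2
    have h3 := norm_pow_sub_pow_le h1 h2 n
    have h4 : NormedSpace.exp ((n : ℝ)⁻¹ • L) ^ n = NormedSpace.exp L := by
      rw [← Matrix.exp_nsmul, ← Nat.cast_smul_eq_nsmul ℝ, smul_smul, mul_inv_cancel₀ hn'.ne',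
        one_smul]
    rw [h4] at h3
    refine h3.trans ?_
    have h5 : (1 + (‖L‖ + 1) / n) ^ n ≤ Real.exp (‖L‖ + 1) := by
      calc (1 + (‖L‖ + 1) / n) ^ n ≤ (Real.exp ((‖L‖ + 1) / n)) ^ n := by
            gcongr
            rw [add_comm]
            exact Real.add_one_le_exp _
        _ = Real.exp (‖L‖ + 1) := by
            rw [← Real.exp_nat_mul, mul_div_cancel₀ _ hn'.ne']
    gcongr
  refine tendsto_iff_norm_sub_tendsto_zero.mpr ?_
  refine squeeze_zero' (Eventually.of_forall fun _ => norm_nonneg _) hbd ?_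
  simpa using hxy.mul_const (Real.exp (‖L‖ + 1) * N)

/-- The Trotter product formula. -/
lemma tendsto_trotter (A B : Matrix (Fin m) (Fin m) ℝ) :
    Tendsto (fun n : ℕ => (NormedSpace.exp ((n : ℝ)⁻¹ • A) * NormedSpace.exp ((n : ℝ)⁻¹ • B)) ^ n)
      atTop (𝓝 (NormedSpace.exp (A + B))) :=
  tendsto_pow_exp_of_hasDerivAt (c := fun t => NormedSpace.exp (t • A) * NormedSpace.exp (t • B))
    (by simp) (hasDerivAt_mul_exp A B)

/-! ### Exponential polynomials that vanish on the natural numbers -/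

/-- A real function of the form `t ↦ p (t)` with `p` a polynomial. -/
def IsPolyFun (f : ℝ → ℝ) : Prop := ∃ p : ℝ[X], ∀ t, f t = p.eval t

/-- This and its analogue for exponential sums replace integer powers by a whole one-parameter
group: an equation of a Zariski closed group that holds on all powers g^k then holds on all exp(t
log g). -/
lemma IsPolyFun.eq_zero {f : ℝ → ℝ} (hf : IsPolyFun f) (h : ∀ k : ℕ, f k = 0) (t : ℝ) :
    f t = 0 := by
  obtain ⟨p, hp⟩ := hf
  have : p = 0 := Polynomial.eq_zero_of_infinite_isRoot p
    ((Set.infinite_range_of_injective Nat.cast_injective).mono (by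
      rintro _ ⟨k, rfl⟩
      show p.eval (k : ℝ) = 0
      rw [← hp, h]))
  rw [hp, this, eval_zero]

lemma isPolyFun_const (c : ℝ) : IsPolyFun fun _ => c := ⟨C c, by simp⟩

lemma IsPolyFun.add {f g : ℝ → ℝ} (hf : IsPolyFun f) (hg : IsPolyFun g) :
    IsPolyFun fun t => f t + g t := by
  obtain ⟨p, hp⟩ := hf
  obtain ⟨q, hq⟩ := hg
  exact ⟨p + q, by simp [hp, hq]⟩

lemma IsPolyFun.mul {f g : ℝ → ℝ} (hf : IsPolyFun f) (hg : IsPolyFun g) :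
    IsPolyFun fun t => f t * g t := by
  obtain ⟨p, hp⟩ := hf
  obtain ⟨q, hq⟩ := hg
  exact ⟨p * q, by simp [hp, hq]⟩

lemma IsPolyFun.sum {ι : Type*} {f : ι → ℝ → ℝ} {s : Finset ι} (hf : ∀ i ∈ s, IsPolyFun (f i)) :
    IsPolyFun fun t => ∑ i ∈ s, f i t := by
  classical
  induction s using Finset.induction_on with
  | empty => simpa using isPolyFun_const 0
  | insert a s ha ih =>
    simp only [Finset.sum_insert ha]
    exact (hf a (Finset.mem_insert_self _ _)).add
      (ih fun i hi => hf i (Finset.mem_insert_of_mem hi))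

lemma isPolyFun_exp {W : Matrix (Fin m) (Fin m) ℝ} (hW : IsNilpotent W) (i j : Fin m) :
    IsPolyFun fun t => NormedSpace.exp (t • W) i j := by
  refine ⟨∑ k ∈ Finset.range m, C ((k.factorial : ℝ)⁻¹ * (W ^ k) i j) * X ^ k, fun t => ?_⟩
  show NormedSpace.exp (t • W) i j = _
  rw [exp_eq_sum_of_pow_eq_zero (k := m) (by
    rw [_root_.smul_pow, matrix_pow_eq_zero hW, smul_zero])]
  simp only [Matrix.sum_apply, eval_finsetSum, eval_mul, eval_C, eval_pow, eval_X, Matrix.smul_apply,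
    _root_.smul_pow, smul_eq_mul]
  exact Finset.sum_congr rfl fun k _ => by ring

lemma IsPolyFun.mvPolynomial_eval {σ : Type*} {f : σ → ℝ → ℝ} (hf : ∀ i, IsPolyFun (f i))
    (F : MvPolynomial σ ℝ) : IsPolyFun fun t => MvPolynomial.eval (fun i => f i t) F := by
  induction F using MvPolynomial.induction_on with
  | C a => simpa using isPolyFun_const a
  | add p q hp hq => simpa using hp.add hq
  | mul_X p i hp => simpa using hp.mul (hf i)

/-- A finite sum `∑ cᵢ e ^ (λᵢ t)`. -/
def IsExpSum (f : ℝ → ℝ) : Prop := ∃ c : ℝ →₀ ℝ, ∀ t, f t = c.sum fun l a => a * Real.exp (l * t)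

/-- Dedekind independence of the distinct characters k ↦ e^(lk) of ℕ. -/
lemma IsExpSum.eq_zero {f : ℝ → ℝ} (hf : IsExpSum f) (h : ∀ k : ℕ, f k = 0) (t : ℝ) :
    f t = 0 := by
  obtain ⟨c, hc⟩ := hf
  have hli := linearIndependent_monoidHom (Multiplicative ℕ) ℝ
  let χ : ℝ → (Multiplicative ℕ →* ℝ) := fun l => powersHom ℝ (Real.exp l)
  have hχ : Function.Injective χ := fun l l' hl => by
    have := DFunLike.congr_fun hl (Multiplicative.ofAdd 1)
    simpa [χ] using this
  have h2 := hli.comp χ hχ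
  have h3 := (linearIndependent_iff.mp h2) c (by
    ext k
    have hk := h k.toAdd
    rw [hc, Finsupp.sum] at hk
    rw [Finsupp.linearCombination_apply, Finsupp.sum, Finset.sum_apply]
    refine Eq.trans (Finset.sum_congr rfl fun l _ => ?_) hk
    simp [χ, ← Real.exp_nat_mul, mul_comm])
  rw [hc, h3, Finsupp.sum_zero_index]

lemma IsExpSum.add {f g : ℝ → ℝ} (hf : IsExpSum f) (hg : IsExpSum g) :
    IsExpSum fun t => f t + g t := by
  obtain ⟨c, hc⟩ := hf
  obtain ⟨d, hd⟩ := hg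
  refine ⟨c + d, fun t => ?_⟩
  show f t + g t = _
  rw [hc, hd, Finsupp.sum_add_index' (by simp) (by intros; ring)]

lemma isExpSum_exp (a l : ℝ) : IsExpSum fun t => a * Real.exp (l * t) :=
  ⟨Finsupp.single l a, fun t => by rw [Finsupp.sum_single_index (by simp)]⟩

lemma IsExpSum.sum {ι : Type*} {f : ι → ℝ → ℝ} {s : Finset ι} (hf : ∀ i ∈ s, IsExpSum (f i)) :
    IsExpSum fun t => ∑ i ∈ s, f i t := by
  classical
  induction s using Finset.induction_on with
  | empty => exact ⟨0, by simp⟩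
  | insert a s ha ih =>
    simp only [Finset.sum_insert ha]
    exact (hf a (Finset.mem_insert_self _ _)).add
      (ih fun i hi => hf i (Finset.mem_insert_of_mem hi))

lemma IsExpSum.mul {f g : ℝ → ℝ} (hf : IsExpSum f) (hg : IsExpSum g) :
    IsExpSum fun t => f t * g t := by
  obtain ⟨c, hc⟩ := hf
  obtain ⟨d, hd⟩ := hg
  simp only [hc, hd, Finsupp.sum, Finset.sum_mul_sum]
  refine IsExpSum.sum fun i _ => IsExpSum.sum fun j _ => ?_
  convert isExpSum_exp (c i * d j) (i + j) using 2 with t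
  rw [add_mul, Real.exp_add]
  ring

lemma IsExpSum.mvPolynomial_eval {σ : Type*} {f : σ → ℝ → ℝ} (hf : ∀ i, IsExpSum (f i))
    (F : MvPolynomial σ ℝ) : IsExpSum fun t => MvPolynomial.eval (fun i => f i t) F := by
  induction F using MvPolynomial.induction_on with
  | C a => simpa using isExpSum_exp a 0
  | add p q hp hq => simpa using hp.add hq
  | mul_X p i hp => simpa using hp.mul (hf i)

end RealReductiveGroup

namespace RealReductiveGroup

open scoped Matrix.Norms.Frobenius
open Polynomial Filter Topology commutatorElement

variable {m : ℕ}

/-! ### Unipotent matrix groups and their commutator subgroups -/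

/-- The exponential as a map to `GL(m, ℝ)`. -/
def expGL (X : Matrix (Fin m) (Fin m) ℝ) : GL (Fin m) ℝ :=
  ⟨NormedSpace.exp X, NormedSpace.exp (-X), exp_mul_exp_neg X, exp_neg_mul_exp X⟩

@[simp] lemma coe_expGL (X : Matrix (Fin m) (Fin m) ℝ) :
    (expGL X : Matrix (Fin m) (Fin m) ℝ) = NormedSpace.exp X := rfl

@[simp] lemma expGL_zero : expGL (0 : Matrix (Fin m) (Fin m) ℝ) = 1 :=
  Units.ext (by simp [NormedSpace.exp_zero])

lemma expGL_neg (X : Matrix (Fin m) (Fin m) ℝ) : expGL (-X) = (expGL X)⁻¹ :=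
  eq_inv_of_mul_eq_one_left (Units.ext (exp_neg_mul_exp X))

lemma expGL_add_smul (s t : ℝ) (X : Matrix (Fin m) (Fin m) ℝ) :
    expGL ((s + t) • X) = expGL (s • X) * expGL (t • X) :=
  Units.ext (by
    simp only [coe_expGL, Units.val_mul, add_smul]
    exact exp_add_of_commute' (((Commute.refl X).smul_left s).smul_right t))

lemma expGL_inv_smul_pow (X : Matrix (Fin m) (Fin m) ℝ) {n : ℕ} (hn : n ≠ 0) :
    expGL ((n : ℝ)⁻¹ • X) ^ n = expGL X :=
  Units.ext (by
    rw [Units.val_pow_eq_pow_val, coe_expGL, coe_expGL, ← Matrix.exp_nsmul,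
      ← Nat.cast_smul_eq_nsmul ℝ, smul_smul, mul_inv_cancel₀ (by exact_mod_cast hn), one_smul])

/-- A nilpotent associative algebra of matrices. -/
structure IsNilAlgebra (U : Submodule ℝ (Matrix (Fin m) (Fin m) ℝ)) : Prop where
  mul_le : U * U ≤ U
  nil : ∃ k, U ^ k = ⊥

/-- `W ≤ U` is saturated if `exp W` is a group. -/
structure IsSaturated (U W : Submodule ℝ (Matrix (Fin m) (Fin m) ℝ)) : Prop where
  le : W ≤ U
  mul_mem : ∀ A ∈ W, ∀ B ∈ W, logU (NormedSpace.exp A * NormedSpace.exp B) ∈ W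

lemma aeval_X_mul_mem {J : Submodule ℝ (Matrix (Fin m) (Fin m) ℝ)} (hJ : J * J ≤ J)
    {x : Matrix (Fin m) (Fin m) ℝ} (hx : x ∈ J) (p : ℝ[X]) : aeval x (X * p) ∈ J := by
  have hpow : ∀ k : ℕ, x ^ (k + 1) ∈ J := by
    intro k
    induction k with
    | zero => simpa using hx
    | succ k ih => rw [pow_succ]; exact hJ (Submodule.mul_mem_mul ih hx)
  induction p using Polynomial.induction_on' with
  | add p q hp hq => rw [mul_add, map_add]; exact J.add_mem hp hq
  | monomial n a =>
    rw [X_mul_monomial, aeval_monomial, ← Algebra.smul_def]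
    exact J.smul_mem _ (hpow n)

lemma logU_mem {J : Submodule ℝ (Matrix (Fin m) (Fin m) ℝ)} (hJ : J * J ≤ J)
    {g : Matrix (Fin m) (Fin m) ℝ} (hg : g - 1 ∈ J) : logU g ∈ J :=
  aeval_X_mul_mem hJ hg _

namespace IsNilAlgebra

variable {U : Submodule ℝ (Matrix (Fin m) (Fin m) ℝ)} (hU : IsNilAlgebra U)
include hU

lemma isNilpotent {x : Matrix (Fin m) (Fin m) ℝ} (hx : x ∈ U) : IsNilpotent x := by
  obtain ⟨k, hk⟩ := hU.nil
  refine ⟨k, ?_⟩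
  have := Submodule.pow_mem_pow U hx k
  rwa [hk, Submodule.mem_bot] at this

lemma pow_succ_le (i : ℕ) : U ^ (i + 2) ≤ U ^ (i + 1) := by
  rw [pow_succ, pow_succ (n := i), mul_assoc]
  exact mul_le_mul' le_rfl hU.mul_le

lemma pow_le (i : ℕ) : U ^ (i + 1) ≤ U := by
  induction i with
  | zero => simp
  | succ i ih => exact (hU.pow_succ_le i).trans ih

lemma mul_pow_le (i : ℕ) : U ^ (i + 1) * U ≤ U ^ (i + 1) := by
  rw [← pow_succ]; exact hU.pow_succ_le i

lemma pow_mul_pow_le (i : ℕ) : U ^ (i + 1) * U ^ (i + 1) ≤ U ^ (i + 1) :=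
  (mul_le_mul' le_rfl (hU.pow_le i)).trans (hU.mul_pow_le i)

lemma exp_sub_one_mem (i : ℕ) {x : Matrix (Fin m) (Fin m) ℝ} (hx : x ∈ U ^ (i + 1)) :
    NormedSpace.exp x - 1 ∈ U ^ (i + 1) := by
  obtain ⟨e, he⟩ := exp_sub_one_eq (hU.isNilpotent (hU.pow_le i hx))
  rw [he]
  exact aeval_X_mul_mem (hU.pow_mul_pow_le i) hx _

lemma exp_sub_one_mem' {x : Matrix (Fin m) (Fin m) ℝ} (hx : x ∈ U) :
    NormedSpace.exp x - 1 ∈ U := by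
  simpa using hU.exp_sub_one_mem 0 (x := x) (by simpa using hx)

omit hU in
lemma mul_sub_one_mem {a b : Matrix (Fin m) (Fin m) ℝ} {J : Submodule ℝ (Matrix (Fin m) (Fin m) ℝ)}
    (hJ : J * J ≤ J) (ha : a - 1 ∈ J) (hb : b - 1 ∈ J) : a * b - 1 ∈ J := by
  have e : a * b - 1 = (a - 1) * (b - 1) + (a - 1) + (b - 1) := by noncomm_ring
  rw [e]
  exact J.add_mem (J.add_mem (hJ (Submodule.mul_mem_mul ha hb)) ha) hb

lemma isSaturated_pow (i : ℕ) : IsSaturated U (U ^ (i + 1)) where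
  le := hU.pow_le i
  mul_mem _ hA _ hB := logU_mem (hU.pow_mul_pow_le i)
    (mul_sub_one_mem (hU.pow_mul_pow_le i) (hU.exp_sub_one_mem i hA) (hU.exp_sub_one_mem i hB))

lemma isSaturated_self : IsSaturated U U := by simpa using hU.isSaturated_pow 0

lemma exp_logU_mul {A B : Matrix (Fin m) (Fin m) ℝ} (hA : A ∈ U) (hB : B ∈ U) :
    NormedSpace.exp (logU (NormedSpace.exp A * NormedSpace.exp B)) =
      NormedSpace.exp A * NormedSpace.exp B :=
  exp_logU (hU.isNilpotent (mul_sub_one_mem hU.mul_le (hU.exp_sub_one_mem' hA)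
    (hU.exp_sub_one_mem' hB)))

lemma expGL_injOn {A B : Matrix (Fin m) (Fin m) ℝ} (hA : A ∈ U) (hB : B ∈ U)
    (h : expGL A = expGL B) : A = B :=
  exp_injOn_nilpotent (hU.isNilpotent hA) (hU.isNilpotent hB) (congrArg Units.val h)

end IsNilAlgebra

/-- The group `exp W` for a saturated `W`. -/
def expSubgroup {U W : Submodule ℝ (Matrix (Fin m) (Fin m) ℝ)} (hU : IsNilAlgebra U)
    (hW : IsSaturated U W) : Subgroup (GL (Fin m) ℝ) where
  carrier := {g | ∃ X ∈ W, expGL X = g}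
  mul_mem' := by
    rintro _ _ ⟨A, hA, rfl⟩ ⟨B, hB, rfl⟩
    exact ⟨_, hW.mul_mem A hA B hB, Units.ext (hU.exp_logU_mul (hW.le hA) (hW.le hB))⟩
  one_mem' := ⟨0, W.zero_mem, expGL_zero⟩
  inv_mem' := by
    rintro _ ⟨A, hA, rfl⟩
    exact ⟨-A, W.neg_mem hA, expGL_neg A⟩

lemma expGL_mem_expSubgroup {U W : Submodule ℝ (Matrix (Fin m) (Fin m) ℝ)} {hU : IsNilAlgebra U}
    {hW : IsSaturated U W} {X : Matrix (Fin m) (Fin m) ℝ} (hX : X ∈ W) :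
    expGL X ∈ expSubgroup hU hW := ⟨X, hX, rfl⟩

lemma mem_of_expGL_mem_expSubgroup {U W : Submodule ℝ (Matrix (Fin m) (Fin m) ℝ)}
    {hU : IsNilAlgebra U} {hW : IsSaturated U W} {X : Matrix (Fin m) (Fin m) ℝ} (hX : X ∈ U)
    (h : expGL X ∈ expSubgroup hU hW) : X ∈ W := by
  obtain ⟨Y, hY, e⟩ := h
  rwa [← hU.expGL_injOn (hW.le hY) hX e]

lemma isSaturated_sInf {U : Submodule ℝ (Matrix (Fin m) (Fin m) ℝ)}
    {F : Set (Submodule ℝ (Matrix (Fin m) (Fin m) ℝ))} (hF : ∀ W ∈ F, IsSaturated U W)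
    (hne : F.Nonempty) : IsSaturated U (sInf F) where
  le := by
    obtain ⟨W, hW⟩ := hne
    exact (sInf_le hW).trans (hF W hW).le
  mul_mem A hA B hB := by
    rw [Submodule.mem_sInf] at *
    exact fun W hW => (hF W hW).mul_mem A (hA W hW) B (hB W hW)

/-- The smallest saturated subspace that contains `S`. -/
def satHull (U : Submodule ℝ (Matrix (Fin m) (Fin m) ℝ)) (S : Set (Matrix (Fin m) (Fin m) ℝ)) :
    Submodule ℝ (Matrix (Fin m) (Fin m) ℝ) :=
  sInf {W | IsSaturated U W ∧ S ⊆ W}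

lemma isSaturated_satHull {U : Submodule ℝ (Matrix (Fin m) (Fin m) ℝ)} (hU : IsNilAlgebra U)
    {S : Set (Matrix (Fin m) (Fin m) ℝ)} (hS : S ⊆ U) : IsSaturated U (satHull U S) :=
  isSaturated_sInf (fun _ h => h.1) ⟨U, hU.isSaturated_self, hS⟩

lemma subset_satHull {U : Submodule ℝ (Matrix (Fin m) (Fin m) ℝ)}
    {S : Set (Matrix (Fin m) (Fin m) ℝ)} : S ⊆ satHull U S := fun x hx => by
  rw [satHull, SetLike.mem_coe, Submodule.mem_sInf]
  exact fun W hW => hW.2 hx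

lemma satHull_le {U W : Submodule ℝ (Matrix (Fin m) (Fin m) ℝ)}
    {S : Set (Matrix (Fin m) (Fin m) ℝ)} (hW : IsSaturated U W) (h : S ⊆ W) : satHull U S ≤ W :=
  sInf_le ⟨hW, h⟩

/-- H contains the commutators of S, so it is normal in S with abelian quotient, and (xy)^n = x^n
y^n there. -/
lemma mul_pow_mem_of_commutator_mem {Γ : Type*} [Group Γ] {S H : Subgroup Γ} (hle : H ≤ S)
    (hc : ∀ x ∈ S, ∀ y ∈ S, ⁅x, y⁆ ∈ H) {x y : Γ} (hx : x ∈ S) (hy : y ∈ S) (n : ℕ) :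
    (x ^ n * y ^ n)⁻¹ * (x * y) ^ n ∈ H := by
  have hn : ∀ c ∈ H, ∀ z ∈ S, z⁻¹ * c * z ∈ H := by
    intro c hcH z hz
    have e : z⁻¹ * c * z = ⁅z⁻¹, c⁆ * c := by simp [commutatorElement_def]
    rw [e]
    exact H.mul_mem (hc _ (S.inv_mem hz) _ (hle hcH)) hcH
  induction n with
  | zero => simp
  | succ n ih =>
    have e : (x ^ (n + 1) * y ^ (n + 1))⁻¹ * (x * y) ^ (n + 1) =
        y⁻¹ * (⁅(y ^ n)⁻¹, x⁻¹⁆ * (x⁻¹ * ((x ^ n * y ^ n)⁻¹ * (x * y) ^ n) * x)) * y := by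
      simp only [commutatorElement_def, pow_succ]
      group
    rw [e]
    exact hn _ (H.mul_mem (hc _ (S.inv_mem (S.pow_mem hy n)) _ (S.inv_mem hx)) (hn _ ih _ hx)) _ hy

/-- The logarithm of the commutator of `exp A` and `exp B`. -/
def commLog (A B : Matrix (Fin m) (Fin m) ℝ) : Matrix (Fin m) (Fin m) ℝ :=
  logU (NormedSpace.exp A * NormedSpace.exp B * NormedSpace.exp (-A) * NormedSpace.exp (-B))

lemma continuous_commLog (A B : Matrix (Fin m) (Fin m) ℝ) :
    Continuous fun t : ℝ => commLog (t • A) B := by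
  have h : Continuous fun t : ℝ => NormedSpace.exp (t • A) :=
    continuous_mexp.comp (continuous_id.smul continuous_const)
  have h' : Continuous fun t : ℝ => NormedSpace.exp (-(t • A)) :=
    continuous_mexp.comp (continuous_id.smul continuous_const).neg
  exact continuous_logU.comp
    (((h.mul continuous_const).mul h').mul continuous_const)

/-- With a = exp A and b = exp B, the matrix is (ab - ba)a⁻¹b⁻¹, and ab - ba is the commutator of a
- 1 and b - 1, which gains one power of U. -/
lemma commutator_sub_one_mem {U : Submodule ℝ (Matrix (Fin m) (Fin m) ℝ)} (hU : IsNilAlgebra U)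
    (i : ℕ) {A B : Matrix (Fin m) (Fin m) ℝ} (hA : A ∈ U) (hB : B ∈ U ^ (i + 1)) :
    NormedSpace.exp A * NormedSpace.exp B * NormedSpace.exp (-A) * NormedSpace.exp (-B) - 1
      ∈ U ^ (i + 2) := by
  have ha := hU.exp_sub_one_mem' hA
  have hb := hU.exp_sub_one_mem i hB
  have hc : NormedSpace.exp (-A) * NormedSpace.exp (-B) - 1 ∈ U :=
    IsNilAlgebra.mul_sub_one_mem hU.mul_le (hU.exp_sub_one_mem' (U.neg_mem hA))
      (hU.exp_sub_one_mem' (U.neg_mem (hU.pow_le i hB)))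
  have h1 : NormedSpace.exp B * NormedSpace.exp A *
      (NormedSpace.exp (-A) * NormedSpace.exp (-B)) = 1 := by
    rw [mul_assoc, ← mul_assoc (NormedSpace.exp A), exp_mul_exp_neg, one_mul, exp_mul_exp_neg]
  set a := NormedSpace.exp A
  set b := NormedSpace.exp B
  set c := NormedSpace.exp (-A) * NormedSpace.exp (-B)
  have e : a * b * NormedSpace.exp (-A) * NormedSpace.exp (-B) - 1 =
      ((a - 1) * (b - 1) - (b - 1) * (a - 1)) + ((a - 1) * (b - 1) - (b - 1) * (a - 1)) * (c - 1) := by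
    rw [mul_assoc _ (NormedSpace.exp (-A))]
    show a * b * c - 1 = _
    have e2 : (a - 1) * (b - 1) - (b - 1) * (a - 1) = a * b - b * a := by noncomm_ring
    rw [e2, mul_sub, mul_one, add_sub_cancel, sub_mul, h1]
  have h2 : (a - 1) * (b - 1) - (b - 1) * (a - 1) ∈ U ^ (i + 2) := by
    refine Submodule.sub_mem _ ?_ ?_
    · rw [pow_succ']; exact Submodule.mul_mem_mul ha hb
    · rw [pow_succ]; exact Submodule.mul_mem_mul hb ha
  rw [e]
  exact Submodule.add_mem _ h2 (hU.mul_pow_le (i + 1) (Submodule.mul_mem_mul h2 hc))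

lemma commLog_mem_pow {U : Submodule ℝ (Matrix (Fin m) (Fin m) ℝ)} (hU : IsNilAlgebra U)
    (i : ℕ) {A B : Matrix (Fin m) (Fin m) ℝ} (hA : A ∈ U) (hB : B ∈ U ^ (i + 1)) :
    commLog A B ∈ U ^ (i + 2) :=
  logU_mem (hU.pow_mul_pow_le (i + 1)) (commutator_sub_one_mem hU i hA hB)

lemma expGL_commLog {U : Submodule ℝ (Matrix (Fin m) (Fin m) ℝ)} (hU : IsNilAlgebra U)
    {A B : Matrix (Fin m) (Fin m) ℝ} (hA : A ∈ U) (hB : B ∈ U) :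
    expGL (commLog A B) = ⁅expGL A, expGL B⁆ := by
  refine Units.ext ?_
  rw [commutatorElement_def, ← expGL_neg, ← expGL_neg]
  exact exp_logU (hU.isNilpotent (hU.pow_le 1 (commutator_sub_one_mem hU 0 hA (by simpa using hB))))

/-! ### The exponential map modulo a subspace c for which s/c is central in v/c -/

section CentralStep

variable {U c s v : Submodule ℝ (Matrix (Fin m) (Fin m) ℝ)} (hU : IsNilAlgebra U)
  (hc : IsSaturated U c) (hs : IsSaturated U s) (hv : IsSaturated U v) (hcs : c ≤ s) (hsv : s ≤ v)
  (hcomm : ∀ A ∈ v, ∀ B ∈ s, commLog A B ∈ c)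

include hcomm in
lemma commutator_mem_of_commLog_mem : ∀ x ∈ expSubgroup hU hv, ∀ y ∈ expSubgroup hU hs,
    ⁅x, y⁆ ∈ expSubgroup hU hc := by
  rintro _ ⟨A, hA, rfl⟩ _ ⟨B, hB, rfl⟩
  exact ⟨_, hcomm A hA B hB, expGL_commLog hU (hv.le hA) (hs.le hB)⟩

lemma expSubgroup_mono {W W' : Submodule ℝ (Matrix (Fin m) (Fin m) ℝ)} (hW : IsSaturated U W)
    (hW' : IsSaturated U W') (h : W ≤ W') : expSubgroup hU hW ≤ expSubgroup hU hW' := by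
  rintro _ ⟨X, hX, rfl⟩
  exact ⟨X, h hX, rfl⟩

include hcs hsv hv hs hcomm in
-- The quotient of exp s by exp c is abelian, so exp A exp B agrees with (exp(A/n) exp(B/n))^n
-- modulo exp c for every n. By the Trotter formula these powers tend to exp(A + B), and c is closed
-- because it is finite dimensional. This takes the place of the Baker-Campbell-Hausdorff formula.
lemma expGL_add_mem {A B : Matrix (Fin m) (Fin m) ℝ} (hA : A ∈ s) (hB : B ∈ s) :
    (expGL A * expGL B)⁻¹ * expGL (A + B) ∈ expSubgroup hU hc := by
  have hpow : ∀ n : ℕ, n ≠ 0 → (expGL A * expGL B)⁻¹ *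
      (expGL ((n : ℝ)⁻¹ • A) * expGL ((n : ℝ)⁻¹ • B)) ^ n ∈ expSubgroup hU hc := by
    intro n hn
    have := mul_pow_mem_of_commutator_mem (expSubgroup_mono hU hc hs hcs)
      (fun x hx y hy => commutator_mem_of_commLog_mem hU hc hs hv hcomm x
        (expSubgroup_mono hU hs hv hsv hx) y hy)
      (expGL_mem_expSubgroup (hU := hU) (hW := hs) (s.smul_mem (n : ℝ)⁻¹ hA))
      (expGL_mem_expSubgroup (hU := hU) (hW := hs) (s.smul_mem (n : ℝ)⁻¹ hB)) n
    rwa [expGL_inv_smul_pow _ hn, expGL_inv_smul_pow _ hn] at this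
  set p : Matrix (Fin m) (Fin m) ℝ := ((expGL A * expGL B)⁻¹).val
  have hlim : Tendsto (fun n : ℕ => logU (p * (NormedSpace.exp ((n : ℝ)⁻¹ • A) *
      NormedSpace.exp ((n : ℝ)⁻¹ • B)) ^ n)) atTop (𝓝 (logU (p * NormedSpace.exp (A + B)))) :=
    (continuous_logU.tendsto _).comp ((tendsto_trotter A B).const_mul p)
  have hmem : logU (p * NormedSpace.exp (A + B)) ∈ c := by
    refine (Submodule.closed_of_finiteDimensional c).mem_of_tendsto hlim ?_
    filter_upwards [eventually_ne_atTop 0] with n hn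
    obtain ⟨Z, hZ, e⟩ := hpow n hn
    have e' := congrArg Units.val e
    simp only [Units.val_mul, Units.val_pow_eq_pow_val, coe_expGL] at e'
    show logU _ ∈ c
    rw [← e', logU_exp (hU.isNilpotent (hc.le hZ))]
    exact hZ
  refine ⟨_, hmem, Units.ext (exp_logU (hU.isNilpotent ?_))⟩
  have hp : p = NormedSpace.exp (-B) * NormedSpace.exp (-A) := by
    simp only [p]
    rw [mul_inv_rev, ← expGL_neg, ← expGL_neg]
    rfl
  rw [hp]
  exact IsNilAlgebra.mul_sub_one_mem hU.mul_le (IsNilAlgebra.mul_sub_one_mem hU.mul_le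
    (hU.exp_sub_one_mem' (U.neg_mem (hs.le hB))) (hU.exp_sub_one_mem' (U.neg_mem (hs.le hA))))
    (hU.exp_sub_one_mem' (U.add_mem (hs.le hA) (hs.le hB)))

include hcs hsv hv hs hcomm in
lemma conj_mem_expSubgroup {x g : GL (Fin m) ℝ} (hx : x ∈ expSubgroup hU hs)
    (hg : g ∈ expSubgroup hU hc) : x * g * x⁻¹ ∈ expSubgroup hU hc := by
  have e : x * g * x⁻¹ = ⁅x, g⁆ * g := by simp [commutatorElement_def]
  rw [e]
  exact mul_mem (commutator_mem_of_commLog_mem hU hc hs hv hcomm _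
    (expSubgroup_mono hU hs hv hsv hx) _ (expSubgroup_mono hU hc hs hcs hg)) hg

include hcs hsv hv hs hcomm in
-- exp(Z - Z') agrees with exp Z exp(Z')⁻¹ modulo exp c, and the latter is a conjugate of the given
-- element of exp c.
lemma sub_mem_of_expGL {Z Z' : Matrix (Fin m) (Fin m) ℝ} (hZ : Z ∈ s) (hZ' : Z' ∈ s)
    (h : (expGL Z')⁻¹ * expGL Z ∈ expSubgroup hU hc) : Z - Z' ∈ c := by
  have h1 := expGL_add_mem hU hc hs hv hcs hsv hcomm hZ (s.neg_mem hZ')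
  have h2 := conj_mem_expSubgroup hU hc hs hv hcs hsv hcomm
    (expGL_mem_expSubgroup (hU := hU) (hW := hs) hZ') (inv_mem h)
  have h3 := mul_mem (inv_mem h2) h1
  refine mem_of_expGL_mem_expSubgroup (hU := hU) (hW := hc) (U.sub_mem (hs.le hZ) (hs.le hZ')) ?_
  rw [← sub_eq_add_neg, expGL_neg] at h3
  convert h3 using 1
  group

include hU hc hs hcs hsv hv hcomm in
lemma logU_mul_sub_mem {A B : Matrix (Fin m) (Fin m) ℝ} (hA : A ∈ s) (hB : B ∈ s) :
    logU (NormedSpace.exp A * NormedSpace.exp B) - (A + B) ∈ c := by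
  have h1 := expGL_add_mem hU hc hs hv hcs hsv hcomm hA hB
  have h2 : expGL A * expGL B = expGL (logU (NormedSpace.exp A * NormedSpace.exp B)) :=
    Units.ext (hU.exp_logU_mul (hs.le hA) (hs.le hB)).symm
  rw [h2] at h1
  rw [← neg_sub]
  exact c.neg_mem (sub_mem_of_expGL hU hc hs hv hcs hsv hcomm (s.add_mem hA hB)
    (hs.mul_mem A hA B hB) h1)

include hU hc hs hcs hsv hv hcomm in
-- Commutators that are central modulo exp c are multiplicative in their first entry, so t ↦ log[exp
-- tA, exp B] is additive modulo c. It is also continuous, hence linear modulo c.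
lemma commLog_smul_sub_mem {A B : Matrix (Fin m) (Fin m) ℝ} (hA : A ∈ v) (hB : B ∈ v)
    (hAB : ∀ t : ℝ, commLog (t • A) B ∈ s) (t : ℝ) :
    commLog (t • A) B - t • commLog A B ∈ c := by
  have hadd : ∀ p q : ℝ, commLog ((p + q) • A) B - (commLog (p • A) B + commLog (q • A) B) ∈ c := by
    intro p q
    have h1 := logU_mul_sub_mem hU hc hs hv hcs hsv hcomm (hAB q) (hAB p)
    have h2 : commLog ((p + q) • A) B - logU (NormedSpace.exp (commLog (q • A) B) *
        NormedSpace.exp (commLog (p • A) B)) ∈ c := by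
      refine sub_mem_of_expGL hU hc hs hv hcs hsv hcomm (hAB _)
        (hs.mul_mem _ (hAB q) _ (hAB p)) ?_
      have e1 : expGL (logU (NormedSpace.exp (commLog (q • A) B) *
          NormedSpace.exp (commLog (p • A) B))) =
          ⁅expGL (q • A), expGL B⁆ * ⁅expGL (p • A), expGL B⁆ := by
        rw [← expGL_commLog hU (hv.le (v.smul_mem q hA)) (hv.le hB),
          ← expGL_commLog hU (hv.le (v.smul_mem p hA)) (hv.le hB)]
        exact Units.ext (hU.exp_logU_mul (hs.le (hAB q)) (hs.le (hAB p)))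
      have hq : ⁅expGL (q • A), expGL B⁆ ∈ expSubgroup hU hs :=
        ⟨_, hAB q, expGL_commLog hU (hv.le (v.smul_mem q hA)) (hv.le hB)⟩
      have hp : ⁅expGL (p • A), expGL B⁆ ∈ expSubgroup hU hs :=
        ⟨_, hAB p, expGL_commLog hU (hv.le (v.smul_mem p hA)) (hv.le hB)⟩
      rw [e1, expGL_commLog hU (hv.le (v.smul_mem _ hA)) (hv.le hB), expGL_add_smul]
      set x := expGL (p • A)
      set x' := expGL (q • A)
      set y := expGL B
      have hx : x ∈ expSubgroup hU hv := ⟨_, v.smul_mem p hA, rfl⟩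
      have h3 := commutator_mem_of_commLog_mem hU hc hs hv hcomm x hx _ hq
      have h4 := conj_mem_expSubgroup hU hc hs hv hcs hsv hcomm (inv_mem (mul_mem hq hp)) h3
      convert h4 using 1
      simp only [commutatorElement_def]
      group
    have := c.add_mem h2 h1
    convert this using 1
    abel
  -- Testing against functionals that vanish on c reduces the claim to continuous additive maps ℝ →
  -- ℝ.
  rw [← Subspace.forall_mem_dualAnnihilator_apply_eq_zero_iff]
  intro φ hφ
  rw [Submodule.mem_dualAnnihilator] at hφ
  let f : ℝ →+ ℝ := AddMonoidHom.mk' (fun t => φ (commLog (t • A) B)) (fun p q => by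
    have := hφ _ (hadd p q)
    rwa [map_sub, map_add, sub_eq_zero] at this)
  have hf : Continuous f := (LinearMap.continuous_of_finiteDimensional φ).comp
    (continuous_commLog A B)
  have h := map_real_smul f hf t 1
  simp only [f, AddMonoidHom.mk'_apply, smul_eq_mul, mul_one, one_smul] at h
  rw [map_sub, map_smul, h, smul_eq_mul, sub_self]

/-- The elements of `s` whose real powers all lie in `C`. -/
def powersIn (C : Subgroup (GL (Fin m) ℝ)) (hcC : ∀ X ∈ c, expGL X ∈ C) :
    Submodule ℝ (Matrix (Fin m) (Fin m) ℝ) where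
  carrier := {X | X ∈ s ∧ ∀ t : ℝ, expGL (t • X) ∈ C}
  zero_mem' := ⟨s.zero_mem, fun t => by simp⟩
  smul_mem' r X hX := ⟨s.smul_mem r hX.1, fun t => by rw [smul_smul]; exact hX.2 _⟩
  add_mem' {A B} hA hB := by
    refine ⟨s.add_mem hA.1 hB.1, fun t => ?_⟩
    obtain ⟨Z, hZ, e⟩ := expGL_add_mem hU hc hs hv hcs hsv hcomm (s.smul_mem t hA.1)
      (s.smul_mem t hB.1)
    rw [smul_add, ← mul_inv_cancel_left (expGL (t • A) * expGL (t • B)) (expGL (t • A + t • B)), ← e]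
    exact C.mul_mem (C.mul_mem (hA.2 t) (hB.2 t)) (hcC Z hZ)

lemma isSaturated_powersIn (C : Subgroup (GL (Fin m) ℝ)) (hcC : ∀ X ∈ c, expGL X ∈ C) :
    IsSaturated U (powersIn hU hc hs hv hcs hsv hcomm C hcC) where
  le := fun X hX => hs.le hX.1
  mul_mem A hA B hB := by
    have h := logU_mul_sub_mem hU hc hs hv hcs hsv hcomm hA.1 hB.1
    rw [← sub_add_cancel (logU (NormedSpace.exp A * NormedSpace.exp B)) (A + B)]
    refine Submodule.add_mem _ ⟨hcs h, fun t => hcC _ (c.smul_mem t h)⟩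
      (Submodule.add_mem _ hA hB)

/-- An arbitrary real power of a commutator need not be a commutator, but by linearity modulo c it
differs from [exp tA, exp B], which lies in C, only by factors from exp c, and these lie in C as
well. -/
lemma commLog_mem_powersIn (C : Subgroup (GL (Fin m) ℝ)) (hcC : ∀ X ∈ c, expGL X ∈ C)
    {A B : Matrix (Fin m) (Fin m) ℝ} (hA : A ∈ v) (hB : B ∈ v)
    (hAB : ∀ t : ℝ, commLog (t • A) B ∈ s) (hABC : ∀ t : ℝ, expGL (commLog (t • A) B) ∈ C) :
    commLog A B ∈ powersIn hU hc hs hv hcs hsv hcomm C hcC := by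
  have h1 : commLog A B ∈ s := by simpa using hAB 1
  refine ⟨h1, fun t => ?_⟩
  have h2 : t • commLog A B - commLog (t • A) B ∈ c := by
    rw [← neg_sub]
    exact c.neg_mem (commLog_smul_sub_mem hU hc hs hv hcs hsv hcomm hA hB hAB t)
  obtain ⟨Z, hZ, e⟩ := expGL_add_mem hU hc hs hv hcs hsv hcomm (hAB t) (hcs h2)
  rw [add_sub_cancel] at e
  rw [← mul_inv_cancel_left (expGL (commLog (t • A) B) *
    expGL (t • commLog A B - commLog (t • A) B)) (expGL (t • commLog A B)), ← e]
  exact C.mul_mem (C.mul_mem (hABC t) (hcC _ h2)) (hcC Z hZ)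

end CentralStep

/-- The descending central series of saturated subspaces of `v`. -/
def satCentralSeries (U v : Submodule ℝ (Matrix (Fin m) (Fin m) ℝ)) :
    ℕ → Submodule ℝ (Matrix (Fin m) (Fin m) ℝ)
  | 0 => v
  | i + 1 => satHull U {Z | ∃ A ∈ v, ∃ B ∈ satCentralSeries U v i, commLog A B = Z}

/-! ### The descending central series and the commutator subgroup of exp v -/

section CentralSeries

variable {U v : Submodule ℝ (Matrix (Fin m) (Fin m) ℝ)} (hU : IsNilAlgebra U)
  (hv : IsSaturated U v)

include hU hv

lemma satCentralSeries_le_pow (i : ℕ) : satCentralSeries U v i ≤ U ^ (i + 1) := by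
  induction i with
  | zero => simpa [satCentralSeries] using hv.le
  | succ i ih =>
    refine satHull_le (hU.isSaturated_pow (i + 1)) ?_
    rintro _ ⟨A, hA, B, hB, rfl⟩
    exact commLog_mem_pow hU i (hv.le hA) (ih hB)

lemma isSaturated_satCentralSeries (i : ℕ) : IsSaturated U (satCentralSeries U v i) := by
  cases i with
  | zero => exact hv
  | succ i =>
    refine isSaturated_satHull hU ?_
    rintro _ ⟨A, hA, B, hB, rfl⟩
    exact hU.pow_le _ (commLog_mem_pow hU i (hv.le hA) (satCentralSeries_le_pow hU hv i hB))

lemma satCentralSeries_succ_le (i : ℕ) : satCentralSeries U v (i + 1) ≤ satCentralSeries U v i := by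
  induction i with
  | zero =>
    refine satHull_le hv ?_
    rintro _ ⟨A, hA, B, hB, rfl⟩
    have hA' : expGL A ∈ expSubgroup hU hv := ⟨A, hA, rfl⟩
    have hB' : expGL B ∈ expSubgroup hU hv := ⟨B, hB, rfl⟩
    refine mem_of_expGL_mem_expSubgroup (hU := hU) (hW := hv)
      (hU.pow_le 1 (commLog_mem_pow hU 0 (hv.le hA) (by simpa using hv.le hB))) ?_
    rw [expGL_commLog hU (hv.le hA) (hv.le hB), commutatorElement_def]
    exact mul_mem (mul_mem (mul_mem hA' hB') (inv_mem hA')) (inv_mem hB')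
  | succ i ih =>
    refine satHull_le (isSaturated_satCentralSeries hU hv (i + 1)) ?_
    rintro _ ⟨A, hA, B, hB, rfl⟩
    exact subset_satHull ⟨A, hA, B, ih hB, rfl⟩

lemma satCentralSeries_le (i : ℕ) : satCentralSeries U v i ≤ v := by
  induction i with
  | zero => exact le_rfl
  | succ i ih => exact (satCentralSeries_succ_le hU hv i).trans ih

/-- Induction from the vanishing end of the series upwards: once exp of the next term lies in the
commutator subgroup, that term serves as c, and the elements all of whose real powers lie in the
commutator subgroup form a saturated subspace containing the generators of the present term. -/
lemma expGL_mem_commutator (i j : ℕ) (h : satCentralSeries U v (i + j + 1) = ⊥) :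
    ∀ X ∈ satCentralSeries U v (i + 1),
      expGL X ∈ ⁅expSubgroup hU hv, expSubgroup hU hv⁆ := by
  induction j generalizing i with
  | zero =>
    intro X hX
    rw [add_zero] at h
    rw [h, Submodule.mem_bot] at hX
    rw [hX, expGL_zero]
    exact one_mem _
  | succ j ih =>
    have hcC := ih (i + 1) (by rw [← h]; congr 1; omega)
    have hs := isSaturated_satCentralSeries hU hv (i + 1)
    have hc := isSaturated_satCentralSeries hU hv (i + 2)
    have hcs := satCentralSeries_succ_le hU hv (i + 1)
    have hsv := satCentralSeries_le hU hv (i + 1)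
    have hcomm : ∀ A ∈ v, ∀ B ∈ satCentralSeries U v (i + 1),
        commLog A B ∈ satCentralSeries U v (i + 2) :=
      fun A hA B hB => subset_satHull ⟨A, hA, B, hB, rfl⟩
    have hle : satCentralSeries U v (i + 1) ≤ powersIn hU hc hs hv hcs hsv hcomm _ hcC := by
      refine satHull_le (isSaturated_powersIn hU hc hs hv hcs hsv hcomm _ hcC) ?_
      rintro _ ⟨A, hA, B, hB, rfl⟩
      have hBv := satCentralSeries_le hU hv i hB
      refine commLog_mem_powersIn hU hc hs hv hcs hsv hcomm _ hcC hA hBv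
        (fun t => subset_satHull ⟨_, v.smul_mem t hA, B, hB, rfl⟩) fun t => ?_
      rw [expGL_commLog hU (hv.le (v.smul_mem t hA)) (hv.le hBv)]
      exact Subgroup.commutator_mem_commutator ⟨_, v.smul_mem t hA, rfl⟩ ⟨B, hBv, rfl⟩
    intro X hX
    simpa using (hle hX).2 1

/-- The commutator subgroup of `exp v` is `exp` of a linear subspace. -/
theorem exists_commutator_expSubgroup : ∃ (w : Submodule ℝ (Matrix (Fin m) (Fin m) ℝ))
    (hw : IsSaturated U w), w ≤ v ∧
      ⁅expSubgroup hU hv, expSubgroup hU hv⁆ = expSubgroup hU hw := by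
  refine ⟨satCentralSeries U v 1, isSaturated_satCentralSeries hU hv 1,
    satCentralSeries_le hU hv 1, le_antisymm ?_ ?_⟩
  · rw [Subgroup.commutator_le]
    rintro _ ⟨A, hA, rfl⟩ _ ⟨B, hB, rfl⟩
    exact ⟨_, subset_satHull ⟨A, hA, B, hB, rfl⟩, expGL_commLog hU (hv.le hA) (hv.le hB)⟩
  · rintro _ ⟨X, hX, rfl⟩
    obtain ⟨k, hk⟩ := hU.nil
    refine expGL_mem_commutator hU hv 0 k ?_ X hX
    rw [eq_bot_iff]
    refine (satCentralSeries_le_pow hU hv _).trans ?_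
    rw [show 0 + k + 1 + 1 = k + 2 by omega, pow_add, hk, Submodule.bot_mul]

end CentralSeries

end RealReductiveGroup

namespace RealReductiveGroup

open scoped Matrix.Norms.Frobenius
open Polynomial Filter Topology commutatorElement

variable {m : ℕ}

/-! ### Conjugation and diagonalisation -/

lemma exp_conj_of_mul_eq_one {P Q : Matrix (Fin m) (Fin m) ℝ} (h : P * Q = 1) (h' : Q * P = 1)
    (A : Matrix (Fin m) (Fin m) ℝ) :
    NormedSpace.exp (P * A * Q) = P * NormedSpace.exp A * Q := by
  have e : P⁻¹ = Q := Matrix.inv_eq_right_inv h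
  rw [← e]
  exact Matrix.exp_conj P A ⟨⟨P, Q, h, h'⟩, rfl⟩

lemma expGL_conj (g : GL (Fin m) ℝ) (X : Matrix (Fin m) (Fin m) ℝ) :
    expGL (g.val * X * g⁻¹.val) = g * expGL X * g⁻¹ :=
  Units.ext (exp_conj_of_mul_eq_one (by rw [← Units.val_mul]; simp)
    (by rw [← Units.val_mul]; simp) X)

lemma exists_orthogonal_diagonal {S : Matrix (Fin m) (Fin m) ℝ} (hS : Sᵀ = S) :
    ∃ (O : Matrix (Fin m) (Fin m) ℝ) (d : Fin m → ℝ), O * Oᵀ = 1 ∧ Oᵀ * O = 1 ∧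
      S = O * Matrix.diagonal d * Oᵀ := by
  have hH : S.IsHermitian := by rw [Matrix.IsHermitian, Matrix.conjTranspose_eq_transpose_of_trivial, hS]
  have h1 := hH.spectral_theorem
  rw [Unitary.conjStarAlgAut_apply] at h1
  have h2 := Matrix.mem_unitaryGroup_iff.mp hH.eigenvectorUnitary.2
  have h3 := Matrix.mem_unitaryGroup_iff'.mp hH.eigenvectorUnitary.2
  simp only [Matrix.star_eq_conjTranspose, Matrix.conjTranspose_eq_transpose_of_trivial] at h1 h2 h3
  exact ⟨_, _, h2, h3, h1⟩

lemma exp_smul_orthogonal_diagonal {O : Matrix (Fin m) (Fin m) ℝ} (h : O * Oᵀ = 1)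
    (h' : Oᵀ * O = 1) (d : Fin m → ℝ) (t : ℝ) :
    NormedSpace.exp (t • (O * Matrix.diagonal d * Oᵀ)) =
      O * Matrix.diagonal (fun i => Real.exp (t * d i)) * Oᵀ := by
  have e : t • (O * Matrix.diagonal d * Oᵀ) = O * Matrix.diagonal (fun i => t * d i) * Oᵀ := by
    rw [show (fun i => t * d i) = t • d from rfl, Matrix.diagonal_smul, mul_smul_comm,
      smul_mul_assoc]
  rw [e, exp_conj_of_mul_eq_one h h', Matrix.exp_diagonal, NormedSpace.exp_def]
  congr 3
  ext i
  rw [Real.exp_eq_exp_ℝ, ← NormedSpace.exp_def, Pi.coe_exp]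

/-! ### The Lie algebra of a Zariski closed subgroup -/

variable {G : Type*} [Group G] [TopologicalSpace G] [IsTopologicalGroup G]
  (R : RealReductiveGroup G m)

lemma mem_algGroup_of_tendsto {u : ℕ → GL (Fin m) ℝ} {g : GL (Fin m) ℝ}
    (hu : ∀ᶠ n in atTop, u n ∈ R.algGroup)
    (h : Tendsto (fun n => (u n).val) atTop (𝓝 g.val)) : g ∈ R.algGroup := by
  obtain ⟨S, hS⟩ := R.zariskiClosed
  rw [hS]
  intro f hf
  have hc : Continuous fun M : Matrix (Fin m) (Fin m) ℝ =>
      MvPolynomial.eval (fun ij : Fin m × Fin m => M ij.1 ij.2) f :=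
    f.continuous_eval.comp (continuous_pi fun ij => continuous_id.matrix_elem ij.1 ij.2)
  refine tendsto_nhds_unique ((hc.tendsto _).comp h)
    (tendsto_const_nhds.congr' ?_)
  filter_upwards [hu] with n hn
  exact ((hS _).mp hn f hf).symm

lemma mem_lie_iff {X : Matrix (Fin m) (Fin m) ℝ} :
    X ∈ R.lie ↔ ∀ t : ℝ, expGL (t • X) ∈ R.algGroup := by
  refine forall_congr' fun t => ⟨?_, fun h => ⟨_, h, rfl⟩⟩
  rintro ⟨g, hg, e⟩
  rwa [show expGL (t • X) = g from Units.ext e.symm]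

/-- `Lie(G)` as a linear subspace. -/
def lieAlg : Submodule ℝ (Matrix (Fin m) (Fin m) ℝ) where
  carrier := R.lie
  zero_mem' := R.mem_lie_iff.mpr fun t => by simp [one_mem]
  smul_mem' r X hX := R.mem_lie_iff.mpr fun t => by
    rw [smul_smul]; exact R.mem_lie_iff.mp hX _
  -- exp(t(A + B)) is a Trotter limit of elements of the Zariski closed, hence closed, group.
  add_mem' {A B} hA hB := R.mem_lie_iff.mpr fun t => by
    refine R.mem_algGroup_of_tendsto (u := fun n : ℕ =>
      (expGL ((n : ℝ)⁻¹ • t • A) * expGL ((n : ℝ)⁻¹ • t • B)) ^ n) (Eventually.of_forall fun n => ?_) ?_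
    · simp only [smul_smul]
      exact pow_mem (mul_mem (R.mem_lie_iff.mp hA _) (R.mem_lie_iff.mp hB _)) n
    · rw [smul_add]
      exact tendsto_trotter (t • A) (t • B)

lemma transpose_mem_lie {X : Matrix (Fin m) (Fin m) ℝ} (hX : X ∈ R.lie) : Xᵀ ∈ R.lie := by
  intro t
  obtain ⟨g, hg, e⟩ := hX t
  obtain ⟨h, hh, e'⟩ := R.symmetric g hg
  refine ⟨h, hh, ?_⟩
  rw [e', e, ← Matrix.exp_transpose, Matrix.transpose_smul]

lemma conj_mem_lie {g : GL (Fin m) ℝ} (hg : g ∈ R.algGroup) {X : Matrix (Fin m) (Fin m) ℝ}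
    (hX : X ∈ R.lie) : g.val * X * g⁻¹.val ∈ R.lie := by
  rw [R.mem_lie_iff] at *
  intro t
  rw [← smul_mul_assoc, ← mul_smul_comm, expGL_conj]
  exact mul_mem (mul_mem hg (hX t)) (inv_mem hg)

lemma hasDerivAt_exp_conj (X Y : Matrix (Fin m) (Fin m) ℝ) :
    HasDerivAt (fun t : ℝ => NormedSpace.exp (t • X) * Y * NormedSpace.exp (-(t • X)))
      (X * Y - Y * X) 0 := by
  have h2 : HasDerivAt (fun t : ℝ => NormedSpace.exp (-(t • X))) (-X) 0 := by
    have := hasDerivAt_mexp (-X) 0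
    simpa using this
  have h := ((hasDerivAt_mexp X 0).mul_const Y).mul h2
  rw [show NormedSpace.exp ((0 : ℝ) • X) * X * Y * NormedSpace.exp (-((0 : ℝ) • X)) +
    NormedSpace.exp ((0 : ℝ) • X) * Y * -X = X * Y - Y * X by simp [sub_eq_add_neg]] at h
  exact h

lemma mem_of_hasDerivAt {W : Submodule ℝ (Matrix (Fin m) (Fin m) ℝ)}
    {f : ℝ → Matrix (Fin m) (Fin m) ℝ} {f' : Matrix (Fin m) (Fin m) ℝ} (hf : ∀ t, f t ∈ W)
    (h : HasDerivAt f f' 0) : f' ∈ W := by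
  refine (Submodule.closed_of_finiteDimensional W).mem_of_tendsto h.tendsto_slope_zero
    (Eventually.of_forall fun t => ?_)
  exact W.smul_mem _ (W.sub_mem (hf _) (hf _))

lemma commutator_mem_lie {X Y : Matrix (Fin m) (Fin m) ℝ} (hX : X ∈ R.lie) (hY : Y ∈ R.lie) :
    X * Y - Y * X ∈ R.lie := by
  refine mem_of_hasDerivAt (W := R.lieAlg) (fun t => ?_) (hasDerivAt_exp_conj X Y)
  have := R.conj_mem_lie (R.mem_lie_iff.mp hX t) hY
  rw [← expGL_neg] at this
  exact this

/-- The entries of exp(t log g) are polynomials in t. Each defining equation of the group therefore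
becomes a polynomial in t that vanishes at every natural number, since g^k lies in the group. -/
lemma logU_mem_lie {g : GL (Fin m) ℝ} (hg : g ∈ R.algGroup) (hn : IsNilpotent (g.val - 1)) :
    logU g.val ∈ R.lie := by
  rw [R.mem_lie_iff]
  obtain ⟨S, hS⟩ := R.zariskiClosed
  have hpow : ∀ k : ℕ, expGL ((k : ℝ) • logU g.val) = g ^ k := fun k => Units.ext (by
    rw [coe_expGL, Nat.cast_smul_eq_nsmul, Matrix.exp_nsmul, exp_logU hn,
      Units.val_pow_eq_pow_val])
  intro t
  rw [hS]
  intro f hf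
  have h1 := IsPolyFun.mvPolynomial_eval
    (f := fun (ij : Fin m × Fin m) t => NormedSpace.exp (t • logU g.val) ij.1 ij.2)
    (fun ij => isPolyFun_exp (isNilpotent_logU hn) ij.1 ij.2) f
  refine h1.eq_zero (fun k => ?_) t
  have h2 := (hS (g ^ k)).mp (pow_mem hg k) f hf
  rwa [← hpow] at h2

/-- The same argument with exponential sums: after diagonalisation the entries of s^t are
combinations of the powers d_i^t of the eigenvalues, and the defining equations vanish at all
natural t. -/
lemma exists_symm_log {s : GL (Fin m) ℝ} (hs : s ∈ R.algGroup) (hpd : s.val.PosDef) :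
    ∃ Y ∈ R.lie, Yᵀ = Y ∧ NormedSpace.exp Y = s.val := by
  obtain ⟨O, d, h1, h2, h3⟩ := exists_orthogonal_diagonal (S := s.val) (by
    have := hpd.isHermitian
    rwa [Matrix.IsHermitian, Matrix.conjTranspose_eq_transpose_of_trivial] at this)
  have hdiag : Oᵀ * s.val * O = Matrix.diagonal d := by
    calc Oᵀ * s.val * O = (Oᵀ * O) * Matrix.diagonal d * (Oᵀ * O) := by
          rw [h3]; simp only [mul_assoc]
      _ = _ := by rw [h2, one_mul, mul_one]
  have hd : ∀ i, 0 < d i := by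
    intro i
    have h4 : (Oᵀ * s.val * O).PosDef := by
      have := hpd.conjTranspose_mul_mul_same (B := O) (by
        refine Function.LeftInverse.injective (g := fun v => Oᵀ *ᵥ v) fun v => ?_
        simp [h2])
      rwa [Matrix.conjTranspose_eq_transpose_of_trivial] at this
    have h5 := h4.diag_pos (i := i)
    rwa [hdiag, Matrix.diagonal_apply_eq] at h5
  set Y := O * Matrix.diagonal (fun i => Real.log (d i)) * Oᵀ with hY
  have hexp : ∀ t : ℝ, NormedSpace.exp (t • Y) =
      O * Matrix.diagonal (fun i => Real.exp (t * Real.log (d i))) * Oᵀ :=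
    fun t => exp_smul_orthogonal_diagonal h1 h2 _ t
  have hexp1 : NormedSpace.exp Y = s.val := by
    have := hexp 1
    rw [one_smul] at this
    rw [this, h3]
    congr 3
    ext i
    rw [one_mul, Real.exp_log (hd i)]
  refine ⟨Y, R.mem_lie_iff.mpr fun t => ?_, ?_, hexp1⟩
  · obtain ⟨S, hS⟩ := R.zariskiClosed
    rw [hS]
    intro f hf
    have h6 : ∀ ij : Fin m × Fin m, IsExpSum fun t => NormedSpace.exp (t • Y) ij.1 ij.2 := by
      intro ij
      simp only [hexp, Matrix.mul_apply (M := O * _), Matrix.mul_diagonal]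
      refine IsExpSum.sum fun k _ => ?_
      convert isExpSum_exp (O ij.1 k * Oᵀ k ij.2) (Real.log (d k)) using 2 with t
      rw [mul_comm t]
      ring
    refine (IsExpSum.mvPolynomial_eval h6 f).eq_zero (fun k => ?_) t
    have h7 := (hS (s ^ k)).mp (pow_mem hs k) f hf
    rw [Units.val_pow_eq_pow_val, ← hexp1, ← Matrix.exp_nsmul, ← Nat.cast_smul_eq_nsmul ℝ] at h7
    exact h7
  · rw [hY, Matrix.transpose_mul, Matrix.transpose_mul, Matrix.transpose_transpose,
      Matrix.diagonal_transpose, mul_assoc]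

/-! ### Lifting the exponential map to `G` -/

lemma continuous_proj : Continuous R.proj := by
  have h := R.isCoveringMapOn.continuousOn
  have : R.proj ⁻¹' Set.range R.proj = Set.univ := by ext; simp
  rw [this] at h
  exact continuousOn_univ.mp h

end RealReductiveGroup

namespace RealReductiveGroup

open scoped Matrix.Norms.Frobenius
open Polynomial Filter Topology commutatorElement

variable {m : ℕ} {G : Type*} [Group G] [TopologicalSpace G] [IsTopologicalGroup G]
  (R : RealReductiveGroup G m)

lemma continuous_mat : Continuous R.mat :=
  Units.continuous_val.comp (continuous_subtype_val.comp R.continuous_proj)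

lemma mat_inv_mul (g : G) : R.mat g⁻¹ * R.mat g = 1 := by
  rw [← mat_mul, inv_mul_cancel, mat_one]

lemma mat_mul_inv (g : G) : R.mat g * R.mat g⁻¹ = 1 := by
  rw [← mat_mul, mul_inv_cancel, mat_one]

lemma proj_eq_one {g : G} (h : R.mat g = 1) : R.proj g = 1 :=
  Subtype.ext (Units.ext h)

lemma discreteTopology_ker : DiscreteTopology (R.proj ⁻¹' {1}) :=
  (R.isCoveringMapOn 1 ⟨1, map_one _⟩).1

lemma eq_of_mat_eq_one {Z : Type*} [TopologicalSpace Z] [PreconnectedSpace Z] {f : Z → G}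
    (hf : Continuous f) (h : ∀ z, R.mat (f z) = 1) (z z' : Z) : f z = f z' := by
  have := R.discreteTopology_ker
  have h1 : Continuous fun z => (⟨f z, R.proj_eq_one (h z)⟩ : R.proj ⁻¹' {1}) :=
    hf.subtype_mk _
  exact congrArg Subtype.val (PreconnectedSpace.constant inferInstance h1 (x := z) (y := z'))

include R in
lemma t2Space : T2Space G := by
  have := R.discreteTopology_ker
  have h1 : IsClosed (R.proj ⁻¹' {1}) := isClosed_singleton.preimage R.continuous_proj
  have h2 : IsClosed ({1} : Set G) := by
    have h3 : IsClosed ({⟨1, map_one _⟩} : Set (R.proj ⁻¹' {1})) := isClosed_discrete _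
    have h4 := h1.isClosedMap_subtype_val _ h3
    simpa using h4
  have : T1Space G := IsTopologicalGroup.t1Space G h2
  infer_instance

lemma continuous_expGL : Continuous (expGL : Matrix (Fin m) (Fin m) ℝ → GL (Fin m) ℝ) :=
  Units.continuous_iff.mpr ⟨continuous_mexp, continuous_mexp.comp continuous_neg⟩

/-- The exponential map of `Lie(G)` into the algebraic group. -/
def expAlg (X : R.lieAlg) : R.algGroup :=
  ⟨expGL X.1, by simpa using R.mem_lie_iff.mp X.2 1⟩

lemma continuous_expAlg : Continuous R.expAlg :=
  (continuous_expGL.comp continuous_subtype_val).subtype_mk _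

/-- The image of G is an open subgroup, hence clopen, and Lie(G) is connected. -/
lemma expAlg_mem_range (X : R.lieAlg) : R.expAlg X ∈ Set.range R.proj := by
  have h1 : IsClopen (R.proj.range : Set R.algGroup) := by
    have ho : IsOpen (R.proj.range : Set R.algGroup) := by
      rw [MonoidHom.coe_range]; exact R.isOpen_range
    exact ⟨Subgroup.isClosed_of_isOpen _ ho, ho⟩
  have h2 := h1.preimage R.continuous_expAlg
  have h3 := (isClopen_iff.mp h2).resolve_left (by
    refine Set.Nonempty.ne_empty ⟨0, ?_⟩
    have : R.expAlg 0 = 1 := Subtype.ext (by simp [expAlg])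
    rw [Set.mem_preimage, this]
    exact one_mem R.proj.range)
  have : X ∈ R.expAlg ⁻¹' R.proj.range := by rw [h3]; trivial
  exact this

/-- A vector space is simply connected, so its exponential map lifts through the covering G → image.
-/
lemma exists_liftExp : ∃ F : C(R.lieAlg, G), F 0 = 1 ∧ ∀ X, R.proj (F X) = R.expAlg X := by
  have : LocallyConvexSpace ℝ R.lieAlg := NormedSpace.toLocallyConvexSpace (E := R.lieAlg)
  have : LocallyPathConnectedSpace R.lieAlg :=
    LocallyConvexSpace.toLocallyPathConnectedSpace (E := R.lieAlg)
  obtain ⟨F, ⟨h1, h2⟩, -⟩ := R.isCoveringMapOn.existsUnique_continuousMap_lifts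
    ⟨R.expAlg, R.continuous_expAlg⟩ (a₀ := 0) (e₀ := 1)
    (by rw [map_one]; exact (Subtype.ext (by simp [expAlg])).symm) R.expAlg_mem_range
  exact ⟨F, h1, fun X => congrFun h2 X⟩

/-- The exponential map `Lie(G) → G`. -/
def liftExp : C(R.lieAlg, G) := R.exists_liftExp.choose

lemma liftExp_zero : R.liftExp 0 = 1 := R.exists_liftExp.choose_spec.1

@[simp] lemma mat_liftExp (X : R.lieAlg) : R.mat (R.liftExp X) = NormedSpace.exp X.1 := by
  rw [mat, liftExp, R.exists_liftExp.choose_spec.2 X]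
  rfl

/-- Two continuous maps from a connected space to `G` that agree at a point and have the same
matrices coincide. -/
lemma eq_of_mat_eq {Z : Type*} [TopologicalSpace Z] [PreconnectedSpace Z] {f f' : Z → G}
    (hf : Continuous f) (hf' : Continuous f') (h : ∀ z, R.mat (f z) = R.mat (f' z)) {z₀ : Z}
    (h₀ : f z₀ = f' z₀) (z : Z) : f z = f' z := by
  have h1 := R.eq_of_mat_eq_one (hf.mul hf'.inv)
    (fun z => by simp only [Pi.mul_apply, Pi.inv_apply]; rw [mat_mul, h, mat_mul_inv]) z z₀
  simp only [Pi.mul_apply, Pi.inv_apply] at h1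
  rw [h₀, mul_inv_cancel] at h1
  exact mul_inv_eq_one.mp h1

lemma isExp_liftExp (X : R.lieAlg) : R.IsExp X.1 (R.liftExp X) := by
  have hc : Continuous fun t : ℝ => R.liftExp (t • X) :=
    R.liftExp.continuous.comp (continuous_id.smul continuous_const)
  refine ⟨fun t => R.liftExp (t • X), hc, ?_, fun t => by simp, by simp⟩
  intro s t
  refine R.eq_of_mat_eq (Z := ℝ × ℝ) (f := fun p => R.liftExp ((p.1 + p.2) • X))
    (f' := fun p => R.liftExp (p.1 • X) * R.liftExp (p.2 • X))
    (hc.comp (continuous_fst.add continuous_snd))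
    ((hc.comp continuous_fst).mul (hc.comp continuous_snd)) (fun p => ?_) (z₀ := (0, 0))
    (by simp [liftExp_zero]) (s, t)
  rw [mat_mul, mat_liftExp, mat_liftExp, mat_liftExp]
  exact congrArg Units.val (expGL_add_smul p.1 p.2 X.1)

variable {R}

lemma IsExp.mem_lie {X : Matrix (Fin m) (Fin m) ℝ} {g : G} (h : R.IsExp X g) : X ∈ R.lie := by
  obtain ⟨γ, -, -, h2, -⟩ := h
  exact fun t => ⟨_, (R.proj (γ t)).2, h2 t⟩

lemma IsExp.mat_eq {X : Matrix (Fin m) (Fin m) ℝ} {g : G} (h : R.IsExp X g) :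
    R.mat g = NormedSpace.exp X := by
  obtain ⟨γ, -, -, h2, rfl⟩ := h
  rw [h2, one_smul]

/-- Uniqueness of lifts along ℝ: a one-parameter subgroup of G is determined by its matrices,
although `mat` need not be injective on G. -/
lemma IsExp.eq_liftExp {X : Matrix (Fin m) (Fin m) ℝ} {g : G} (h : R.IsExp X g) :
    g = R.liftExp ⟨X, h.mem_lie⟩ := by
  have hX := h.mem_lie
  obtain ⟨γ, hγ, h1, h2, rfl⟩ := h
  have h0 : γ 0 = 1 := by
    have := h1 0 0
    rwa [add_zero, left_eq_mul] at this
  have := R.eq_of_mat_eq hγ (f' := fun t : ℝ => R.liftExp (t • ⟨X, hX⟩))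
    (R.liftExp.continuous.comp (by fun_prop))
    (fun t => by rw [h2, mat_liftExp]; rfl) (z₀ := 0) (by simp [h0, liftExp_zero]) 1
  simpa using this

lemma IsExp.eq {X : Matrix (Fin m) (Fin m) ℝ} {g g' : G} (h : R.IsExp X g) (h' : R.IsExp X g') :
    g = g' := by
  rw [h.eq_liftExp, h'.eq_liftExp]

lemma IsExp.conj {X : Matrix (Fin m) (Fin m) ℝ} {g : G} (h : R.IsExp X g) (p : G) :
    R.IsExp (R.mat p * X * R.mat p⁻¹) (p * g * p⁻¹) := by
  obtain ⟨γ, hγ, h1, h2, rfl⟩ := h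
  refine ⟨fun t => p * γ t * p⁻¹, (continuous_const.mul hγ).mul continuous_const, fun s t => ?_,
    fun t => ?_, rfl⟩
  · show p * γ (s + t) * p⁻¹ = p * γ s * p⁻¹ * (p * γ t * p⁻¹)
    rw [h1]; group
  · rw [mat_mul, mat_mul, h2, ← smul_mul_assoc, ← mul_smul_comm,
      exp_conj_of_mul_eq_one (R.mat_mul_inv p) (R.mat_inv_mul p)]

lemma exists_isExp {X : Matrix (Fin m) (Fin m) ℝ} (hX : X ∈ R.lie) : ∃ g, R.IsExp X g :=
  ⟨_, R.isExp_liftExp ⟨X, hX⟩⟩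

lemma isExp_zero : R.IsExp 0 1 := by
  have := R.isExp_liftExp 0
  rwa [liftExp_zero] at this

lemma IsExp.inv {X : Matrix (Fin m) (Fin m) ℝ} {g : G} (h : R.IsExp X g) : R.IsExp (-X) g⁻¹ := by
  obtain ⟨γ, hγ, h1, h2, rfl⟩ := h
  have h0 : γ 0 = 1 := by
    have := h1 0 0
    rwa [add_zero, left_eq_mul] at this
  refine ⟨fun t => γ (-t), hγ.comp continuous_neg, fun s t => by
    show γ (-(s + t)) = γ (-s) * γ (-t)
    rw [neg_add, h1],
    fun t => by rw [h2, smul_neg, neg_smul], ?_⟩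
  rw [eq_inv_iff_mul_eq_one, ← h1, neg_add_cancel, h0]

/-- If `Z` is a continuous family of elements of `Lie(G)` with `exp (Z (A, B)) = exp A exp B`,
then the same holds for the exponential map of `G`. -/
lemma IsExp.mul {W : Submodule ℝ (Matrix (Fin m) (Fin m) ℝ)} (hW : W ≤ R.lieAlg)
    {Z : Matrix (Fin m) (Fin m) ℝ → Matrix (Fin m) (Fin m) ℝ → Matrix (Fin m) (Fin m) ℝ}
    (hZc : Continuous fun p : Matrix (Fin m) (Fin m) ℝ × Matrix (Fin m) (Fin m) ℝ => Z p.1 p.2)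
    (hZ : ∀ A ∈ W, ∀ B ∈ W, Z A B ∈ R.lie ∧
      NormedSpace.exp (Z A B) = NormedSpace.exp A * NormedSpace.exp B) (hZ0 : Z 0 0 = 0)
    {A B : Matrix (Fin m) (Fin m) ℝ} (hA : A ∈ W) (hB : B ∈ W) {g h : G} (hg : R.IsExp A g)
    (hh : R.IsExp B h) : R.IsExp (Z A B) (g * h) := by
  have hc1 : Continuous fun p : W × W => R.liftExp ⟨p.1.1, hW p.1.2⟩ * R.liftExp ⟨p.2.1, hW p.2.2⟩ :=
    (R.liftExp.continuous.comp (Continuous.subtype_mk (by fun_prop) _)).mul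
      (R.liftExp.continuous.comp (Continuous.subtype_mk (by fun_prop) _))
  have hc2 : Continuous fun p : W × W =>
      R.liftExp ⟨Z p.1.1 p.2.1, (hZ _ p.1.2 _ p.2.2).1⟩ :=
    R.liftExp.continuous.comp (Continuous.subtype_mk
      (hZc.comp (f := fun p : W × W => (p.1.1, p.2.1)) (by fun_prop)) _)
  have h1 := R.eq_of_mat_eq hc1 hc2 (fun p => by
    rw [mat_mul, mat_liftExp, mat_liftExp, mat_liftExp, (hZ _ p.1.2 _ p.2.2).2])
    (z₀ := (0, 0)) (by
      have e1 : R.liftExp ⟨((0 : W) : Matrix (Fin m) (Fin m) ℝ), hW (0 : W).2⟩ = 1 := R.liftExp_zero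
      have e2 : (⟨Z ((0 : W) : Matrix (Fin m) (Fin m) ℝ) ((0 : W) : Matrix (Fin m) (Fin m) ℝ),
        (hZ _ (0 : W).2 _ (0 : W).2).1⟩ : R.lieAlg) = 0 := Subtype.ext hZ0
      show R.liftExp _ * R.liftExp _ = R.liftExp _
      rw [e2, liftExp_zero, e1, mul_one]) (⟨A, hA⟩, ⟨B, hB⟩)
  have h2 := R.isExp_liftExp ⟨Z A B, (hZ A hA B hB).1⟩
  rw [hg.eq_liftExp, hh.eq_liftExp]
  rwa [← h1] at h2

/-! ### Unipotent subgroups of `G` -/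

section Unipotent

variable {U W : Submodule ℝ (Matrix (Fin m) (Fin m) ℝ)} (hU : IsNilAlgebra U)
  (hW : IsSaturated U W) (hWL : W ≤ R.lieAlg)

include hU hW hWL in
lemma IsExp.mul_of_isSaturated {A B : Matrix (Fin m) (Fin m) ℝ} (hA : A ∈ W) (hB : B ∈ W)
    {g h : G} (hg : R.IsExp A g) (hh : R.IsExp B h) :
    R.IsExp (logU (NormedSpace.exp A * NormedSpace.exp B)) (g * h) := by
  refine IsExp.mul (Z := fun A B => logU (NormedSpace.exp A * NormedSpace.exp B)) hWL ?_
    (fun A hA B hB => ⟨hWL (hW.mul_mem A hA B hB), hU.exp_logU_mul (hW.le hA) (hW.le hB)⟩) ?_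
    hA hB hg hh
  · exact continuous_logU.comp ((continuous_mexp.comp continuous_fst).mul
      (continuous_mexp.comp continuous_snd))
  · show logU (NormedSpace.exp 0 * NormedSpace.exp 0) = 0
    rw [NormedSpace.exp_zero, mul_one, ← NormedSpace.exp_zero (𝔸 := Matrix (Fin m) (Fin m) ℝ),
      logU_exp IsNilpotent.zero]

include hU hW hWL in
lemma mem_analyticSubgroup_iff {g : G} :
    g ∈ R.analyticSubgroup (W : Set (Matrix (Fin m) (Fin m) ℝ)) ↔ ∃ X ∈ W, R.IsExp X g := by
  refine ⟨fun hg => ?_, fun hg => Subgroup.subset_closure hg⟩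
  induction hg using Subgroup.closure_induction with
  | mem x hx => exact hx
  | one => exact ⟨0, W.zero_mem, isExp_zero⟩
  | mul x y _ _ hx hy =>
    obtain ⟨A, hA, hxA⟩ := hx
    obtain ⟨B, hB, hyB⟩ := hy
    exact ⟨_, hW.mul_mem A hA B hB, IsExp.mul_of_isSaturated hU hW hWL hA hB hxA hyB⟩
  | inv x _ hx =>
    obtain ⟨A, hA, hxA⟩ := hx
    exact ⟨-A, W.neg_mem hA, hxA.inv⟩

end Unipotent

end RealReductiveGroup

namespace RealReductiveGroup

open scoped Matrix.Norms.Frobenius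
open Polynomial Filter Topology commutatorElement Function

variable {m : ℕ}

/-! ### The trace inner product -/

lemma frobenius_norm_sq (X : Matrix (Fin m) (Fin m) ℝ) : ‖X‖ ^ 2 = (Xᵀ * X).trace := by
  rw [Matrix.frobenius_norm_def, ← Real.sqrt_eq_rpow, Real.sq_sqrt (by positivity),
    Matrix.trace, Finset.sum_comm]
  refine Finset.sum_congr rfl fun i _ => ?_
  rw [Matrix.diag_apply, Matrix.mul_apply]
  refine Finset.sum_congr rfl fun j _ => ?_
  rw [Real.norm_eq_abs, Matrix.transpose_apply]
  norm_num [sq_abs, sq]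

/-- The inner product `tr (Xᵀ Y)` on matrices. -/
abbrev frobeniusInnerProductSpace : InnerProductSpace ℝ (Matrix (Fin m) (Fin m) ℝ) where
  inner X Y := (Xᵀ * Y).trace
  norm_sq_eq_re_inner X := frobenius_norm_sq X
  conj_inner_symm X Y := by
    show (Yᵀ * X).trace = (Xᵀ * Y).trace
    rw [← Matrix.trace_transpose, Matrix.transpose_mul, Matrix.transpose_transpose]
  add_left X Y Z := by
    show ((X + Y)ᵀ * Z).trace = (Xᵀ * Z).trace + (Yᵀ * Z).trace
    rw [Matrix.transpose_add, add_mul, Matrix.trace_add]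
  smul_left X Y r := by
    show ((r • X)ᵀ * Y).trace = r * (Xᵀ * Y).trace
    rw [Matrix.transpose_smul, smul_mul_assoc, Matrix.trace_smul, smul_eq_mul]

attribute [local instance] frobeniusInnerProductSpace

lemma inner_eq_trace (X Y : Matrix (Fin m) (Fin m) ℝ) : inner ℝ X Y = (Xᵀ * Y).trace := rfl

/-! ### Block triangular matrices for an orthogonal frame -/

/-- The matrices that are strictly block upper triangular in the orthonormal frame `O`, with blocks
ordered by the values of `h`. -/
def strictUpper (O : Matrix (Fin m) (Fin m) ℝ) (h : Fin m → ℝ) :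
    Submodule ℝ (Matrix (Fin m) (Fin m) ℝ) where
  carrier := {X | ∀ i j, h i ≤ h j → (Oᵀ * X * O) i j = 0}
  zero_mem' := by simp
  add_mem' {X Y} hX hY i j hij := by
    rw [mul_add, add_mul, Matrix.add_apply, hX i j hij, hY i j hij, add_zero]
  smul_mem' r X hX i j hij := by
    rw [mul_smul_comm, smul_mul_assoc, Matrix.smul_apply, hX i j hij, smul_zero]

lemma mem_strictUpper {O X : Matrix (Fin m) (Fin m) ℝ} {h : Fin m → ℝ} :
    X ∈ strictUpper O h ↔ ∀ i j, h i ≤ h j → (Oᵀ * X * O) i j = 0 := Iff.rfl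

lemma transpose_mem_strictUpper {O X : Matrix (Fin m) (Fin m) ℝ} {h : Fin m → ℝ} :
    Xᵀ ∈ strictUpper O h ↔ X ∈ strictUpper O (-h) := by
  have e : Oᵀ * Xᵀ * O = (Oᵀ * X * O)ᵀ := by
    simp [Matrix.transpose_mul, mul_assoc]
  simp only [mem_strictUpper, e, Matrix.transpose_apply, Pi.neg_apply, neg_le_neg_iff]
  exact ⟨fun H i j hij => H j i hij, fun H i j hij => H j i hij⟩

lemma conj_mul_conj {O : Matrix (Fin m) (Fin m) ℝ} (hO : O * Oᵀ = 1)
    (X Y : Matrix (Fin m) (Fin m) ℝ) : Oᵀ * (X * Y) * O = (Oᵀ * X * O) * (Oᵀ * Y * O) := by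
  calc Oᵀ * (X * Y) * O = Oᵀ * X * 1 * Y * O := by simp only [mul_one, mul_assoc]
    _ = _ := by rw [← hO]; simp only [mul_assoc]

/-- Let r i be the number of indices with a smaller value of h. A product of k strictly upper
triangular matrices has an (i, j) entry only if r i ≥ r j + k, and r takes values below m. -/
lemma isNilAlgebra_strictUpper {O : Matrix (Fin m) (Fin m) ℝ} (hO : O * Oᵀ = 1)
    (hO' : Oᵀ * O = 1) (h : Fin m → ℝ) : IsNilAlgebra (strictUpper O h) where
  mul_le := by
    rw [Submodule.mul_le]
    intro X hX Y hY i j hij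
    rw [conj_mul_conj hO, Matrix.mul_apply]
    refine Finset.sum_eq_zero fun k _ => ?_
    by_cases hik : h i ≤ h k
    · rw [hX i k hik, zero_mul]
    · rw [hY k j (by linarith), mul_zero]
  nil := by
    let r : Fin m → ℕ := fun i => (Finset.univ.filter fun l => h l < h i).card
    have hr : ∀ i j, h j < h i → r j < r i := fun i j hij => by
      refine Finset.card_lt_card ⟨fun l hl => ?_, fun H => ?_⟩
      · simp only [Finset.mem_filter, Finset.mem_univ, true_and] at *
        linarith
      · have := H (show j ∈ _ by simpa using hij)
        simp at this
    have hrm : ∀ i, r i < m := fun i => by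
      refine (Finset.card_lt_card (t := Finset.univ)
        ⟨Finset.subset_univ _, fun H => ?_⟩).trans_eq (by simp)
      have := H (Finset.mem_univ i)
      simp at this
    have key : ∀ k : ℕ, ∀ X ∈ strictUpper O h ^ k, ∀ i j, r i < r j + k →
        (Oᵀ * X * O) i j = 0 := by
      intro k
      induction k with
      | zero =>
        intro X hX i j hij
        rw [pow_zero, Submodule.mem_one] at hX
        obtain ⟨a, rfl⟩ := hX
        have : i ≠ j := by rintro rfl; omega
        rw [← Algebra.commutes, mul_assoc, hO', mul_one, Matrix.algebraMap_matrix_apply, if_neg this]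
      | succ k ih =>
        intro X hX i j hij
        rw [pow_succ] at hX
        refine Submodule.mul_induction_on hX (fun A hA B hB => ?_) fun A B hA hB => ?_
        · rw [conj_mul_conj hO, Matrix.mul_apply]
          refine Finset.sum_eq_zero fun l _ => ?_
          by_cases hlj : h l ≤ h j
          · rw [hB l j hlj, mul_zero]
          · rw [ih A hA i l (by have := hr l j (not_le.mp hlj); omega), zero_mul]
        · rw [mul_add, add_mul, Matrix.add_apply, hA, hB, add_zero]
    refine ⟨m, ?_⟩
    rw [eq_bot_iff]
    intro X hX
    have h0 : Oᵀ * X * O = 0 := by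
      ext i j
      exact key m X hX i j (by have := hrm i; omega)
    rw [Submodule.mem_bot]
    calc X = (O * Oᵀ) * X * (O * Oᵀ) := by rw [hO, one_mul, mul_one]
      _ = O * (Oᵀ * X * O) * Oᵀ := by simp only [mul_assoc]
      _ = 0 := by rw [h0]; simp

/-- The part of a matrix in the blocks `(i, j)` of the frame `O` with `h i - h j` satisfying `p`. -/
def blockPart (O : Matrix (Fin m) (Fin m) ℝ) (h : Fin m → ℝ) (p : ℝ → Prop) [DecidablePred p] :
    Matrix (Fin m) (Fin m) ℝ →ₗ[ℝ] Matrix (Fin m) (Fin m) ℝ where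
  toFun X := O * (Matrix.of fun i j => if p (h i - h j) then (Oᵀ * X * O) i j else 0) * Oᵀ
  map_add' X Y := by
    rw [← add_mul, ← mul_add]
    congr 2
    ext i j
    simp only [Matrix.of_apply, Matrix.add_apply, mul_add, add_mul]
    split_ifs <;> simp
  map_smul' r X := by
    rw [RingHom.id_apply, ← smul_mul_assoc, ← mul_smul_comm]
    congr 2
    ext i j
    simp only [Matrix.of_apply, Matrix.smul_apply, mul_smul_comm, smul_mul_assoc]
    split_ifs <;> simp

section Frame

variable {O : Matrix (Fin m) (Fin m) ℝ} (hO : O * Oᵀ = 1) (hO' : Oᵀ * O = 1) (h : Fin m → ℝ)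

include hO' in
lemma conj_blockPart (p : ℝ → Prop) [DecidablePred p] (X : Matrix (Fin m) (Fin m) ℝ)
    (i j : Fin m) : (Oᵀ * blockPart O h p X * O) i j =
      if p (h i - h j) then (Oᵀ * X * O) i j else 0 := by
  have e : Oᵀ * blockPart O h p X * O = (Oᵀ * O) *
      (Matrix.of fun i j => if p (h i - h j) then (Oᵀ * X * O) i j else 0) * (Oᵀ * O) := by
    show Oᵀ * (O * _ * Oᵀ) * O = _
    simp only [mul_assoc]
  rw [e, hO', one_mul, mul_one, Matrix.of_apply]

include hO in
lemma eq_of_conj_eq {X Y : Matrix (Fin m) (Fin m) ℝ}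
    (hXY : ∀ i j, (Oᵀ * X * O) i j = (Oᵀ * Y * O) i j) : X = Y := by
  have h0 : Oᵀ * X * O = Oᵀ * Y * O := by ext i j; exact hXY i j
  have h1 : ∀ Z : Matrix (Fin m) (Fin m) ℝ, Z = O * (Oᵀ * Z * O) * Oᵀ := fun Z => by
    calc Z = (O * Oᵀ) * Z * (O * Oᵀ) := by rw [hO, one_mul, mul_one]
      _ = _ := by simp only [mul_assoc]
  rw [h1 X, h0, ← h1 Y]

include hO hO' in
lemma conj_diagonal_commutator (X : Matrix (Fin m) (Fin m) ℝ) (i j : Fin m) :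
    (Oᵀ * ((O * Matrix.diagonal h * Oᵀ) * X - X * (O * Matrix.diagonal h * Oᵀ)) * O) i j =
      (h i - h j) * (Oᵀ * X * O) i j := by
  have e : Oᵀ * (O * Matrix.diagonal h * Oᵀ) * O = Matrix.diagonal h := by
    calc _ = (Oᵀ * O) * Matrix.diagonal h * (Oᵀ * O) := by simp only [mul_assoc]
      _ = _ := by rw [hO', one_mul, mul_one]
  rw [mul_sub, sub_mul, conj_mul_conj hO (O * Matrix.diagonal h * Oᵀ), conj_mul_conj hO X, e,
    Matrix.sub_apply,
    Matrix.diagonal_mul, Matrix.mul_diagonal]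
  ring

include hO hO' in
/-- `blockPart` on an eigenvector of `ad`. -/
lemma blockPart_of_eigen (p : ℝ → Prop) [DecidablePred p] {X : Matrix (Fin m) (Fin m) ℝ} {c : ℝ}
    (hX : (O * Matrix.diagonal h * Oᵀ) * X - X * (O * Matrix.diagonal h * Oᵀ) = c • X) :
    blockPart O h p X = if p c then X else 0 := by
  have h1 : ∀ i j, (Oᵀ * X * O) i j ≠ 0 → h i - h j = c := by
    intro i j hij
    have := conj_diagonal_commutator hO hO' h X i j
    rw [hX, mul_smul_comm, smul_mul_assoc, Matrix.smul_apply, smul_eq_mul] at this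
    exact (mul_right_cancel₀ hij this).symm
  refine eq_of_conj_eq hO fun i j => ?_
  rw [conj_blockPart hO']
  by_cases h2 : (Oᵀ * X * O) i j = 0
  · split_ifs <;> simp [h2]
  · rw [h1 i j h2]
    split_ifs <;> simp

include hO in
lemma trace_transpose_mul_conj (X Y : Matrix (Fin m) (Fin m) ℝ) :
    (Xᵀ * Y).trace = ((Oᵀ * X * O)ᵀ * (Oᵀ * Y * O)).trace := by
  have e : (Oᵀ * X * O)ᵀ * (Oᵀ * Y * O) = Oᵀ * (Xᵀ * Y) * O := by
    rw [conj_mul_conj hO]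
    congr 1
    simp [Matrix.transpose_mul, mul_assoc]
  rw [e, mul_assoc, Matrix.trace_mul_comm Oᵀ, mul_assoc, hO, mul_one]

end Frame

variable {G : Type*} [Group G] [TopologicalSpace G] [IsTopologicalGroup G]
  {R : RealReductiveGroup G m}

/-- By `logU_mem_lie` the logarithm of a unipotent element of the algebraic group is in Lie(G).
Applied to Lie(N) and its transpose, this shows that their exponentials are groups. -/
lemma isSaturated_lieAlg_inf {U : Submodule ℝ (Matrix (Fin m) (Fin m) ℝ)} (hU : IsNilAlgebra U) :
    IsSaturated U (R.lieAlg ⊓ U) where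
  le := inf_le_right
  mul_mem A hA B hB := by
    have h1 := hU.isSaturated_self.mul_mem A hA.2 B hB.2
    refine ⟨?_, h1⟩
    have hA' : expGL A ∈ R.algGroup := by simpa using R.mem_lie_iff.mp hA.1 1
    have hB' : expGL B ∈ R.algGroup := by simpa using R.mem_lie_iff.mp hB.1 1
    exact R.logU_mem_lie (mul_mem hA' hB') (hU.isNilpotent (IsNilAlgebra.mul_sub_one_mem hU.mul_le
      (hU.exp_sub_one_mem' hA.2) (hU.exp_sub_one_mem' hB.2)))

/-! ### Restricted root spaces and the block triangular form of Lie(N) -/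

namespace IwasawaDatum

variable (D : R.IwasawaDatum)

/-- The matrix of the regular element. -/
def Hm : Matrix (Fin m) (Fin m) ℝ := D.H

lemma exists_frame : ∃ (O : Matrix (Fin m) (Fin m) ℝ) (d : Fin m → ℝ), O * Oᵀ = 1 ∧ Oᵀ * O = 1 ∧
    D.Hm = O * Matrix.diagonal d * Oᵀ := exists_orthogonal_diagonal (D.symm _ D.H.2)

/-- An orthonormal frame that diagonalises the regular element. -/
def O : Matrix (Fin m) (Fin m) ℝ := D.exists_frame.choose

/-- The eigenvalues of the regular element. -/
def h : Fin m → ℝ := D.exists_frame.choose_spec.choose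

lemma O_mul : D.O * D.Oᵀ = 1 := D.exists_frame.choose_spec.choose_spec.1
lemma mul_O : D.Oᵀ * D.O = 1 := D.exists_frame.choose_spec.choose_spec.2.1
lemma Hm_eq : D.Hm = D.O * Matrix.diagonal D.h * D.Oᵀ :=
  D.exists_frame.choose_spec.choose_spec.2.2

lemma inner_commutator {Y : Matrix (Fin m) (Fin m) ℝ} (hY : Yᵀ = Y)
    (X Z : Matrix (Fin m) (Fin m) ℝ) :
    inner ℝ (Y * X - X * Y) Z = inner ℝ X (Y * Z - Z * Y) := by
  rw [inner_eq_trace, inner_eq_trace, Matrix.transpose_sub, Matrix.transpose_mul,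
    Matrix.transpose_mul, hY, sub_mul, mul_sub, Matrix.trace_sub, Matrix.trace_sub]
  congr 1
  · rw [mul_assoc]
  · rw [mul_assoc, Matrix.trace_mul_comm, mul_assoc]

/-- `ad Y` on `Lie(G)`, for `Y ∈ 𝔞`. -/
def adLie (Y : D.𝔞) : R.lieAlg →ₗ[ℝ] R.lieAlg :=
  ((LinearMap.mulLeft ℝ Y.1 - LinearMap.mulRight ℝ Y.1).comp R.lieAlg.subtype).codRestrict R.lieAlg
    fun X => R.commutator_mem_lie (D.mem_lie _ Y.2) X.2

lemma coe_adLie (Y : D.𝔞) (X : R.lieAlg) :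
    ((D.adLie Y X : R.lieAlg) : Matrix (Fin m) (Fin m) ℝ) = Y.1 * X.1 - X.1 * Y.1 := rfl

/-- The operators ad Y, for Y in 𝔞, are symmetric for the trace inner product and commute, so they
are simultaneously diagonalisable. On a nonzero joint eigenvector the eigenvalue depends linearly on
Y, so it is a weight. -/
lemma mem_span_weightSpace {X : Matrix (Fin m) (Fin m) ℝ} (hX : X ∈ R.lie) :
    X ∈ Submodule.span ℝ (⋃ α, R.weightSpace D.𝔞 α) := by
  have hsymm : ∀ Y, (D.adLie Y).IsSymmetric := fun Y X Z =>
    inner_commutator (D.symm _ Y.2) X.1 Z.1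
  have hcomm : Pairwise (Commute on D.adLie) := by
    intro Y Z _
    refine LinearMap.ext fun X => Subtype.ext ?_
    show Y.1 * (Z.1 * X.1 - X.1 * Z.1) - (Z.1 * X.1 - X.1 * Z.1) * Y.1 =
      Z.1 * (Y.1 * X.1 - X.1 * Y.1) - (Y.1 * X.1 - X.1 * Y.1) * Z.1
    have e := D.comm _ Y.2 _ Z.2
    have e1 : Y.1 * (Z.1 * X.1) = Z.1 * (Y.1 * X.1) := by rw [← mul_assoc, e, mul_assoc]
    have e2 : X.1 * Z.1 * Y.1 = X.1 * Y.1 * Z.1 := by rw [mul_assoc, ← e, mul_assoc]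
    rw [mul_sub, sub_mul, mul_sub, sub_mul, e1, e2]
    simp only [mul_assoc]
    abel
  have htop := LinearMap.IsSymmetric.iSup_iInf_eq_top_of_commute hsymm hcomm
  have hle : (⊤ : Submodule ℝ R.lieAlg) ≤
      (Submodule.span ℝ (⋃ α, R.weightSpace D.𝔞 α)).comap R.lieAlg.subtype := by
    rw [← htop]
    refine iSup_le fun χ X hXχ => ?_
    rw [Submodule.mem_iInf] at hXχ
    have hX' : ∀ Y : D.𝔞, Y.1 * X.1 - X.1 * Y.1 = χ Y • X.1 := fun Y => by
      have := Module.End.mem_eigenspace_iff.mp (hXχ Y)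
      rw [← coe_adLie, this]
      rfl
    rw [Submodule.mem_comap, Submodule.subtype_apply]
    by_cases h0 : X.1 = 0
    · rw [h0]; exact Submodule.zero_mem _
    let α : Module.Dual ℝ D.𝔞 :=
      { toFun := χ
        map_add' := fun Y Z => by
          refine smul_left_injective ℝ h0 ?_
          show χ (Y + Z) • X.1 = (χ Y + χ Z) • X.1
          rw [add_smul, ← hX', ← hX', ← hX']
          show (Y.1 + Z.1) * X.1 - X.1 * (Y.1 + Z.1) = _
          noncomm_ring
        map_smul' := fun r Y => by
          refine smul_left_injective ℝ h0 ?_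
          show χ (r • Y) • X.1 = (r * χ Y) • X.1
          rw [mul_smul, ← hX', ← hX']
          show (r • Y.1) * X.1 - X.1 * (r • Y.1) = _
          rw [smul_mul_assoc, mul_smul_comm, smul_sub] }
    exact Submodule.subset_span (Set.mem_iUnion.mpr ⟨α, X.2, hX'⟩)
  exact hle (Submodule.mem_top (x := (⟨X, hX⟩ : R.lieAlg)))

lemma blockPart_weight {α : Module.Dual ℝ D.𝔞} {X : Matrix (Fin m) (Fin m) ℝ}
    (hX : X ∈ R.weightSpace D.𝔞 α) (p : ℝ → Prop) [DecidablePred p] :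
    blockPart D.O D.h p X = if p (α D.H) then X else 0 := by
  refine blockPart_of_eigen D.O_mul D.mul_O D.h p ?_
  rw [← Hm_eq]
  exact hX.2 D.H

/-- A property of `blockPart` on `Lie(G)` may be checked on weight vectors. -/
lemma blockPart_mem_of_lie {W : Submodule ℝ (Matrix (Fin m) (Fin m) ℝ)} (p : ℝ → Prop)
    [DecidablePred p]
    (hW : ∀ α, p (α D.H) → ∀ X ∈ R.weightSpace D.𝔞 α, X ∈ W) {X : Matrix (Fin m) (Fin m) ℝ}
    (hX : X ∈ R.lie) : blockPart D.O D.h p X ∈ W := by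
  have hle : Submodule.span ℝ (⋃ α, R.weightSpace D.𝔞 α) ≤ W.comap (blockPart D.O D.h p) := by
    rw [Submodule.span_le]
    intro Y hY
    obtain ⟨α, hα⟩ := Set.mem_iUnion.mp hY
    show blockPart D.O D.h p Y ∈ W
    rw [D.blockPart_weight hα]
    split_ifs with hp
    · exact hW α hp Y hα
    · exact W.zero_mem
  exact hle (D.mem_span_weightSpace hX)

lemma blockPart_mem_lie (p : ℝ → Prop) [DecidablePred p] {X : Matrix (Fin m) (Fin m) ℝ}
    (hX : X ∈ R.lie) : blockPart D.O D.h p X ∈ R.lie :=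
  D.blockPart_mem_of_lie (W := R.lieAlg) p (fun _ _ _ hX => hX.1) hX

lemma blockPart_pos_mem_𝔫 {X : Matrix (Fin m) (Fin m) ℝ} (hX : X ∈ R.lie) :
    blockPart D.O D.h (0 < ·) X ∈ D.𝔫 := by
  refine D.blockPart_mem_of_lie _ (fun α hα X hX => ?_) hX
  by_cases h0 : X = 0
  · rw [h0]; exact D.𝔫.zero_mem
  · exact Submodule.subset_span ⟨α, ⟨⟨fun h => by simp [h] at hα, X, hX, h0⟩, hα⟩, hX⟩

/-- The part of an element of `Lie(G)` that commutes with the regular element commutes with `𝔞`. -/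
lemma blockPart_zero_comm {X : Matrix (Fin m) (Fin m) ℝ} (hX : X ∈ R.lie) {Y : Matrix (Fin m) (Fin m) ℝ}
    (hY : Y ∈ D.𝔞) : Y * blockPart D.O D.h (· = 0) X = blockPart D.O D.h (· = 0) X * Y := by
  rw [← sub_eq_zero]
  refine D.blockPart_mem_of_lie (W := LinearMap.ker (LinearMap.mulLeft ℝ Y - LinearMap.mulRight ℝ Y))
    (· = 0) (fun α hα X hX => ?_) hX
  show Y * X - X * Y = 0
  by_cases h0 : X = 0
  · simp [h0]
  -- Regularity of H enters here: a weight that vanishes on H cannot be a root.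
  have : α = 0 := by
    by_contra hne
    exact D.regular α ⟨hne, X, hX, h0⟩ hα
  have h1 := hX.2 ⟨Y, hY⟩
  rw [this, LinearMap.zero_apply, zero_smul] at h1
  exact h1

/-- The strictly block upper triangular matrices for the regular element. -/
def upper : Submodule ℝ (Matrix (Fin m) (Fin m) ℝ) := strictUpper D.O D.h

lemma isNilAlgebra_upper : IsNilAlgebra D.upper := isNilAlgebra_strictUpper D.O_mul D.mul_O D.h

/-- The description used from here on: block triangularity with respect to H replaces root
combinatorics, and it embeds Lie(N) in a nilpotent associative algebra. -/
lemma 𝔫_eq : D.𝔫 = R.lieAlg ⊓ D.upper := by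
  refine le_antisymm (Submodule.span_le.mpr ?_) fun X hX => ?_
  · rintro X ⟨α, hα, hX⟩
    refine ⟨hX.1, fun i j hij => ?_⟩
    have h1 := D.blockPart_weight hX (0 < ·)
    rw [if_pos hα.2] at h1
    rw [← h1, conj_blockPart D.mul_O, if_neg (by linarith)]
  · have h1 : blockPart D.O D.h (0 < ·) X = X := by
      refine eq_of_conj_eq D.O_mul fun i j => ?_
      rw [conj_blockPart D.mul_O]
      split_ifs with hij
      · rfl
      · exact (hX.2 i j (by linarith)).symm
    rw [← h1]
    exact D.blockPart_pos_mem_𝔫 hX.1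

lemma isSaturated_𝔫 : IsSaturated D.upper D.𝔫 := by
  rw [𝔫_eq]; exact isSaturated_lieAlg_inf D.isNilAlgebra_upper

lemma 𝔫_le_lieAlg : D.𝔫 ≤ R.lieAlg := by rw [𝔫_eq]; exact inf_le_left

lemma 𝔫_le_upper : D.𝔫 ≤ D.upper := by rw [𝔫_eq]; exact inf_le_right

lemma mem_N_iff {g : G} : g ∈ D.N ↔ ∃ X ∈ D.𝔫, R.IsExp X g :=
  mem_analyticSubgroup_iff D.isNilAlgebra_upper D.isSaturated_𝔫 D.𝔫_le_lieAlg

end IwasawaDatum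

end RealReductiveGroup

namespace RealReductiveGroup

open scoped Matrix.Norms.Frobenius
open Polynomial Filter Topology commutatorElement Function

attribute [local instance] frobeniusInnerProductSpace

variable {m : ℕ}

/-! ### Symmetric matrices and exponentials -/

lemma trace_orthogonal_conj {O : Matrix (Fin m) (Fin m) ℝ} (h' : Oᵀ * O = 1)
    (A : Matrix (Fin m) (Fin m) ℝ) : (O * A * Oᵀ).trace = A.trace := by
  rw [Matrix.trace_mul_comm, ← mul_assoc, h', one_mul]

lemma sq_le_exp_add_exp_neg (y : ℝ) : y ^ 2 ≤ Real.exp y + Real.exp (-y) := by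
  have h1 : |y / 2| ≤ |Real.sinh (y / 2)| := by
    rcases le_total 0 (y / 2) with h | h
    · rw [abs_of_nonneg h, abs_of_nonneg (Real.sinh_nonneg_iff.mpr h)]
      exact Real.self_le_sinh_iff.mpr h
    · rw [abs_of_nonpos h, abs_of_nonpos (Real.sinh_nonpos_iff.mpr h)]
      exact neg_le_neg (Real.sinh_le_self_iff.mpr h)
  have h2 := sq_le_sq' (by linarith [abs_nonneg (y / 2), abs_nonneg (Real.sinh (y / 2))]) h1
  rw [sq_abs, sq_abs] at h2
  have h3 := Real.cosh_sq (y / 2)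
  have h4 := Real.cosh_two_mul (y / 2)
  rw [mul_div_cancel₀ _ two_ne_zero, Real.cosh_eq] at h4
  nlinarith

/-- Eigenvalue by eigenvalue this is y² ≤ e^y + e^(-y). It supplies the coercivity in the direction
of 𝔞 for the minimisation. -/
lemma norm_sq_le_trace_exp {Y : Matrix (Fin m) (Fin m) ℝ} (hY : Yᵀ = Y) :
    ‖Y‖ ^ 2 ≤ (NormedSpace.exp Y).trace + (NormedSpace.exp (-Y)).trace := by
  obtain ⟨O, d, h1, h2, h3⟩ := exists_orthogonal_diagonal hY
  have e1 := exp_smul_orthogonal_diagonal h1 h2 d 1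
  have e2 := exp_smul_orthogonal_diagonal h1 h2 d (-1)
  rw [← h3] at e1 e2
  rw [one_smul] at e1
  rw [neg_smul, one_smul] at e2
  have e3 : Yᵀ * Y = O * Matrix.diagonal (fun i => d i * d i) * Oᵀ := by
    rw [hY, h3]
    calc _ = O * Matrix.diagonal d * (Oᵀ * O) * Matrix.diagonal d * Oᵀ := by simp only [mul_assoc]
      _ = _ := by rw [h2, mul_one, mul_assoc O, Matrix.diagonal_mul_diagonal]
  rw [frobenius_norm_sq, e3, e1, e2, trace_orthogonal_conj h2, trace_orthogonal_conj h2,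
    trace_orthogonal_conj h2, Matrix.trace_diagonal, Matrix.trace_diagonal, Matrix.trace_diagonal,
    ← Finset.sum_add_distrib]
  refine Finset.sum_le_sum fun i _ => ?_
  have := sq_le_exp_add_exp_neg (d i)
  rw [one_mul, neg_one_mul]
  linarith [sq (d i)]

/-- The trace is a sum of terms 2d sinh d over the eigenvalues of V, each nonnegative and zero only
for d = 0. -/
lemma eq_zero_of_trace_mul_sinh {V : Matrix (Fin m) (Fin m) ℝ} (hV : Vᵀ = V)
    (h : (V * (NormedSpace.exp V - NormedSpace.exp (-V))).trace = 0) : V = 0 := by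
  obtain ⟨O, d, h1, h2, h3⟩ := exists_orthogonal_diagonal hV
  have e1 := exp_smul_orthogonal_diagonal h1 h2 d 1
  have e2 := exp_smul_orthogonal_diagonal h1 h2 d (-1)
  rw [← h3] at e1 e2
  rw [one_smul] at e1
  rw [neg_smul, one_smul] at e2
  have hmul : ∀ a b : Fin m → ℝ, O * Matrix.diagonal a * Oᵀ * (O * Matrix.diagonal b * Oᵀ) =
      O * Matrix.diagonal (fun i => a i * b i) * Oᵀ := fun a b => by
    calc _ = O * Matrix.diagonal a * (Oᵀ * O) * Matrix.diagonal b * Oᵀ := by simp only [mul_assoc]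
      _ = _ := by rw [h2, mul_one, mul_assoc O, Matrix.diagonal_mul_diagonal]
  rw [mul_sub, e1, e2, h3, hmul, hmul, Matrix.trace_sub, trace_orthogonal_conj h2,
    trace_orthogonal_conj h2, Matrix.trace_diagonal, Matrix.trace_diagonal,
    ← Finset.sum_sub_distrib] at h
  have hnn : ∀ y : ℝ, 0 ≤ y * Real.exp (1 * y) - y * Real.exp (-1 * y) ∧
      (y * Real.exp (1 * y) - y * Real.exp (-1 * y) = 0 → y = 0) := by
    intro y
    rw [one_mul, neg_one_mul]
    rcases lt_trichotomy y 0 with hy | hy | hy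
    · have : Real.exp y < Real.exp (-y) := Real.exp_lt_exp.mpr (by linarith)
      have : 0 < y * Real.exp y - y * Real.exp (-y) := by nlinarith
      exact ⟨this.le, fun h => absurd h this.ne'⟩
    · simp [hy]
    · have : Real.exp (-y) < Real.exp y := Real.exp_lt_exp.mpr (by linarith)
      have : 0 < y * Real.exp y - y * Real.exp (-y) := by nlinarith
      exact ⟨this.le, fun h => absurd h this.ne'⟩
  have hd := (Finset.sum_eq_zero_iff_of_nonneg fun i _ => (hnn (d i)).1).mp h
  have hd0 : d = 0 := funext fun i => (hnn (d i)).2 (hd i (Finset.mem_univ i))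
  rw [h3, hd0]
  simp

lemma trace_skew_mul_symm {Z S : Matrix (Fin m) (Fin m) ℝ} (hZ : Zᵀ = -Z) (hS : Sᵀ = S) :
    (Z * S).trace = 0 := by
  have h1 : (Z * S).trace = -(Z * S).trace := by
    conv_lhs => rw [← Matrix.trace_transpose, Matrix.transpose_mul, hZ, hS, Matrix.trace_mul_comm,
      neg_mul, Matrix.trace_neg]
  linarith

/-! ### Matrices that commute with the diagonalised element -/

section Frame

variable {O : Matrix (Fin m) (Fin m) ℝ} (hO : O * Oᵀ = 1) (hO' : Oᵀ * O = 1) {h : Fin m → ℝ}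

include hO hO' in
lemma conj_eq_zero_of_commute {E : Matrix (Fin m) (Fin m) ℝ}
    (hE : Commute (O * Matrix.diagonal h * Oᵀ) E) {i j : Fin m} (hij : h i ≠ h j) :
    (Oᵀ * E * O) i j = 0 := by
  have h1 := conj_diagonal_commutator hO hO' h E i j
  rw [hE.eq, sub_self, mul_zero, zero_mul, Matrix.zero_apply] at h1
  exact (mul_eq_zero.mp h1.symm).resolve_left (sub_ne_zero.mpr hij)

include hO hO' in
-- E and F commute with the diagonalised element, so they are block diagonal and cannot move an
-- entry to another block.
lemma mul_mem_strictUpper {E L F : Matrix (Fin m) (Fin m) ℝ}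
    (hE : Commute (O * Matrix.diagonal h * Oᵀ) E) (hF : Commute (O * Matrix.diagonal h * Oᵀ) F)
    {h' : Fin m → ℝ} (hh' : ∀ i j, h i = h j → h' i = h' j) (hL : L ∈ strictUpper O h') :
    E * L * F ∈ strictUpper O h' := by
  intro i j hij
  rw [conj_mul_conj hO, conj_mul_conj hO, Matrix.mul_apply]
  refine Finset.sum_eq_zero fun k _ => ?_
  by_cases hkj : h k = h j
  · rw [Matrix.mul_apply, Finset.sum_eq_zero fun l _ => ?_, zero_mul]
    by_cases hil : h i = h l
    · rw [hL l k (by rw [← hh' _ _ hil, hh' _ _ hkj]; exact hij), mul_zero]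
    · rw [conj_eq_zero_of_commute hO hO' hE hil, zero_mul]
  · rw [conj_eq_zero_of_commute hO hO' hF hkj, mul_zero]

lemma trace_eq_zero_of_mem_strictUpper {L : Matrix (Fin m) (Fin m) ℝ} {h' : Fin m → ℝ}
    (hL : L ∈ strictUpper O h') (hO : O * Oᵀ = 1) : L.trace = 0 := by
  have e : L.trace = (Oᵀ * L * O).trace := by
    rw [mul_assoc, Matrix.trace_mul_comm Oᵀ, mul_assoc, hO, mul_one]
  rw [e, Matrix.trace]
  exact Finset.sum_eq_zero fun i _ => hL i i le_rfl

end Frame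

variable {G : Type*} [Group G] [TopologicalSpace G] [IsTopologicalGroup G]
  {R : RealReductiveGroup G m}

/-! ### The Iwasawa decomposition by minimisation -/

namespace IwasawaDatum

variable (D : R.IwasawaDatum)

/-- The strictly block lower triangular matrices for the regular element. -/
def lower : Submodule ℝ (Matrix (Fin m) (Fin m) ℝ) := strictUpper D.O (-D.h)

lemma isNilAlgebra_lower : IsNilAlgebra D.lower := isNilAlgebra_strictUpper D.O_mul D.mul_O _

lemma transpose_mem_lower {X : Matrix (Fin m) (Fin m) ℝ} : Xᵀ ∈ D.lower ↔ X ∈ D.upper := by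
  rw [lower, transpose_mem_strictUpper, neg_neg, upper]

/-- `{Xᵀ | X ∈ Lie(N)}`, the Lie algebra of `θ(N)`. -/
def 𝔫T : Submodule ℝ (Matrix (Fin m) (Fin m) ℝ) := R.lieAlg ⊓ D.lower

lemma isSaturated_𝔫T : IsSaturated D.lower D.𝔫T := isSaturated_lieAlg_inf D.isNilAlgebra_lower

lemma transpose_mem_𝔫T {X : Matrix (Fin m) (Fin m) ℝ} : Xᵀ ∈ D.𝔫T ↔ X ∈ D.𝔫 := by
  rw [𝔫_eq, 𝔫T, Submodule.mem_inf, Submodule.mem_inf, transpose_mem_lower]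
  refine and_congr_left fun _ => ⟨fun h => ?_, fun h => R.transpose_mem_lie h⟩
  have := R.transpose_mem_lie h
  rwa [Matrix.transpose_transpose] at this

lemma transpose_mem_𝔫 {X : Matrix (Fin m) (Fin m) ℝ} : Xᵀ ∈ D.𝔫 ↔ X ∈ D.𝔫T := by
  rw [← transpose_mem_𝔫T, Matrix.transpose_transpose]

lemma thetaN_eq : D.thetaN = R.analyticSubgroup (D.𝔫T : Set (Matrix (Fin m) (Fin m) ℝ)) := by
  unfold thetaN
  congr 1
  ext Y
  constructor
  · rintro ⟨X, hX, rfl⟩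
    exact D.𝔫T.neg_mem (D.transpose_mem_𝔫T.mpr hX)
  · intro hY
    exact ⟨-Yᵀ, D.𝔫.neg_mem (D.transpose_mem_𝔫.mpr hY), by simp⟩

lemma mem_thetaN_iff {g : G} : g ∈ D.thetaN ↔ ∃ X ∈ D.𝔫T, R.IsExp X g := by
  rw [thetaN_eq]
  exact mem_analyticSubgroup_iff D.isNilAlgebra_lower D.isSaturated_𝔫T inf_le_left

lemma commute_mexp {Y Z : Matrix (Fin m) (Fin m) ℝ} (hZ : Commute Z Y) :
    Commute Z (NormedSpace.exp Y) :=
  let _ : NormedAlgebra ℚ (Matrix (Fin m) (Fin m) ℝ) := NormedAlgebra.restrictScalars ℚ ℝ _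
  hZ.exp_right

lemma commute_Hm {Y : Matrix (Fin m) (Fin m) ℝ} (hY : Y ∈ D.𝔞) : Commute D.Hm Y :=
  D.comm _ D.H.2 _ hY

lemma commute_frame_exp {Y : Matrix (Fin m) (Fin m) ℝ} (hY : Y ∈ D.𝔞) :
    Commute (D.O * Matrix.diagonal D.h * D.Oᵀ) (NormedSpace.exp Y) := by
  rw [← Hm_eq]
  exact commute_mexp (D.commute_Hm hY)

lemma mem_A_iff {g : G} : g ∈ D.A ↔ ∃ Y ∈ D.𝔞, R.IsExp Y g := by
  refine ⟨fun hg => ?_, fun hg => Subgroup.subset_closure hg⟩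
  induction hg using Subgroup.closure_induction with
  | mem x hx => exact hx
  | one => exact ⟨0, D.𝔞.zero_mem, isExp_zero⟩
  | mul x y _ _ hx hy =>
    obtain ⟨A, hA, hxA⟩ := hx
    obtain ⟨B, hB, hyB⟩ := hy
    refine ⟨A + B, D.𝔞.add_mem hA hB, ?_⟩
    exact IsExp.mul (W := D.𝔞) (Z := fun A B => A + B) D.mem_lie
      (continuous_fst.add continuous_snd) (fun A hA B hB => ⟨D.mem_lie _ (D.𝔞.add_mem hA hB),
        exp_add_of_commute' (D.comm A hA B hB)⟩) (add_zero 0) hA hB hxA hyB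
  | inv x _ hx =>
    obtain ⟨A, hA, hxA⟩ := hx
    exact ⟨-A, D.𝔞.neg_mem hA, hxA.inv⟩

/-- (exp X - 1) exp Y is strictly block lower triangular, hence traceless. The trace of a product
therefore sees only its factor in A. -/
lemma exp_mul_mem_lower {X Y : Matrix (Fin m) (Fin m) ℝ} (hX : X ∈ D.lower) (hY : Y ∈ D.𝔞) :
    (NormedSpace.exp X * NormedSpace.exp Y).trace = (NormedSpace.exp Y).trace := by
  have h1 : (1 : Matrix (Fin m) (Fin m) ℝ) * (NormedSpace.exp X - 1) * NormedSpace.exp Y ∈ D.lower :=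
    mul_mem_strictUpper D.O_mul D.mul_O (Commute.one_right _) (D.commute_frame_exp hY)
      (fun i j hij => by simp [hij]) (D.isNilAlgebra_lower.exp_sub_one_mem' hX)
  have h2 := trace_eq_zero_of_mem_strictUpper h1 D.O_mul
  rw [one_mul, sub_mul, one_mul, Matrix.trace_sub, sub_eq_zero] at h2
  exact h2

lemma conj_exp_mem_𝔫T {X Y : Matrix (Fin m) (Fin m) ℝ} (hX : X ∈ D.𝔫T) (hY : Y ∈ D.𝔞) :
    NormedSpace.exp Y * X * NormedSpace.exp (-Y) ∈ D.𝔫T := by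
  refine ⟨?_, mul_mem_strictUpper D.O_mul D.mul_O (D.commute_frame_exp hY)
    (D.commute_frame_exp (D.𝔞.neg_mem hY)) (fun i j hij => by simp [hij]) hX.2⟩
  have h1 : expGL Y ∈ R.algGroup := by simpa using R.mem_lie_iff.mp (D.mem_lie _ hY) 1
  have h2 := R.conj_mem_lie h1 hX.1
  rwa [← expGL_neg] at h2

/-- Right multiplication by `exp 𝔫T` and by `exp 𝔞` preserves `exp 𝔫T exp 𝔞`. -/
lemma exp_mul_exp_mul_exp {X Y Z : Matrix (Fin m) (Fin m) ℝ} (hX : X ∈ D.𝔫T) (hY : Y ∈ D.𝔞)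
    (hZ : Z ∈ D.𝔫T ∨ Z ∈ D.𝔞) : ∃ X' ∈ D.𝔫T, ∃ Y' ∈ D.𝔞,
      NormedSpace.exp X' * NormedSpace.exp Y' =
        NormedSpace.exp X * NormedSpace.exp Y * NormedSpace.exp Z := by
  rcases hZ with hZ | hZ
  · have h1 := D.conj_exp_mem_𝔫T hZ hY
    refine ⟨_, D.isSaturated_𝔫T.mul_mem X hX _ h1, Y, hY, ?_⟩
    rw [D.isNilAlgebra_lower.exp_logU_mul hX.2 h1.2,
      exp_conj_of_mul_eq_one (exp_mul_exp_neg Y) (exp_neg_mul_exp Y)]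
    simp only [mul_assoc, exp_neg_mul_exp, mul_one]
  · exact ⟨X, hX, Y + Z, D.𝔞.add_mem hY hZ, by
      rw [exp_add_of_commute' (D.comm Y hY Z hZ), mul_assoc]⟩

/-- The function whose minimum over `exp 𝔫T exp 𝔞` gives the Iwasawa decomposition. -/
def iwasawaFun (g : G) (b : Matrix (Fin m) (Fin m) ℝ × Matrix (Fin m) (Fin m) ℝ) : ℝ :=
  ‖NormedSpace.exp (-b.2) * NormedSpace.exp (-b.1) * R.mat g‖ ^ 2 +
    ‖R.mat g⁻¹ * (NormedSpace.exp b.1 * NormedSpace.exp b.2)‖ ^ 2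

lemma continuous_iwasawaFun (g : G) : Continuous (iwasawaFun (R := R) g) := by
  have h1 : Continuous fun b : Matrix (Fin m) (Fin m) ℝ × Matrix (Fin m) (Fin m) ℝ =>
      NormedSpace.exp (-b.2) * NormedSpace.exp (-b.1) * R.mat g :=
    ((continuous_mexp.comp continuous_snd.neg).mul (continuous_mexp.comp continuous_fst.neg)).mul
      continuous_const
  have h2 : Continuous fun b : Matrix (Fin m) (Fin m) ℝ × Matrix (Fin m) (Fin m) ℝ =>
      R.mat g⁻¹ * (NormedSpace.exp b.1 * NormedSpace.exp b.2) :=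
    continuous_const.mul ((continuous_mexp.comp continuous_fst).mul
      (continuous_mexp.comp continuous_snd))
  exact (h1.norm.pow 2).add (h2.norm.pow 2)

lemma exists_norm_trace_le (m : ℕ) : ∃ C : ℝ, 0 ≤ C ∧ ∀ X : Matrix (Fin m) (Fin m) ℝ,
    |X.trace| ≤ C * ‖X‖ := by
  refine ⟨‖(1 : Matrix (Fin m) (Fin m) ℝ)‖, norm_nonneg _, fun X => ?_⟩
  have := abs_real_inner_le_norm (1 : Matrix (Fin m) (Fin m) ℝ) X
  rwa [inner_eq_trace, Matrix.transpose_one, one_mul] at this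

/-- A bound on the function bounds exp X exp Y and its inverse as matrices. Their traces are those
of exp Y and exp(-Y), which bounds Y; then X = log(exp X exp Y exp(-Y)) is a continuous function of
data in a compact set. -/
lemma isBounded_iwasawaFun_le (g : G) (C : ℝ) : Bornology.IsBounded
    {b : D.𝔫T × D.𝔞 | iwasawaFun (R := R) g (b.1.1, b.2.1) ≤ C} := by
  obtain ⟨T, hT0, hT⟩ := exists_norm_trace_le m
  set r₁ := ‖R.mat g‖ * (1 + C)
  set r₂ := (1 + C) * ‖R.mat g⁻¹‖
  have key : ∀ b : D.𝔫T × D.𝔞, iwasawaFun (R := R) g (b.1.1, b.2.1) ≤ C →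
      ‖NormedSpace.exp b.1.1 * NormedSpace.exp b.2.1‖ ≤ r₁ ∧ ‖b.2.1‖ ≤ 1 + (T * r₁ + T * r₂) := by
    rintro ⟨⟨X, hX⟩, ⟨Y, hY⟩⟩ hb
    simp only [iwasawaFun] at hb
    have hle : ∀ x : ℝ, x ≤ 1 + x ^ 2 := fun x => by nlinarith [sq_nonneg (x - 1)]
    set p := NormedSpace.exp (-Y) * NormedSpace.exp (-X)
    set q := NormedSpace.exp X * NormedSpace.exp Y
    have hp : ‖p‖ ≤ r₂ := by
      calc ‖p‖ = ‖p * R.mat g * R.mat g⁻¹‖ := by rw [mul_assoc, R.mat_mul_inv, mul_one]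
        _ ≤ ‖p * R.mat g‖ * ‖R.mat g⁻¹‖ := norm_mul_le _ _
        _ ≤ r₂ := by
          refine mul_le_mul_of_nonneg_right ?_ (norm_nonneg _)
          nlinarith [hle ‖p * R.mat g‖, sq_nonneg ‖R.mat g⁻¹ * q‖]
    have hq : ‖q‖ ≤ r₁ := by
      calc ‖q‖ = ‖R.mat g * (R.mat g⁻¹ * q)‖ := by rw [← mul_assoc, R.mat_mul_inv, one_mul]
        _ ≤ ‖R.mat g‖ * ‖R.mat g⁻¹ * q‖ := norm_mul_le _ _
        _ ≤ r₁ := by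
          refine mul_le_mul_of_nonneg_left ?_ (norm_nonneg _)
          nlinarith [hle ‖R.mat g⁻¹ * q‖, sq_nonneg ‖p * R.mat g‖]
    refine ⟨hq, ?_⟩
    have h1 := norm_sq_le_trace_exp (D.symm _ hY)
    rw [← D.exp_mul_mem_lower hX.2 hY,
      ← D.exp_mul_mem_lower (D.lower.neg_mem hX.2) (D.𝔞.neg_mem hY),
      Matrix.trace_mul_comm (NormedSpace.exp (-X))] at h1
    have h2 := (le_abs_self _).trans ((hT q).trans (mul_le_mul_of_nonneg_left hq hT0))
    have h3 := (le_abs_self _).trans ((hT p).trans (mul_le_mul_of_nonneg_left hp hT0))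
    show ‖Y‖ ≤ _
    linarith [hle ‖Y‖]
  have hcont : Continuous fun p : Matrix (Fin m) (Fin m) ℝ × Matrix (Fin m) (Fin m) ℝ =>
      ‖logU (p.1 * NormedSpace.exp (-p.2))‖ :=
    (continuous_logU.comp (continuous_fst.mul (continuous_mexp.comp continuous_snd.neg))).norm
  have hcpt : IsCompact (Metric.closedBall (0 : Matrix (Fin m) (Fin m) ℝ) r₁ ×ˢ
      Metric.closedBall (0 : Matrix (Fin m) (Fin m) ℝ) (1 + (T * r₁ + T * r₂))) :=
    (isCompact_closedBall _ _).prod (isCompact_closedBall _ _)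
  obtain ⟨B, hB⟩ := hcpt.bddAbove_image hcont.continuousOn
  refine isBounded_iff_forall_norm_le.mpr ⟨max B (1 + (T * r₁ + T * r₂)), ?_⟩
  rintro ⟨⟨X, hX⟩, ⟨Y, hY⟩⟩ hb
  obtain ⟨h1, h2⟩ := key _ hb
  refine norm_prod_le_iff.mpr ⟨le_max_of_le_left ?_, le_max_of_le_right h2⟩
  have h3 := hB ⟨(NormedSpace.exp X * NormedSpace.exp Y, Y), ⟨by simpa using h1, by simpa using h2⟩, rfl⟩
  simp only [mul_assoc, exp_mul_exp_neg, mul_one] at h3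
  rwa [logU_exp (D.isNilAlgebra_lower.isNilpotent hX.2)] at h3

/-- At a minimum, the matrix `s - s⁻¹`, with `s = g gᵀ`, is orthogonal to `Z`. -/
lemma trace_eq_zero_of_isMin {M M' Z : Matrix (Fin m) (Fin m) ℝ}
    (hmin : ∀ t : ℝ, ‖M‖ ^ 2 + ‖M'‖ ^ 2 ≤
      ‖NormedSpace.exp (t • -Z) * M‖ ^ 2 + ‖M' * NormedSpace.exp (t • Z)‖ ^ 2) :
    (Z * (M * Mᵀ - M'ᵀ * M')).trace = 0 := by
  have h1 := ((hasDerivAt_mexp (-Z) 0).mul_const M).norm_sq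
  have h2 := ((hasDerivAt_mexp Z 0).const_mul M').norm_sq
  have h3 := h1.add h2
  have h4 : IsLocalMin ((fun t : ℝ => ‖NormedSpace.exp (t • -Z) * M‖ ^ 2) +
      fun t : ℝ => ‖M' * NormedSpace.exp (t • Z)‖ ^ 2) 0 := by
    refine Eventually.of_forall fun t => ?_
    simpa using hmin t
  have h5 := h4.hasDerivAt_eq_zero h3
  simp only [zero_smul, NormedSpace.exp_zero, one_mul, mul_one, inner_eq_trace] at h5
  have e1 : (Mᵀ * (-Z * M)).trace = -(Z * (M * Mᵀ)).trace := by
    rw [Matrix.trace_mul_comm, neg_mul, neg_mul, Matrix.trace_neg, mul_assoc]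
  have e2 : (M'ᵀ * (M' * Z)).trace = (Z * (M'ᵀ * M')).trace := by
    rw [← mul_assoc, Matrix.trace_mul_comm]
  rw [e1, e2] at h5
  rw [mul_sub, Matrix.trace_sub]
  linarith

lemma posDef_mat_mul_transpose (g : G) : (R.mat g * (R.mat g)ᵀ).PosDef := by
  have := Matrix.PosDef.mul_conjTranspose_self (R.mat g)
    (fun v w hvw => by
      have h1 := congrArg (fun u => Matrix.vecMul u (R.mat g⁻¹)) hvw
      simpa [Matrix.vecMul_vecMul, R.mat_mul_inv] using h1)
  rwa [Matrix.conjTranspose_eq_transpose_of_trivial] at this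

lemma exists_log_mat_mul_transpose (g : G) : ∃ V ∈ R.lie, Vᵀ = V ∧
    NormedSpace.exp V = R.mat g * (R.mat g)ᵀ := by
  obtain ⟨h, hh, e⟩ := R.symmetric _ (R.proj g).2
  obtain ⟨V, h1, h2, h3⟩ := R.exists_symm_log (s := (R.proj g).1 * h) (mul_mem (R.proj g).2 hh) (by
    rw [Units.val_mul, e]; exact posDef_mat_mul_transpose g)
  exact ⟨V, h1, h2, by rw [h3, Units.val_mul, e]; rfl⟩

/-- A symmetric V in Lie(G) is V₀ + V₁ + V₁ᵀ with V₁ its part in Lie(N), and V₀ lies in 𝔞 by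
maximality. Rewriting V₁ + V₁ᵀ as 2V₁ᵀ + (V₁ - V₁ᵀ) leaves a skew matrix, which is orthogonal to
every symmetric S. -/
lemma trace_mul_eq_zero_of_lie {S : Matrix (Fin m) (Fin m) ℝ} (hS : Sᵀ = S)
    (h : ∀ Z, Z ∈ D.𝔫T ∨ Z ∈ D.𝔞 → (Z * S).trace = 0) {V : Matrix (Fin m) (Fin m) ℝ}
    (hV : V ∈ R.lie) (hVs : Vᵀ = V) : (V * S).trace = 0 := by
  set V₀ := blockPart D.O D.h (· = 0) V
  set V₁ := blockPart D.O D.h (0 < ·) V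
  have hVs' : ∀ i j, (D.Oᵀ * V * D.O) j i = (D.Oᵀ * V * D.O) i j := by
    have e : (D.Oᵀ * V * D.O)ᵀ = D.Oᵀ * V * D.O := by
      simp [Matrix.transpose_mul, mul_assoc, hVs]
    intro i j
    rw [← Matrix.transpose_apply (D.Oᵀ * V * D.O) i j, e]
  have hT : ∀ (X : Matrix (Fin m) (Fin m) ℝ) (i j), (D.Oᵀ * Xᵀ * D.O) i j =
      (D.Oᵀ * X * D.O) j i := fun X i j => by
    have e : D.Oᵀ * Xᵀ * D.O = (D.Oᵀ * X * D.O)ᵀ := by simp [Matrix.transpose_mul, mul_assoc]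
    rw [e, Matrix.transpose_apply]
  have h0s : V₀ᵀ = V₀ := eq_of_conj_eq D.O_mul fun i j => by
    rw [hT, conj_blockPart D.mul_O, conj_blockPart D.mul_O, hVs']
    have : (D.h j - D.h i = 0) ↔ (D.h i - D.h j = 0) := by constructor <;> intro hh <;> linarith
    simp only [this]
  have hdec : V = V₀ + (V₁ + V₁ᵀ) := eq_of_conj_eq D.O_mul fun i j => by
    rw [mul_add, mul_add, add_mul, add_mul, Matrix.add_apply, Matrix.add_apply, hT,
      conj_blockPart D.mul_O, conj_blockPart D.mul_O, conj_blockPart D.mul_O, hVs']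
    rcases lt_trichotomy (D.h i) (D.h j) with hij | hij | hij
    · rw [if_neg (by linarith), if_neg (by linarith), if_pos (by linarith)]; ring
    · rw [if_pos (by linarith), if_neg (by linarith), if_neg (by linarith)]; ring
    · rw [if_neg (by linarith), if_pos (by linarith), if_neg (by linarith)]; ring
  have hV₀ : V₀ ∈ D.𝔞 := D.maximal _ (D.blockPart_mem_lie _ hV) h0s
    fun Y hY => D.blockPart_zero_comm hV hY
  have hV₁ : V₁ᵀ ∈ D.𝔫T := D.transpose_mem_𝔫T.mpr (D.blockPart_pos_mem_𝔫 hV)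
  have hskew := trace_skew_mul_symm (Z := V₁ - V₁ᵀ) (S := S) (by simp) hS
  rw [hdec, show V₀ + (V₁ + V₁ᵀ) = V₀ + (2 : ℝ) • V₁ᵀ + (V₁ - V₁ᵀ) by rw [two_smul]; abel,
    add_mul, add_mul, Matrix.trace_add, Matrix.trace_add, hskew, smul_mul_assoc, Matrix.trace_smul,
    h _ (Or.inl hV₁), h _ (Or.inr hV₀)]
  simp

/-- The Iwasawa decomposition `G = θ(N) A K`. -/
theorem exists_iwasawa (g : G) :
    ∃ a : D.A, ∃ v ∈ D.thetaN, ∃ k ∈ R.K, g = v * a * k := by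
  have hc : Continuous fun b : D.𝔫T × D.𝔞 => iwasawaFun (R := R) g (b.1.1, b.2.1) :=
    (continuous_iwasawaFun g).comp
      (f := fun b : D.𝔫T × D.𝔞 => (b.1.1, b.2.1)) (by fun_prop)
  obtain ⟨⟨⟨X, hX⟩, ⟨Y, hY⟩⟩, hmin⟩ := hc.exists_forall_le_of_isBounded 0
    (D.isBounded_iwasawaFun_le g _)
  obtain ⟨v, hv⟩ := exists_isExp (R := R) hX.1
  obtain ⟨a, ha⟩ := exists_isExp (R := R) (D.mem_lie _ hY)
  have hvN : v ∈ D.thetaN := D.mem_thetaN_iff.mpr ⟨X, hX, hv⟩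
  have haA : a ∈ D.A := D.mem_A_iff.mpr ⟨Y, hY, ha⟩
  set k := (v * a)⁻¹ * g with hk
  refine ⟨⟨a, haA⟩, v, hvN, k, ?_, by rw [hk, mul_inv_cancel_left]⟩
  have hmatk : R.mat k = NormedSpace.exp (-Y) * NormedSpace.exp (-X) * R.mat g := by
    rw [hk, mul_inv_rev, mat_mul, mat_mul, hv.inv.mat_eq, ha.inv.mat_eq]
  have hmatk' : R.mat k⁻¹ = R.mat g⁻¹ * (NormedSpace.exp X * NormedSpace.exp Y) := by
    rw [hk, mul_inv_rev, inv_inv, mat_mul, mat_mul, hv.mat_eq, ha.mat_eq]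
  -- Right multiplication by exp(tZ) stays in exp 𝔫T exp 𝔞, so the derivative along it vanishes at
  -- the minimum. This is the equation for k = (va)⁻¹g.
  have hcrit : ∀ Z, Z ∈ D.𝔫T ∨ Z ∈ D.𝔞 →
      (Z * (R.mat k * (R.mat k)ᵀ - (R.mat k⁻¹)ᵀ * R.mat k⁻¹)).trace = 0 := by
    intro Z hZ
    refine trace_eq_zero_of_isMin fun t => ?_
    obtain ⟨X', hX', Y', hY', e⟩ := D.exp_mul_exp_mul_exp hX hY (Z := t • Z)
      (hZ.imp (D.𝔫T.smul_mem t) (D.𝔞.smul_mem t))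
    have e' : NormedSpace.exp (-Y') * NormedSpace.exp (-X') =
        NormedSpace.exp (t • -Z) * (NormedSpace.exp (-Y) * NormedSpace.exp (-X)) := by
      have h1 : expGL X' * expGL Y' = expGL X * expGL Y * expGL (t • Z) := Units.ext e
      have h2 := congrArg Units.val (congrArg (·⁻¹) h1)
      simp only [mul_inv_rev, ← expGL_neg, ← smul_neg] at h2
      exact h2
    have h3 := hmin (⟨X', hX'⟩, ⟨Y', hY'⟩)
    simp only [iwasawaFun] at h3
    rw [e, e'] at h3
    rw [hmatk, hmatk']
    simpa only [mul_assoc] using h3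
  -- With kkᵀ = exp V the critical equations say that exp V - exp(-V) is orthogonal to all symmetric
  -- elements of Lie(G). Testing against V itself forces V = 0, so k is orthogonal.
  obtain ⟨V, hV, hVs, hVe⟩ := exists_log_mat_mul_transpose (R := R) k
  have hinv : (R.mat k⁻¹)ᵀ * R.mat k⁻¹ = NormedSpace.exp (-V) := by
    have h1 : NormedSpace.exp V * ((R.mat k⁻¹)ᵀ * R.mat k⁻¹) = 1 := by
      rw [hVe, mul_assoc, ← mul_assoc (R.mat k)ᵀ, ← Matrix.transpose_mul, R.mat_inv_mul,
        Matrix.transpose_one, one_mul, R.mat_mul_inv]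
    calc _ = NormedSpace.exp (-V) * NormedSpace.exp V * ((R.mat k⁻¹)ᵀ * R.mat k⁻¹) := by
          rw [exp_neg_mul_exp, one_mul]
      _ = _ := by rw [mul_assoc, h1, mul_one]
  have hS : (NormedSpace.exp V - NormedSpace.exp (-V))ᵀ =
      NormedSpace.exp V - NormedSpace.exp (-V) := by
    rw [Matrix.transpose_sub, ← Matrix.exp_transpose, ← Matrix.exp_transpose, Matrix.transpose_neg, hVs]
  rw [hinv, ← hVe] at hcrit
  have hV0 := eq_zero_of_trace_mul_sinh hVs (D.trace_mul_eq_zero_of_lie hS hcrit hV hVs)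
  show R.mat k * (R.mat k)ᵀ = 1
  rw [← hVe, hV0, NormedSpace.exp_zero]

/-- The default value in `aPart` is thus never taken. -/
lemma aPart_spec (g : G) : ∃ v ∈ D.thetaN, ∃ k ∈ R.K, g = v * (D.aPart g : G) * k := by
  rw [aPart, dif_pos (D.exists_iwasawa g)]
  exact (D.exists_iwasawa g).choose_spec

end IwasawaDatum

end RealReductiveGroup

namespace RealReductiveGroup

open Filter Topology Function

/-! ### Gram determinants -/

section GramDet

variable {E F : Type*} [NormedAddCommGroup E] [InnerProductSpace ℝ E] [FiniteDimensional ℝ E]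
  [NormedAddCommGroup F] [InnerProductSpace ℝ F] [FiniteDimensional ℝ F]

/-- The Gram determinant `det (τ* τ)` of a linear map. -/
def gramDet (τ : E →ₗ[ℝ] F) : ℝ := LinearMap.det (LinearMap.adjoint τ ∘ₗ τ)

lemma gramDet_comp (τ : E →ₗ[ℝ] F) (u : E →ₗ[ℝ] E) :
    gramDet (τ ∘ₗ u) = LinearMap.det u ^ 2 * gramDet τ := by
  have h1 : LinearMap.det (LinearMap.adjoint u) = LinearMap.det u := by
    have := LinearMap.det_toMatrix (stdOrthonormalBasis ℝ E).toBasis (LinearMap.adjoint u)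
    rw [LinearMap.toMatrix_adjoint, Matrix.conjTranspose_eq_transpose_of_trivial,
      Matrix.det_transpose, LinearMap.det_toMatrix] at this
    exact this.symm
  rw [gramDet, gramDet, LinearMap.adjoint_comp, LinearMap.comp_assoc, ← LinearMap.comp_assoc u,
    LinearMap.det_comp, LinearMap.det_comp, h1]
  ring

lemma gramDet_congr {τ : E →ₗ[ℝ] F} {F' : Type*} [NormedAddCommGroup F'] [InnerProductSpace ℝ F']
    [FiniteDimensional ℝ F'] {τ' : E →ₗ[ℝ] F'}
    (h : ∀ x y, inner ℝ (τ x) (τ y) = inner ℝ (τ' x) (τ' y)) : gramDet τ = gramDet τ' := by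
  rw [gramDet, gramDet]
  congr 1
  refine LinearMap.ext fun x => ext_inner_left ℝ fun y => ?_
  rw [LinearMap.comp_apply, LinearMap.comp_apply, LinearMap.adjoint_inner_right,
    LinearMap.adjoint_inner_right, h]

lemma inner_adjoint_comp_self (τ : E →ₗ[ℝ] F) (x : E) :
    inner ℝ x ((LinearMap.adjoint τ ∘ₗ τ) x) = ‖τ x‖ ^ 2 := by
  rw [LinearMap.comp_apply, LinearMap.adjoint_inner_right, real_inner_self_eq_norm_sq]

/-- A positive operator has an orthonormal eigenbasis that computes its determinant. -/
lemma exists_gram_eigenbasis (τ : E →ₗ[ℝ] F) : ∃ (b : OrthonormalBasis (Fin (Module.finrank ℝ E)) ℝ E),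
    gramDet τ = ∏ i, ‖τ (b i)‖ ^ 2 ∧ ∀ x, ‖τ x‖ ^ 2 = ∑ i, ‖τ (b i)‖ ^ 2 * inner ℝ (b i) x ^ 2 := by
  have hs := LinearMap.isSymmetric_adjoint_comp_self τ
  have hev : ∀ i, hs.eigenvalues rfl i = ‖τ (hs.eigenvectorBasis rfl i)‖ ^ 2 := fun i => by
    rw [← inner_adjoint_comp_self, hs.apply_eigenvectorBasis, inner_smul_right,
      real_inner_self_eq_norm_sq, OrthonormalBasis.norm_eq_one]
    simp
  refine ⟨hs.eigenvectorBasis rfl, ?_, fun x => ?_⟩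
  · rw [gramDet, hs.det_eq_prod_eigenvalues rfl]
    exact Finset.prod_congr rfl fun i _ => hev i
  · rw [← inner_adjoint_comp_self, ← OrthonormalBasis.sum_inner_mul_inner (hs.eigenvectorBasis rfl)]
    refine Finset.sum_congr rfl fun i _ => ?_
    rw [← hs (hs.eigenvectorBasis rfl i) x, hs.apply_eigenvectorBasis, ← hev]
    rw [inner_smul_left, real_inner_comm x]
    simp
    ring

lemma gramDet_le {τ : E →ₗ[ℝ] F} {r : ℝ} (h : ∀ x, ‖τ x‖ ≤ r * ‖x‖) :
    gramDet τ ≤ (r ^ 2) ^ Module.finrank ℝ E := by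
  obtain ⟨b, hb, -⟩ := exists_gram_eigenbasis τ
  rw [hb]
  refine (Finset.prod_le_prod (g := fun _ => r ^ 2) (fun i _ => sq_nonneg _) fun i _ => ?_).trans
    (by simp)
  have := h (b i)
  rw [b.norm_eq_one, mul_one] at this
  exact pow_le_pow_left₀ (norm_nonneg _) this 2

/-- A map `1 + S` with `S` perpendicular to the identity has large Gram determinant. -/
lemma norm_sq_add_le_gramDet {τ : E →ₗ[ℝ] F} {S : E →ₗ[ℝ] F}
    (h : ∀ x, ‖τ x‖ ^ 2 = ‖x‖ ^ 2 + ‖S x‖ ^ 2) :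
    1 ≤ gramDet τ ∧ ∀ y, ‖S y‖ ^ 2 ≤ (gramDet τ - 1) * ‖y‖ ^ 2 := by
  obtain ⟨b, hb, hx⟩ := exists_gram_eigenbasis τ
  have h1 : ∀ i, 1 ≤ ‖τ (b i)‖ ^ 2 := fun i => by
    rw [h, b.norm_eq_one]; nlinarith [sq_nonneg ‖S (b i)‖]
  -- Every factor of the determinant is at least 1, so each one is bounded by the product.
  have h2 : ∀ i, ‖τ (b i)‖ ^ 2 ≤ gramDet τ := fun i => by
    rw [hb]
    rw [← Finset.mul_prod_erase _ _ (Finset.mem_univ i)]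
    refine le_mul_of_one_le_right (sq_nonneg _) ?_
    calc (1 : ℝ) = ∏ j ∈ Finset.univ.erase i, 1 := Finset.prod_const_one.symm
      _ ≤ _ := Finset.prod_le_prod (fun _ _ => zero_le_one) fun j _ => h1 j
  refine ⟨?_, fun y => ?_⟩
  · rw [hb]
    calc (1 : ℝ) = ∏ j : Fin (Module.finrank ℝ E), 1 := Finset.prod_const_one.symm
      _ ≤ _ := Finset.prod_le_prod (fun _ _ => zero_le_one) fun j _ => h1 j
  have h3 : ‖τ y‖ ^ 2 ≤ gramDet τ * ‖y‖ ^ 2 := by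
    rw [hx, ← b.sum_sq_inner_right y, Finset.mul_sum]
    exact Finset.sum_le_sum fun i _ => mul_le_mul_of_nonneg_right (h2 i) (sq_nonneg _)
  rw [h] at h3
  linarith

/-- The compression u of τ to V has determinant 1, so τ∘u⁻¹ has the same Gram determinant as τ and
has the form 1 + S with S mapping into the orthogonal complement of V. -/
lemma norm_sub_sq_le_gramDet {V : Submodule ℝ F} (τ : V →ₗ[ℝ] F)
    (hdet : LinearMap.det (V.orthogonalProjectionOnto.toLinearMap ∘ₗ τ) = 1) :
    1 ≤ gramDet τ ∧ ∀ y, ‖τ y - V.starProjection (τ y)‖ ^ 2 ≤ (gramDet τ - 1) * ‖V.starProjection (τ y)‖ ^ 2 := by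
  set u := V.orthogonalProjectionOnto.toLinearMap ∘ₗ τ with hu
  have hunit : IsUnit u := (LinearMap.isUnit_iff_isUnit_det u).mpr (by rw [hdet]; exact isUnit_one)
  obtain ⟨⟨u', w, huw, hwu⟩, rfl : u' = u⟩ := hunit
  have hw : LinearMap.det w = 1 := by
    have := congrArg LinearMap.det huw
    rwa [map_mul, hdet, one_mul, map_one] at this
  have hg := gramDet_comp τ w
  rw [hw, one_pow, one_mul] at hg
  have hpu : ∀ x, V.starProjection (τ x) = u x := fun x => rfl
  have h1 := norm_sq_add_le_gramDet (τ := τ ∘ₗ w)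
    (S := (LinearMap.id - V.starProjection.toLinearMap) ∘ₗ τ ∘ₗ w) (fun x => by
      have h2 := Submodule.norm_sq_eq_add_norm_sq_starProjection (τ (w x)) V
      have h3 : V.starProjection (τ (w x)) = x := by
        rw [hpu, ← Module.End.mul_apply, huw, Module.End.one_apply]
      rw [Submodule.starProjection_orthogonal', h3] at h2
      simpa [h3] using h2)
  rw [hg] at h1
  refine ⟨h1.1, fun y => ?_⟩
  have h5 := h1.2 (u y)
  have h4 : w (u y) = y := by rw [← Module.End.mul_apply, hwu, Module.End.one_apply]
  simpa [h4, hpu] using h5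

end GramDet

end RealReductiveGroup

namespace RealReductiveGroup

open scoped Matrix.Norms.Frobenius
open Filter Topology Function

attribute [local instance] frobeniusInnerProductSpace

variable {m : ℕ} {G : Type*} [Group G] [TopologicalSpace G] [IsTopologicalGroup G]
  {R : RealReductiveGroup G m}

namespace IwasawaDatum

variable (D : R.IwasawaDatum)

/-! ### The dilations of `Lie(G)` -/

/-- Conjugation by `exp (-s H)`, for the regular element `H`. -/
def dil (s : ℝ) : Matrix (Fin m) (Fin m) ℝ →ₗ[ℝ] Matrix (Fin m) (Fin m) ℝ :=
  LinearMap.mulLeft ℝ (NormedSpace.exp (-(s • D.Hm))) ∘ₗ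
    LinearMap.mulRight ℝ (NormedSpace.exp (s • D.Hm))

lemma dil_apply (s : ℝ) (X : Matrix (Fin m) (Fin m) ℝ) :
    D.dil s X = NormedSpace.exp (-(s • D.Hm)) * X * NormedSpace.exp (s • D.Hm) :=
  (mul_assoc _ _ _).symm

lemma dil_mul (s : ℝ) (X Y : Matrix (Fin m) (Fin m) ℝ) :
    D.dil s (X * Y) = D.dil s X * D.dil s Y := by
  simp only [dil_apply]
  calc _ = NormedSpace.exp (-(s • D.Hm)) * X * 1 * Y * NormedSpace.exp (s • D.Hm) := by
        simp only [mul_assoc, one_mul]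
    _ = _ := by rw [← exp_mul_exp_neg (s • D.Hm)]; simp only [mul_assoc]

lemma dil_exp (s : ℝ) (X : Matrix (Fin m) (Fin m) ℝ) :
    NormedSpace.exp (D.dil s X) = D.dil s (NormedSpace.exp X) := by
  rw [dil_apply, dil_apply, exp_conj_of_mul_eq_one (exp_neg_mul_exp _) (exp_mul_exp_neg _)]

/-- For s ≥ 0 the dilation contracts the strictly upper blocks, fixes the diagonal blocks and
expands the lower ones. -/
lemma conj_dil (s : ℝ) (X : Matrix (Fin m) (Fin m) ℝ) (i j : Fin m) :
    (D.Oᵀ * D.dil s X * D.O) i j = Real.exp (-(s * (D.h i - D.h j))) * (D.Oᵀ * X * D.O) i j := by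
  have e1 := exp_smul_orthogonal_diagonal D.O_mul D.mul_O D.h s
  have e2 := exp_smul_orthogonal_diagonal D.O_mul D.mul_O D.h (-s)
  rw [neg_smul] at e2
  have e3 : D.Oᵀ * D.dil s X * D.O = Matrix.diagonal (fun i => Real.exp (-s * D.h i)) *
      (D.Oᵀ * X * D.O) * Matrix.diagonal (fun i => Real.exp (s * D.h i)) := by
    rw [dil_apply, Hm_eq, e1, e2]
    calc _ = (D.Oᵀ * D.O) * Matrix.diagonal (fun i => Real.exp (-s * D.h i)) *
        (D.Oᵀ * X * D.O) * Matrix.diagonal (fun i => Real.exp (s * D.h i)) * (D.Oᵀ * D.O) := by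
          simp only [mul_assoc]
      _ = _ := by rw [D.mul_O, one_mul, mul_one]
  rw [e3, Matrix.mul_diagonal, Matrix.diagonal_mul, mul_right_comm, ← Real.exp_add]
  congr 2
  ring

lemma dil_zero (X : Matrix (Fin m) (Fin m) ℝ) : D.dil 0 X = X := by
  simp [dil_apply]

lemma dil_dil_neg (s : ℝ) (X : Matrix (Fin m) (Fin m) ℝ) : D.dil s (D.dil (-s) X) = X := by
  refine eq_of_conj_eq D.O_mul fun i j => ?_
  rw [conj_dil, conj_dil, ← mul_assoc, ← Real.exp_add]
  simp

lemma continuous_dil : Continuous fun p : ℝ × Matrix (Fin m) (Fin m) ℝ => D.dil p.1 p.2 := by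
  simp only [dil_apply]
  have h1 : Continuous fun p : ℝ × Matrix (Fin m) (Fin m) ℝ => p.1 • D.Hm :=
    continuous_fst.smul continuous_const
  exact ((continuous_mexp.comp h1.neg).mul continuous_snd).mul (continuous_mexp.comp h1)

lemma dil_mem_lie (s : ℝ) {X : Matrix (Fin m) (Fin m) ℝ} (hX : X ∈ R.lie) : D.dil s X ∈ R.lie := by
  have h1 : expGL (-(s • D.Hm)) ∈ R.algGroup := by
    have := R.mem_lie_iff.mp (D.mem_lie _ D.H.2) (-s)
    rwa [neg_smul] at this
  have h2 := R.conj_mem_lie h1 hX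
  rw [← expGL_neg, neg_neg] at h2
  rw [dil_apply]
  exact h2

lemma dil_mem_strictUpper (s : ℝ) {h' : Fin m → ℝ} {X : Matrix (Fin m) (Fin m) ℝ}
    (hX : X ∈ strictUpper D.O h') : D.dil s X ∈ strictUpper D.O h' := fun i j hij => by
  rw [conj_dil, hX i j hij, mul_zero]

lemma dil_mem_𝔫 (s : ℝ) {X : Matrix (Fin m) (Fin m) ℝ} (hX : X ∈ D.𝔫) : D.dil s X ∈ D.𝔫 := by
  rw [𝔫_eq] at hX ⊢
  exact ⟨D.dil_mem_lie s hX.1, D.dil_mem_strictUpper s hX.2⟩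

lemma dil_mem_𝔫T (s : ℝ) {X : Matrix (Fin m) (Fin m) ℝ} (hX : X ∈ D.𝔫T) : D.dil s X ∈ D.𝔫T :=
  ⟨D.dil_mem_lie s hX.1, D.dil_mem_strictUpper s hX.2⟩

lemma trace_transpose_mul_eq_sum (X Y : Matrix (Fin m) (Fin m) ℝ) : (Xᵀ * Y).trace =
    ∑ j, ∑ i, (D.Oᵀ * X * D.O) i j * (D.Oᵀ * Y * D.O) i j := by
  rw [trace_transpose_mul_conj D.O_mul, Matrix.trace]
  exact Finset.sum_congr rfl fun j _ => Matrix.mul_apply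

lemma norm_le_of_conj_le {X Y : Matrix (Fin m) (Fin m) ℝ} {r : ℝ} (hr : 0 ≤ r)
    (h : ∀ i j, |(D.Oᵀ * X * D.O) i j| ≤ r * |(D.Oᵀ * Y * D.O) i j|) : ‖X‖ ≤ r * ‖Y‖ := by
  refine abs_le_of_sq_le_sq' ?_ (by positivity) |>.2
  rw [mul_pow, frobenius_norm_sq, frobenius_norm_sq, D.trace_transpose_mul_eq_sum,
    D.trace_transpose_mul_eq_sum, Finset.mul_sum]
  refine Finset.sum_le_sum fun j _ => ?_
  rw [Finset.mul_sum]
  refine Finset.sum_le_sum fun i _ => ?_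
  have := pow_le_pow_left₀ (abs_nonneg _) (h i j) 2
  rw [mul_pow, sq_abs, sq_abs] at this
  linarith

lemma exists_gap : ∃ c : ℝ, 0 < c ∧ ∀ i j, D.h i < D.h j → c ≤ D.h j - D.h i := by
  have : ∀ p : Fin m × Fin m, ∃ c : ℝ, 0 < c ∧ (D.h p.1 < D.h p.2 → c ≤ D.h p.2 - D.h p.1) := by
    intro p
    by_cases hp : D.h p.1 < D.h p.2
    · exact ⟨_, sub_pos.mpr hp, fun _ => le_rfl⟩
    · exact ⟨1, one_pos, fun h => absurd h hp⟩
  choose c hc hc' using this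
  rcases isEmpty_or_nonempty (Fin m × Fin m) with he | he
  · exact ⟨1, one_pos, fun i j _ => (he.false (i, j)).elim⟩
  · obtain ⟨p, hp⟩ := Finite.exists_min c
    exact ⟨c p, hc p, fun i j hij => (hp (i, j)).trans (hc' (i, j) hij)⟩

/-- The smallest positive difference of eigenvalues of the regular element. -/
def gap : ℝ := D.exists_gap.choose
lemma gap_pos : 0 < D.gap := D.exists_gap.choose_spec.1
lemma gap_le {i j : Fin m} (h : D.h i < D.h j) : D.gap ≤ D.h j - D.h i :=
  D.exists_gap.choose_spec.2 i j h

lemma norm_dil_upper_le {s : ℝ} (hs : 0 ≤ s) {X : Matrix (Fin m) (Fin m) ℝ} (hX : X ∈ D.upper) :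
    ‖D.dil s X‖ ≤ Real.exp (-(s * D.gap)) * ‖X‖ := by
  refine D.norm_le_of_conj_le (Real.exp_pos _).le fun i j => ?_
  rw [conj_dil, abs_mul, Real.abs_exp]
  rcases le_or_gt (D.h i) (D.h j) with hij | hij
  · rw [hX i j hij]; simp
  · have := D.gap_le hij
    gcongr

lemma norm_dil_lower_le {s : ℝ} (hs : s ≤ 0) {X : Matrix (Fin m) (Fin m) ℝ} (hX : X ∈ D.lower) :
    ‖D.dil s X‖ ≤ Real.exp (s * D.gap) * ‖X‖ := by
  refine D.norm_le_of_conj_le (Real.exp_pos _).le fun i j => ?_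
  rw [conj_dil, abs_mul, Real.abs_exp]
  rcases le_or_gt (D.h j) (D.h i) with hij | hij
  · rw [hX i j (by simpa using hij)]; simp
  · have := D.gap_le hij
    gcongr
    nlinarith

lemma norm_le_norm_dil {s : ℝ} (hs : 0 ≤ s) {X : Matrix (Fin m) (Fin m) ℝ}
    (hX : ∀ i j, D.h j < D.h i → (D.Oᵀ * X * D.O) i j = 0) : ‖X‖ ≤ ‖D.dil s X‖ := by
  rw [← one_mul ‖D.dil s X‖]
  refine D.norm_le_of_conj_le zero_le_one fun i j => ?_
  rw [conj_dil, abs_mul, Real.abs_exp, one_mul]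
  rcases lt_or_ge (D.h j) (D.h i) with hij | hij
  · rw [hX i j hij]; simp
  · refine le_mul_of_one_le_left (abs_nonneg _) (Real.one_le_exp ?_)
    nlinarith

lemma exists_norm_dil_le : ∃ L : ℝ, 0 ≤ L ∧ ∀ s : ℝ, 0 ≤ s → ∀ X : Matrix (Fin m) (Fin m) ℝ,
    ‖D.dil s X‖ ≤ Real.exp (s * L) * ‖X‖ := by
  refine ⟨∑ p : Fin m × Fin m, |D.h p.1 - D.h p.2|, Finset.sum_nonneg fun _ _ => abs_nonneg _,
    fun s hs X => D.norm_le_of_conj_le (Real.exp_pos _).le fun i j => ?_⟩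
  rw [conj_dil, abs_mul, Real.abs_exp]
  have h1 := Finset.single_le_sum (f := fun p : Fin m × Fin m => |D.h p.1 - D.h p.2|)
    (fun _ _ => abs_nonneg _) (Finset.mem_univ (i, j))
  have h2 := neg_le_abs (D.h i - D.h j)
  gcongr
  nlinarith

/-! ### The orthogonal projection to `Lie(N)` -/

/-- On Lie(G) the orthogonal projection to Lie(N) just cuts out blocks, so it commutes with the
dilations. -/
lemma starProjection_eq_blockPart {X : Matrix (Fin m) (Fin m) ℝ} (hX : X ∈ R.lie) :
    D.𝔫.starProjection X = blockPart D.O D.h (0 < ·) X := by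
  refine Submodule.eq_starProjection_of_mem_of_inner_eq_zero (D.blockPart_pos_mem_𝔫 hX) fun Y hY => ?_
  rw [inner_eq_trace, D.trace_transpose_mul_eq_sum]
  refine Finset.sum_eq_zero fun j _ => Finset.sum_eq_zero fun i _ => ?_
  rw [mul_sub, sub_mul, Matrix.sub_apply, conj_blockPart D.mul_O]
  split_ifs with hij
  · simp
  · rw [D.𝔫_le_upper hY i j (by linarith), mul_zero]

lemma starProjection_dil (s : ℝ) {X : Matrix (Fin m) (Fin m) ℝ} (hX : X ∈ R.lie) :
    D.𝔫.starProjection (D.dil s X) = D.dil s (D.𝔫.starProjection X) := by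
  rw [D.starProjection_eq_blockPart hX, D.starProjection_eq_blockPart (D.dil_mem_lie s hX)]
  refine eq_of_conj_eq D.O_mul fun i j => ?_
  rw [conj_blockPart D.mul_O, conj_dil, conj_dil, conj_blockPart D.mul_O]
  split_ifs <;> simp

/-- The map `Y ↦ P Y Q` on `Lie(N)`. -/
def conjN (P Q : Matrix (Fin m) (Fin m) ℝ) : D.𝔫 →ₗ[ℝ] Matrix (Fin m) (Fin m) ℝ :=
  (LinearMap.mulLeft ℝ P ∘ₗ LinearMap.mulRight ℝ Q) ∘ₗ D.𝔫.subtype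

lemma conjN_apply (P Q : Matrix (Fin m) (Fin m) ℝ) (Y : D.𝔫) : D.conjN P Q Y = P * Y.1 * Q :=
  (mul_assoc _ _ _).symm

/-- `Ad (exp W)` on `Lie(N)`. -/
def expConj (W : Matrix (Fin m) (Fin m) ℝ) : D.𝔫 →ₗ[ℝ] Matrix (Fin m) (Fin m) ℝ :=
  D.conjN (NormedSpace.exp W) (NormedSpace.exp (-W))

lemma expConj_mem_lie {W : Matrix (Fin m) (Fin m) ℝ} (hW : W ∈ R.lie) (Y : D.𝔫) :
    D.expConj W Y ∈ R.lie := by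
  have h1 : expGL W ∈ R.algGroup := by simpa using R.mem_lie_iff.mp hW 1
  have h2 := R.conj_mem_lie h1 (D.𝔫_le_lieAlg Y.2)
  rw [← expGL_neg] at h2
  rw [expConj, conjN_apply]
  exact h2

/-- The restriction of a dilation to `Lie(N)`. -/
def dilN (s : ℝ) : D.𝔫 →ₗ[ℝ] D.𝔫 := (D.dil s).restrict fun _ => D.dil_mem_𝔫 s

lemma coe_dilN (s : ℝ) (Y : D.𝔫) : (D.dilN s Y : Matrix (Fin m) (Fin m) ℝ) = D.dil s Y.1 := rfl

lemma expConj_dil (s : ℝ) (W : Matrix (Fin m) (Fin m) ℝ) (Y : D.𝔫) :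
    D.expConj (D.dil s W) (D.dilN s Y) = D.dil s (D.expConj W Y) := by
  rw [expConj, expConj, conjN_apply, conjN_apply, coe_dilN, ← map_neg, dil_exp, dil_exp, ← dil_mul,
    ← dil_mul]

lemma det_dilN_ne_zero (s : ℝ) : LinearMap.det (D.dilN s) ≠ 0 := by
  have h1 : D.dilN s * D.dilN (-s) = 1 :=
    LinearMap.ext fun Y => Subtype.ext (D.dil_dil_neg s Y.1)
  have h2 := congrArg LinearMap.det h1
  rw [map_mul, map_one] at h2
  exact left_ne_zero_of_mul_eq_one h2

/-- The compression of `Ad (exp W)` to `Lie(N)`. -/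
def compr (W : Matrix (Fin m) (Fin m) ℝ) : D.𝔫 →ₗ[ℝ] D.𝔫 :=
  D.𝔫.orthogonalProjectionOnto.toLinearMap ∘ₗ D.expConj W

lemma coe_compr (W : Matrix (Fin m) (Fin m) ℝ) (Y : D.𝔫) :
    (D.compr W Y : Matrix (Fin m) (Fin m) ℝ) = D.𝔫.starProjection (D.expConj W Y) := rfl

lemma continuous_expConj (Y : D.𝔫) : Continuous fun W => D.expConj W Y := by
  simp only [expConj, conjN_apply]
  exact (continuous_mexp.mul continuous_const).mul (continuous_mexp.comp continuous_neg)

lemma continuous_det_compr : Continuous fun W => LinearMap.det (D.compr W) := by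
  set b := stdOrthonormalBasis ℝ D.𝔫
  have h1 : (fun W => LinearMap.det (D.compr W)) =
      fun W => (LinearMap.toMatrix b.toBasis b.toBasis (D.compr W)).det :=
    funext fun W => (LinearMap.det_toMatrix _ _).symm
  rw [h1]
  refine Continuous.matrix_det (continuous_matrix fun i j => ?_)
  simp only [LinearMap.toMatrix_apply, OrthonormalBasis.coe_toBasis, OrthonormalBasis.coe_toBasis_repr_apply,
    OrthonormalBasis.repr_apply_apply]
  exact continuous_const.inner
    (D.𝔫.orthogonalProjectionOnto.continuous.comp (D.continuous_expConj (b j)))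

/-- Dilating W conjugates the compression by a dilation of Lie(N), so its determinant does not
change. Along the given sequence W shrinks to 0, where the compression is the identity. -/
lemma det_compr_eq_one {W : Matrix (Fin m) (Fin m) ℝ} (hW : W ∈ R.lie) {s : ℕ → ℝ}
    (hs : Tendsto (fun n => D.dil (s n) W) atTop (𝓝 0)) : LinearMap.det (D.compr W) = 1 := by
  have h1 : ∀ s, LinearMap.det (D.compr (D.dil s W)) = LinearMap.det (D.compr W) := by
    intro s
    have h2 : D.compr (D.dil s W) * D.dilN s = D.dilN s * D.compr W := by
      refine LinearMap.ext fun Y => Subtype.ext ?_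
      rw [Module.End.mul_apply, Module.End.mul_apply, coe_compr, expConj_dil,
        D.starProjection_dil _ (D.expConj_mem_lie hW Y)]
      rfl
    have h3 := congrArg LinearMap.det h2
    rw [map_mul, map_mul, mul_comm] at h3
    exact mul_left_cancel₀ (D.det_dilN_ne_zero s) h3
  have h2 : LinearMap.det (D.compr 0) = 1 := by
    have : D.compr 0 = 1 := by
      refine LinearMap.ext fun Y => Subtype.ext ?_
      rw [coe_compr, expConj, conjN_apply]
      simp
    rw [this, map_one]
  have h3 := (D.continuous_det_compr.tendsto 0).comp hs
  simp only [Function.comp_def, h1, h2] at h3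
  exact tendsto_nhds_unique tendsto_const_nhds h3

lemma tendsto_exp_neg_mul_gap (r : ℝ) :
    Tendsto (fun n : ℕ => Real.exp (-(n * D.gap)) * r) atTop (𝓝 0) := by
  rw [← zero_mul r]
  refine Tendsto.mul_const _ (Real.tendsto_exp_neg_atTop_nhds_zero.comp ?_)
  exact tendsto_natCast_atTop_atTop.atTop_mul_const D.gap_pos

lemma det_compr_of_mem_𝔫 {W : Matrix (Fin m) (Fin m) ℝ} (hW : W ∈ D.𝔫) :
    LinearMap.det (D.compr W) = 1 :=
  D.det_compr_eq_one (D.𝔫_le_lieAlg hW) (s := fun n => n)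
    (squeeze_zero_norm (fun n => D.norm_dil_upper_le n.cast_nonneg (D.𝔫_le_upper hW))
      (D.tendsto_exp_neg_mul_gap _))

lemma det_compr_of_mem_𝔫T {W : Matrix (Fin m) (Fin m) ℝ} (hW : W ∈ D.𝔫T) :
    LinearMap.det (D.compr W) = 1 :=
  D.det_compr_eq_one hW.1 (s := fun n => -n)
    (squeeze_zero_norm (fun n => by
      have := D.norm_dil_lower_le (neg_nonpos.mpr n.cast_nonneg) hW.2
      rwa [neg_mul] at this) (D.tendsto_exp_neg_mul_gap _))

/-! ### Growth of the Gram determinant -/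

/-- If Ad(exp W) preserves Lie(N), so do its powers and, by polynomial dependence on t, every Ad(exp
tW). Differentiating at Wᵀ gives [W, Wᵀ] in Lie(N), which has zero diagonal in the frame. Weighting
the diagonal entries by h yields ∑ (h_i - h_j) w_ij² = 0, and for a strictly lower W no term is
positive. -/
lemma eq_zero_of_expConj_mem {W : Matrix (Fin m) (Fin m) ℝ} (hW : W ∈ D.𝔫T)
    (h : ∀ Y, D.expConj W Y ∈ D.𝔫) : W = 0 := by
  have hnil : IsNilpotent W := D.isNilAlgebra_lower.isNilpotent hW.2
  have hk : ∀ (k : ℕ) (Y : D.𝔫), D.expConj ((k : ℝ) • W) Y ∈ D.𝔫 := by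
    intro k
    induction k with
    | zero => intro Y; simp [expConj, conjN_apply]
    | succ k ih =>
      intro Y
      have := ih ⟨_, h Y⟩
      have e1 : NormedSpace.exp (((k + 1 : ℕ) : ℝ) • W) = NormedSpace.exp ((k : ℝ) • W) * NormedSpace.exp W := by
        rw [Nat.cast_succ, add_smul, one_smul]
        exact exp_add_of_commute' (Commute.smul_left (Commute.refl W) _)
      have e2 : NormedSpace.exp (-(((k + 1 : ℕ) : ℝ) • W)) = NormedSpace.exp (-W) * NormedSpace.exp (-((k : ℝ) • W)) := by
        rw [Nat.cast_succ, add_smul, one_smul, neg_add_rev]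
        exact exp_add_of_commute' ((Commute.smul_left (Commute.refl W) _).neg_left.neg_right.symm)
      simp only [expConj, conjN_apply] at this ⊢
      rw [e1, e2]
      simpa only [mul_assoc] using this
  have ht : ∀ (t : ℝ) (Y : D.𝔫), D.expConj (t • W) Y ∈ D.𝔫 := by
    intro t Y
    have hoo := Submodule.orthogonal_orthogonal D.𝔫
    refine hoo.le ((Submodule.mem_orthogonal _ _).mpr fun Z hZ => ?_)
    have hpoly : IsPolyFun fun t => inner ℝ Z (D.expConj (t • W) Y) := by
      simp only [expConj, conjN_apply, inner_eq_trace, Matrix.trace, Matrix.diag_apply,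
        Matrix.mul_apply, ← smul_neg]
      refine IsPolyFun.sum fun i _ => IsPolyFun.sum fun j _ => (isPolyFun_const _).mul
        (IsPolyFun.sum fun k _ => IsPolyFun.mul (IsPolyFun.sum fun l _ => IsPolyFun.mul ?_
          (isPolyFun_const _)) ?_)
      · exact isPolyFun_exp hnil _ _
      · exact isPolyFun_exp hnil.neg _ _
    exact hpoly.eq_zero (fun k => Submodule.inner_left_of_mem_orthogonal (hk k Y) hZ) t
  have hder : W * Wᵀ - Wᵀ * W ∈ D.𝔫 := by
    refine mem_of_hasDerivAt (W := D.𝔫) (fun t => ?_) (hasDerivAt_exp_conj W Wᵀ)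
    have := ht t ⟨Wᵀ, D.transpose_mem_𝔫.mpr hW⟩
    rwa [expConj, conjN_apply] at this
  have hdiag : ∀ i, (D.Oᵀ * (W * Wᵀ - Wᵀ * W) * D.O) i i = 0 := fun i => D.𝔫_le_upper hder i i le_rfl
  set w := D.Oᵀ * W * D.O with hw
  have hwT : D.Oᵀ * Wᵀ * D.O = wᵀ := by rw [hw]; simp [Matrix.transpose_mul, mul_assoc]
  have h1 : ∑ i, D.h i * (D.Oᵀ * (W * Wᵀ - Wᵀ * W) * D.O) i i =
      ∑ i, ∑ j, (D.h i - D.h j) * w i j ^ 2 := by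
    have e1 : ∀ i, (D.Oᵀ * (W * Wᵀ - Wᵀ * W) * D.O) i i = ∑ j, w i j ^ 2 - ∑ j, w j i ^ 2 := by
      intro i
      rw [mul_sub, sub_mul, Matrix.sub_apply, conj_mul_conj D.O_mul, conj_mul_conj D.O_mul, hwT, ← hw,
        Matrix.mul_apply, Matrix.mul_apply]
      simp only [Matrix.transpose_apply, sq]
    calc _ = ∑ i, (∑ j, D.h i * w i j ^ 2 - ∑ j, D.h i * w j i ^ 2) :=
          Finset.sum_congr rfl fun i _ => by rw [e1, mul_sub, Finset.mul_sum, Finset.mul_sum]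
      _ = ∑ i, ∑ j, D.h i * w i j ^ 2 - ∑ i, ∑ j, D.h j * w i j ^ 2 := by
          rw [Finset.sum_sub_distrib, Finset.sum_comm (f := fun i j => D.h i * w j i ^ 2)]
      _ = _ := by simp only [sub_mul, Finset.sum_sub_distrib]
  rw [Finset.sum_eq_zero fun i _ => by rw [hdiag, mul_zero]] at h1
  have h2 : ∀ i j, (D.h i - D.h j) * w i j ^ 2 ≤ 0 := fun i j => by
    rcases le_or_gt (D.h j) (D.h i) with hij | hij
    · rw [show w i j = 0 from hW.2 i j (by simpa using hij)]; simp
    · nlinarith [sq_nonneg (w i j)]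
  have h3 := (Finset.sum_eq_zero_iff_of_nonpos fun i _ => Finset.sum_nonpos fun j _ => h2 i j).mp h1.symm
  refine eq_of_conj_eq D.O_mul fun i j => ?_
  rw [← hw, mul_zero, zero_mul, Matrix.zero_apply]
  have h4 := (Finset.sum_eq_zero_iff_of_nonpos fun j _ => h2 i j).mp (h3 i (Finset.mem_univ i)) j
    (Finset.mem_univ j)
  rcases le_or_gt (D.h j) (D.h i) with hij | hij
  · exact hW.2 i j (by simpa using hij)
  · exact pow_eq_zero_iff two_ne_zero |>.mp ((mul_eq_zero.mp h4).resolve_left (by linarith))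

lemma one_le_gramDet {W : Matrix (Fin m) (Fin m) ℝ} (hW : W ∈ D.𝔫T) :
    1 ≤ gramDet (D.expConj W) := (norm_sub_sq_le_gramDet _ (D.det_compr_of_mem_𝔫T hW)).1

/-- The component of `Ad (exp W)` on `Lie(N)` that is perpendicular to `Lie(N)`. -/
lemma norm_perp_sq_le {W : Matrix (Fin m) (Fin m) ℝ} (hW : W ∈ D.𝔫T) (Y : D.𝔫) :
    ‖D.expConj W Y - D.𝔫.starProjection (D.expConj W Y)‖ ^ 2 ≤
      (gramDet (D.expConj W) - 1) * ‖D.𝔫.starProjection (D.expConj W Y)‖ ^ 2 :=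
  (norm_sub_sq_le_gramDet _ (D.det_compr_of_mem_𝔫T hW)).2 Y

/-- For s ≥ 0 dilation does not shrink the component perpendicular to Lie(N), which has no strictly
upper blocks, while it contracts the component in Lie(N) by e^(-s·gap). The perpendicular estimate
is applied to the dilated element. -/
lemma norm_perp_sq_dil_le {W : Matrix (Fin m) (Fin m) ℝ} (hW : W ∈ D.𝔫T) (Y : D.𝔫) {s : ℝ}
    (hs : 0 ≤ s) : ‖D.expConj W Y - D.𝔫.starProjection (D.expConj W Y)‖ ^ 2 ≤
      (gramDet (D.expConj (D.dil s W)) - 1) *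
        (Real.exp (-(s * D.gap)) * ‖D.expConj W Y‖) ^ 2 := by
  have hZ := D.expConj_mem_lie hW.1 Y
  have h1 := D.norm_perp_sq_le (D.dil_mem_𝔫T s hW) (D.dilN s Y)
  rw [expConj_dil, D.starProjection_dil s hZ, ← map_sub] at h1
  have h2 : ‖D.expConj W Y - D.𝔫.starProjection (D.expConj W Y)‖ ≤
      ‖D.dil s (D.expConj W Y - D.𝔫.starProjection (D.expConj W Y))‖ := by
    refine D.norm_le_norm_dil hs fun i j hij => ?_
    rw [D.starProjection_eq_blockPart hZ, mul_sub, sub_mul, Matrix.sub_apply, conj_blockPart D.mul_O,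
      if_pos (by linarith), sub_self]
  have h3 : ‖D.dil s (D.𝔫.starProjection (D.expConj W Y))‖ ≤
      Real.exp (-(s * D.gap)) * ‖D.expConj W Y‖ :=
    (D.norm_dil_upper_le hs (D.𝔫_le_upper (Submodule.starProjection_apply_mem _ _))).trans
      (mul_le_mul_of_nonneg_left (Submodule.norm_starProjection_apply_le _ _) (Real.exp_pos _).le)
  have h4 := pow_le_pow_left₀ (norm_nonneg _) h2 2
  have h5 := pow_le_pow_left₀ (norm_nonneg _) h3 2
  exact h4.trans (h1.trans (mul_le_mul_of_nonneg_left h5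
    (sub_nonneg.mpr (D.one_le_gramDet (D.dil_mem_𝔫T s hW)))))

lemma mul_le_of_le_sub_one_mul {ε f g q e₁ e₂ : ℝ} (h1 : f ≤ (q - 1) * (e₁ * g))
    (h2 : ε * (g + 1) ≤ f) (hq : 1 ≤ q) (hg : 0 ≤ g) (he₁ : 0 ≤ e₁) (he₂ : 0 ≤ e₂)
    (he : e₁ * e₂ = 1) : ε * e₂ ≤ q := by
  have h3 : ε * (g + 1) ≤ q * e₁ * (g + 1) := by
    refine h2.trans (h1.trans ?_)
    rw [mul_assoc]
    exact mul_le_mul (by linarith) (mul_le_mul_of_nonneg_left (by linarith) he₁)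
      (by positivity) (by linarith)
  have h4 := le_of_mul_le_mul_right h3 (by linarith)
  calc ε * e₂ ≤ q * e₁ * e₂ := mul_le_mul_of_nonneg_right h4 he₂
    _ = q := by rw [mul_assoc, he, mul_one]

/-- On the unit sphere of `Lie(θ(N))` the group `exp W` moves `Lie(N)` by a definite amount. -/
lemma exists_perp_lower_bound : ∃ ε : ℝ, 0 < ε ∧ ∀ W ∈ D.𝔫T, ‖W‖ = 1 → ∀ s : ℝ, 0 ≤ s →
    ε * Real.exp (s * D.gap) ^ 2 ≤ gramDet (D.expConj (D.dil s W)) := by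
  set b := stdOrthonormalBasis ℝ D.𝔫
  set f : Matrix (Fin m) (Fin m) ℝ → ℝ := fun W =>
    ∑ i, ‖D.expConj W (b i) - D.𝔫.starProjection (D.expConj W (b i))‖ ^ 2
  set g : Matrix (Fin m) (Fin m) ℝ → ℝ := fun W => ∑ i, ‖D.expConj W (b i)‖ ^ 2
  have hf : Continuous f := continuous_finsetSum _ fun i _ => ((D.continuous_expConj (b i)).sub
    (D.𝔫.starProjection.continuous.comp (D.continuous_expConj (b i)))).norm.pow 2
  have hg : Continuous g := continuous_finsetSum _ fun i _ => (D.continuous_expConj (b i)).norm.pow 2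
  have hK : IsCompact ((D.𝔫T : Set (Matrix (Fin m) (Fin m) ℝ)) ∩ Metric.sphere 0 1) :=
    (isCompact_sphere 0 1).inter_left (Submodule.closed_of_finiteDimensional D.𝔫T)
  have hfpos : ∀ W ∈ (D.𝔫T : Set (Matrix (Fin m) (Fin m) ℝ)) ∩ Metric.sphere 0 1, 0 < f W := by
    rintro W ⟨hW, hW1⟩
    refine lt_of_le_of_ne (Finset.sum_nonneg fun _ _ => sq_nonneg _) fun h0 => ?_
    have h1 := (Finset.sum_eq_zero_iff_of_nonneg fun _ _ => sq_nonneg _).mp h0.symm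
    have h2 : ∀ Y, D.expConj W Y ∈ D.𝔫 := by
      intro Y
      have : ⊤ ≤ D.𝔫.comap (D.expConj W) := by
        rw [← b.toBasis.span_eq, Submodule.span_le]
        rintro _ ⟨i, rfl⟩
        have h3 := pow_eq_zero_iff two_ne_zero |>.mp (h1 i (Finset.mem_univ i))
        rw [norm_sub_eq_zero_iff] at h3
        show D.expConj W (b.toBasis i) ∈ D.𝔫
        rw [OrthonormalBasis.coe_toBasis, h3]
        exact Submodule.starProjection_apply_mem _ _
      exact this Submodule.mem_top
    have h3 := D.eq_zero_of_expConj_mem hW h2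
    rw [h3] at hW1
    simp at hW1
  -- ε is the minimum of f/(g + 1) on the compact unit sphere of Lie(θ(N)); the 1 keeps the
  -- denominator positive, and any ε works if the sphere is empty.
  obtain ⟨ε, hε, hε'⟩ : ∃ ε : ℝ, 0 < ε ∧ ∀ W ∈ (D.𝔫T : Set (Matrix (Fin m) (Fin m) ℝ)) ∩
      Metric.sphere 0 1, ε * (g W + 1) ≤ f W := by
    rcases Set.eq_empty_or_nonempty ((D.𝔫T : Set (Matrix (Fin m) (Fin m) ℝ)) ∩ Metric.sphere 0 1)
      with he | hne
    · exact ⟨1, one_pos, by simp [he]⟩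
    have hg0 : ∀ W, 0 < g W + 1 := fun W =>
      add_pos_of_nonneg_of_pos (Finset.sum_nonneg fun _ _ => sq_nonneg _) one_pos
    obtain ⟨W₀, hW₀, hmin⟩ := hK.exists_isMinOn hne
      ((hf.div (hg.add continuous_const) fun W => (hg0 W).ne').continuousOn)
    refine ⟨f W₀ / (g W₀ + 1), div_pos (hfpos _ hW₀) (hg0 _), fun W hW => ?_⟩
    exact (le_div_iff₀ (hg0 W)).mp (hmin hW)
  refine ⟨ε, hε, fun W hW hW1 s hs => ?_⟩
  have h1 : f W ≤ (gramDet (D.expConj (D.dil s W)) - 1) * (Real.exp (-(s * D.gap)) ^ 2 * g W) := by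
    rw [Finset.mul_sum, Finset.mul_sum]
    refine Finset.sum_le_sum fun i _ => ?_
    rw [← mul_pow]
    exact D.norm_perp_sq_dil_le hW _ hs
  have h2 := hε' W ⟨hW, by simpa using hW1⟩
  have hq := D.one_le_gramDet (D.dil_mem_𝔫T s hW)
  have hg0 : 0 ≤ g W := Finset.sum_nonneg fun _ _ => sq_nonneg _
  have h5 : Real.exp (-(s * D.gap)) ^ 2 * Real.exp (s * D.gap) ^ 2 = 1 := by
    rw [← mul_pow, ← Real.exp_add]
    simp
  exact mul_le_of_le_sub_one_mul h1 h2 hq hg0 (sq_nonneg _) (sq_nonneg _) h5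

/-- Negative dilations contract Lie(θ(N)) to 0, so by the intermediate value theorem the orbit of W
meets the unit sphere. -/
lemma exists_eq_dil {W : Matrix (Fin m) (Fin m) ℝ} (hW : W ∈ D.𝔫T) (h1 : 1 ≤ ‖W‖) :
    ∃ s : ℝ, 0 ≤ s ∧ ∃ W₀ ∈ D.𝔫T, ‖W₀‖ = 1 ∧ W = D.dil s W₀ := by
  have hc : Continuous fun s : ℝ => ‖D.dil (-s) W‖ :=
    (D.continuous_dil.comp (continuous_neg.prodMk continuous_const)).norm
  have hlim : Tendsto (fun n : ℕ => ‖D.dil (-n) W‖) atTop (𝓝 0) :=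
    squeeze_zero (fun _ => norm_nonneg _) (fun n => by
      have := D.norm_dil_lower_le (neg_nonpos.mpr n.cast_nonneg) hW.2
      rwa [neg_mul] at this) (D.tendsto_exp_neg_mul_gap _)
  obtain ⟨n, hn⟩ := (hlim.eventually (gt_mem_nhds one_pos)).exists
  obtain ⟨s, hs, hs1⟩ := intermediate_value_Icc' (n.cast_nonneg (α := ℝ)) hc.continuousOn
    ⟨hn.le, by simpa [dil_zero] using h1⟩
  exact ⟨s, hs.1, _, D.dil_mem_𝔫T _ hW, hs1, (D.dil_dil_neg s W).symm⟩

/-- The norm on `Lie(θ(N))` grows at most polynomially in the Gram determinant. -/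
lemma exists_log_norm_le : ∃ C : ℝ, 0 ≤ C ∧ ∀ W ∈ D.𝔫T,
    Real.log (1 + ‖W‖) ≤ C * (1 + Real.log (gramDet (D.expConj W))) := by
  obtain ⟨ε, hε, h⟩ := D.exists_perp_lower_bound
  obtain ⟨L, hL, hL'⟩ := D.exists_norm_dil_le
  have hgap := D.gap_pos
  -- The norm is at most e^(sL) and the Gram determinant at least ε e^(2s·gap); B is the ratio of
  -- the two exponents.
  set B := L / (2 * D.gap)
  have hB : 0 ≤ B := by positivity
  refine ⟨Real.log 2 + B * (1 + |Real.log ε|), by positivity, fun W hW => ?_⟩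
  have hq := Real.log_nonneg (D.one_le_gramDet hW)
  have hlog2 : 0 ≤ Real.log 2 := Real.log_nonneg one_le_two
  rcases le_or_gt 1 ‖W‖ with h1 | h1
  · obtain ⟨s, hs, W₀, hW₀, hn, rfl⟩ := D.exists_eq_dil hW h1
    have h2 := hL' s hs W₀
    rw [hn, mul_one] at h2
    have h3 : Real.log (1 + ‖D.dil s W₀‖) ≤ Real.log 2 + s * L := by
      rw [← Real.log_exp (s * L), ← Real.log_mul two_ne_zero (Real.exp_pos _).ne']
      exact Real.log_le_log (by positivity) (by linarith)
    have h4 := Real.log_le_log (by positivity) (h W₀ hW₀ hn s hs)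
    rw [Real.log_mul hε.ne' (by positivity), Real.log_pow, Real.log_exp] at h4
    set q := Real.log (gramDet (D.expConj (D.dil s W₀)))
    have h5 : s * L ≤ B * (q + |Real.log ε|) := by
      have h6 : s * (2 * D.gap) ≤ q + |Real.log ε| := by
        have := neg_abs_le (Real.log ε)
        push_cast at h4
        linarith
      calc s * L = B * (s * (2 * D.gap)) := by simp only [B]; field_simp
        _ ≤ _ := mul_le_mul_of_nonneg_left h6 hB
    have h7 : 0 ≤ |Real.log ε| := abs_nonneg _
    nlinarith [mul_nonneg hB hq, mul_nonneg hB h7, mul_nonneg (mul_nonneg hB h7) hq,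
      mul_nonneg hlog2 hq]
  · have h2 : Real.log (1 + ‖W‖) ≤ Real.log 2 := Real.log_le_log (by positivity) (by linarith)
    have h7 : 0 ≤ |Real.log ε| := abs_nonneg _
    have h8 : 0 ≤ B * (1 + |Real.log ε|) := by positivity
    nlinarith [mul_nonneg h8 hq, mul_nonneg hlog2 hq]

end IwasawaDatum

end RealReductiveGroup

namespace RealReductiveGroup

open scoped Matrix.Norms.Frobenius
open Filter Topology Function

attribute [local instance] frobeniusInnerProductSpace

variable {m : ℕ} {G : Type*} [Group G] [TopologicalSpace G] [IsTopologicalGroup G]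
  {R : RealReductiveGroup G m}

/-! ### The norm and the maximal compact subgroup -/

lemma mat_inv_of_mem_K {k : G} (hk : k ∈ R.K) : R.mat k⁻¹ = (R.mat k)ᵀ := by
  have h1 : R.mat k * (R.mat k)ᵀ = 1 := hk
  calc R.mat k⁻¹ = R.mat k⁻¹ * (R.mat k * (R.mat k)ᵀ) := by rw [h1, mul_one]
    _ = (R.mat k)ᵀ := by rw [← mul_assoc, R.mat_inv_mul, one_mul]

lemma transpose_mul_mat_of_mem_K {k : G} (hk : k ∈ R.K) : (R.mat k)ᵀ * R.mat k = 1 := by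
  rw [← mat_inv_of_mem_K hk, R.mat_inv_mul]

lemma norm_mat_mul {k : G} (hk : k ∈ R.K) (X : Matrix (Fin m) (Fin m) ℝ) :
    ‖R.mat k * X‖ = ‖X‖ := by
  rw [← sq_eq_sq₀ (norm_nonneg _) (norm_nonneg _), frobenius_norm_sq, frobenius_norm_sq,
    Matrix.transpose_mul, mul_assoc, ← mul_assoc (R.mat k)ᵀ, transpose_mul_mat_of_mem_K hk, one_mul]

lemma norm_mul_mat {k : G} (hk : k ∈ R.K) (X : Matrix (Fin m) (Fin m) ℝ) :
    ‖X * R.mat k‖ = ‖X‖ := by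
  have h1 := norm_mat_mul (R.K.inv_mem hk) Xᵀ
  rw [mat_inv_of_mem_K hk, ← Matrix.transpose_mul, Matrix.frobenius_norm_transpose,
    Matrix.frobenius_norm_transpose] at h1
  exact h1

lemma norm_exp_le_of_isNilpotent (m : ℕ) : ∃ C : ℝ, 1 ≤ C ∧ ∀ X : Matrix (Fin m) (Fin m) ℝ,
    IsNilpotent X → ‖NormedSpace.exp X‖ ≤ C * (1 + ‖X‖) ^ m := by
  refine ⟨1 + m * (1 + ‖(1 : Matrix (Fin m) (Fin m) ℝ)‖), by
    have : 0 ≤ (m : ℝ) * (1 + ‖(1 : Matrix (Fin m) (Fin m) ℝ)‖) := by positivity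
    linarith, fun X hX => ?_⟩
  rw [exp_eq_sum_of_pow_eq_zero (matrix_pow_eq_zero hX)]
  have h1 : ∀ k ∈ Finset.range m, ‖((k.factorial : ℝ)⁻¹) • X ^ k‖ ≤
      (1 + ‖(1 : Matrix (Fin m) (Fin m) ℝ)‖) * (1 + ‖X‖) ^ m := by
    intro k hk
    have h2 : ‖X ^ k‖ ≤ (1 + ‖(1 : Matrix (Fin m) (Fin m) ℝ)‖) * (1 + ‖X‖) ^ m := by
      have h5 : (1 : ℝ) ≤ (1 + ‖X‖) ^ m := one_le_pow₀ (by linarith [norm_nonneg X])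
      rcases Nat.eq_zero_or_pos k with h0 | h0
      · rw [h0, pow_zero]
        nlinarith [norm_nonneg (1 : Matrix (Fin m) (Fin m) ℝ)]
      · have h3 := norm_pow_le' X h0
        have h4 : ‖X‖ ^ k ≤ (1 + ‖X‖) ^ m :=
          (pow_le_pow_left₀ (norm_nonneg _) (by linarith) k).trans
            (pow_le_pow_right₀ (by linarith [norm_nonneg X]) (Finset.mem_range.mp hk).le)
        nlinarith [norm_nonneg (1 : Matrix (Fin m) (Fin m) ℝ)]
    rw [norm_smul]
    refine (mul_le_of_le_one_left (norm_nonneg _) ?_).trans h2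
    rw [norm_inv, Real.norm_natCast]
    exact inv_le_one_of_one_le₀ (by exact_mod_cast k.factorial_pos)
  refine (norm_sum_le _ _).trans ((Finset.sum_le_sum h1).trans ?_)
  rw [Finset.sum_const, Finset.card_range, nsmul_eq_mul, ← mul_assoc]
  exact mul_le_mul_of_nonneg_right (by linarith) (by positivity)

namespace IwasawaDatum

variable (D : R.IwasawaDatum)

/-! ### The function `a ↦ a ^ ρ` -/

/-- A basis of Lie(N) chosen among root vectors diagonalises Ad(a). Hence the determinant is
positive, and at least 1 on A⁺. -/
lemma exists_det_Ad_eq {Y : D.𝔞} {a : D.A}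
    (ha : R.IsExp (Y : Matrix (Fin m) (Fin m) ℝ) (a : G)) :
    ∃ (n : ℕ) (α : Fin n → Module.Dual ℝ D.𝔞), (∀ i, α i ∈ D.posRoots) ∧
      LinearMap.det ((R.Ad (a : G)).restrict (D.Ad_mem_𝔫 a)) = ∏ i, Real.exp (α i Y) := by
  set S : Set D.𝔫 := {X | ∃ α ∈ D.posRoots, X.1 ∈ R.weightSpace D.𝔞 α}
  have hS : ⊤ ≤ Submodule.span ℝ S := by
    rw [← Submodule.map_le_map_iff_of_injective D.𝔫.injective_subtype, Submodule.map_span,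
      Submodule.map_top, Submodule.range_subtype]
    refine Submodule.span_le.mpr ?_
    rintro X ⟨α, hα, hX⟩
    exact Submodule.subset_span ⟨⟨X, Submodule.subset_span ⟨α, hα, hX⟩⟩, ⟨α, hα, hX⟩, rfl⟩
  obtain ⟨n, b, hb⟩ : ∃ (n : ℕ) (b : Module.Basis (Fin n) ℝ D.𝔫),
      ∀ i, ∃ α ∈ D.posRoots, (b i).1 ∈ R.weightSpace D.𝔞 α := by
    have := Module.Finite.finite_basis (Module.Basis.ofSpan hS)
    refine ⟨_, (Module.Basis.ofSpan hS).reindex (Finite.equivFin _), fun i => ?_⟩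
    rw [Module.Basis.reindex_apply]
    exact Module.Basis.ofSpan_subset hS ⟨_, rfl⟩
  choose α hα hbα using hb
  refine ⟨n, α, hα, ?_⟩
  rw [← LinearMap.det_toMatrix b]
  have h1 : LinearMap.toMatrix b b ((R.Ad (a : G)).restrict (D.Ad_mem_𝔫 a)) =
      Matrix.diagonal fun i => Real.exp (α i Y) := by
    ext i j
    have h2 : (R.Ad (a : G)).restrict (D.Ad_mem_𝔫 a) (b j) = Real.exp (α j Y) • b j := by
      refine Subtype.ext ?_
      show R.Ad (a : G) (b j).1 = Real.exp (α j Y) • (b j).1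
      rw [Ad_apply, ← mul_assoc, ha.mat_eq, mat_exp_mul ((hbα j).2 Y), smul_mul_assoc, mul_assoc,
        ← ha.mat_eq, R.mat_mul_inv, mul_one]
    rw [LinearMap.toMatrix_apply, h2, map_smul, Module.Basis.repr_self, Matrix.diagonal_apply]
    by_cases hij : i = j
    · simp [hij]
    · simp [hij]
  rw [h1, Matrix.det_diagonal]

lemma det_Ad_pos (a : D.A) : 0 < LinearMap.det ((R.Ad (a : G)).restrict (D.Ad_mem_𝔫 a)) := by
  obtain ⟨Y, hY, ha⟩ := D.mem_A_iff.mp a.2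
  obtain ⟨n, α, -, h⟩ := D.exists_det_Ad_eq (Y := ⟨Y, hY⟩) ha
  rw [h]
  exact Finset.prod_pos fun i _ => Real.exp_pos _

lemma powRho_pos (a : D.A) : 0 < D.powRho a := Real.sqrt_pos.mpr (D.det_Ad_pos a)

lemma powRho_pow_four (a : D.A) :
    D.powRho a ^ 4 = LinearMap.det ((R.Ad (a : G)).restrict (D.Ad_mem_𝔫 a)) ^ 2 := by
  rw [powRho, show 4 = 2 * 2 from rfl, pow_mul, Real.sq_sqrt (D.det_Ad_pos a).le]

lemma one_le_powRho {a : D.A} (ha : a ∈ D.APlus) : 1 ≤ D.powRho a := by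
  obtain ⟨Y, hY, h⟩ := ha
  obtain ⟨n, α, hα, h'⟩ := D.exists_det_Ad_eq hY
  rw [powRho, Real.one_le_sqrt, h']
  calc (1 : ℝ) = ∏ i : Fin n, 1 := Finset.prod_const_one.symm
    _ ≤ _ := Finset.prod_le_prod (fun _ _ => zero_le_one) fun i _ => h _ (hα i)

/-! ### The Gram determinant of `G` acting on `Lie(N)` -/

/-- The Gram determinant of `Ad(gᵀ)` on `Lie(N)`. -/
def gram (g : G) : ℝ := gramDet (D.conjN (R.mat g)ᵀ (R.mat g⁻¹)ᵀ)

lemma expConj_mem_𝔫 {X : Matrix (Fin m) (Fin m) ℝ} (hX : X ∈ D.𝔫) (Y : D.𝔫) :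
    D.expConj X Y ∈ D.𝔫 := by
  have h1 := D.expConj_mem_lie (D.𝔫_le_lieAlg hX) Y
  refine D.𝔫_eq.ge ⟨h1, ?_⟩
  have hU := D.isNilAlgebra_upper
  have e1 := hU.exp_sub_one_mem' (D.𝔫_le_upper hX)
  have e2 := hU.exp_sub_one_mem' (D.upper.neg_mem (D.𝔫_le_upper hX))
  have hm : ∀ {A B}, A ∈ D.upper → B ∈ D.upper → A * B ∈ D.upper := fun hA hB =>
    hU.mul_le (Submodule.mul_mem_mul hA hB)
  have hY := D.𝔫_le_upper Y.2
  rw [expConj, conjN_apply, show NormedSpace.exp X * Y.1 * NormedSpace.exp (-X) =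
    (NormedSpace.exp X - 1) * Y.1 * (NormedSpace.exp (-X) - 1) + (NormedSpace.exp X - 1) * Y.1 +
      (Y.1 * (NormedSpace.exp (-X) - 1) + Y.1) by noncomm_ring]
  exact D.upper.add_mem (D.upper.add_mem (hm (hm e1 hY) e2) (hm e1 hY))
    (D.upper.add_mem (hm hY e2) hY)

lemma transpose_mat_of_mem_A (a : D.A) : (R.mat (a : G))ᵀ = R.mat (a : G) := by
  obtain ⟨Y, hY, ha⟩ := D.mem_A_iff.mp a.2
  rw [ha.mat_eq, ← Matrix.exp_transpose, D.symm _ hY]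

/-- Transposition reverses the product, so vᵀ and a act on Lie(N) before yᵀ does. Both preserve
Lie(N), so they contribute only the squares of their determinants, 1 and a^{4ρ}. -/
lemma gram_mul {v : G} (hv : v ∈ D.thetaN) (a : D.A) (y : G) :
    D.gram (v * a * y) = D.powRho a ^ 4 * D.gram y := by
  obtain ⟨X, hX, hvX⟩ := D.mem_thetaN_iff.mp hv
  have hXT := D.transpose_mem_𝔫.mpr hX
  have h1 : D.conjN (R.mat (v * a * y))ᵀ (R.mat (v * a * y)⁻¹)ᵀ =
      D.conjN (R.mat y)ᵀ (R.mat y⁻¹)ᵀ ∘ₗ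
        ((R.Ad (a : G)).restrict (D.Ad_mem_𝔫 a) ∘ₗ D.compr Xᵀ) := by
    refine LinearMap.ext fun Y => ?_
    have e1 : ((R.Ad (a : G)).restrict (D.Ad_mem_𝔫 a) (D.compr Xᵀ Y)).1 =
        R.mat (a : G) * D.expConj Xᵀ Y * R.mat (a : G)⁻¹ := by
      have : (D.compr Xᵀ Y).1 = D.expConj Xᵀ Y :=
        Submodule.starProjection_eq_self_iff.mpr (D.expConj_mem_𝔫 hXT Y)
      rw [LinearMap.coe_restrict_apply, Ad_apply, this, mul_assoc]
    have e2 := D.transpose_mat_of_mem_A a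
    have e3 := D.transpose_mat_of_mem_A a⁻¹
    rw [Subgroup.coe_inv] at e3
    rw [LinearMap.comp_apply, LinearMap.comp_apply, conjN_apply, conjN_apply, e1, expConj,
      conjN_apply, ← Matrix.transpose_neg, Matrix.exp_transpose, Matrix.exp_transpose, ← hvX.mat_eq,
      ← hvX.inv.mat_eq]
    simp only [mul_inv_rev, mat_mul, Matrix.transpose_mul, e2, e3, mul_assoc]
  rw [gram, h1, gramDet_comp, LinearMap.det_comp, D.det_compr_of_mem_𝔫 hXT, mul_one,
    ← powRho_pow_four, gram]

lemma norm_conjN_le (g : G) (Y : D.𝔫) :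
    ‖D.conjN (R.mat g)ᵀ (R.mat g⁻¹)ᵀ Y‖ ≤ ‖R.mat g‖ * ‖R.mat g⁻¹‖ * ‖Y‖ := by
  rw [conjN_apply, ← Matrix.frobenius_norm_transpose (R.mat g),
    ← Matrix.frobenius_norm_transpose (R.mat g⁻¹)]
  calc _ ≤ ‖(R.mat g)ᵀ‖ * ‖Y.1‖ * ‖(R.mat g⁻¹)ᵀ‖ :=
        (norm_mul_le _ _).trans (mul_le_mul_of_nonneg_right (norm_mul_le _ _) (norm_nonneg _))
    _ = _ := by rw [mul_right_comm]; rfl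

/-- A bound for the effect of right translation by `x` on the Gram determinant. -/
def gramBound (x : G) : ℝ := ((‖R.mat x‖ * ‖R.mat x⁻¹‖) ^ 2) ^ Module.finrank ℝ D.𝔫

lemma gram_le (g : G) : D.gram g ≤ D.gramBound g := gramDet_le (D.norm_conjN_le g)

lemma gramBound_mul {k : G} (hk : k ∈ R.K) (x : G) : D.gramBound (k * x) = D.gramBound x := by
  rw [gramBound, gramBound, mul_inv_rev, mat_mul, mat_mul, norm_mat_mul hk,
    norm_mul_mat (R.K.inv_mem hk)]

lemma gram_of_mem_K {k : G} (hk : k ∈ R.K) : D.gram k = 1 := by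
  rw [gram, gramDet_congr (τ' := (LinearMap.id : D.𝔫 →ₗ[ℝ] D.𝔫)) fun X Y => ?_]
  · rw [gramDet, LinearMap.comp_id, LinearMap.adjoint_id, LinearMap.det_id]
  · have h1 : R.mat k * (R.mat k)ᵀ = 1 := hk
    rw [conjN_apply, conjN_apply, inner_eq_trace, mat_inv_of_mem_K hk, Matrix.transpose_transpose]
    show _ = (X.1ᵀ * Y.1).trace
    rw [Matrix.transpose_mul, Matrix.transpose_mul, Matrix.transpose_transpose]
    calc _ = ((R.mat k)ᵀ * (X.1ᵀ * ((R.mat k * (R.mat k)ᵀ) * Y.1) * R.mat k)).trace := by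
          simp only [mul_assoc]
      _ = _ := by rw [h1, one_mul, Matrix.trace_mul_comm, mul_assoc, h1, mul_one]

/-- The left side involves no choice, so a(g)^ρ does not depend on the decomposition selected by
`aPart`. -/
lemma gram_eq (g : G) : D.gram g = D.powRho (D.aPart g) ^ 4 := by
  obtain ⟨v, hv, k, hk, h⟩ := D.aPart_spec g
  conv_lhs => rw [h]
  rw [D.gram_mul hv, D.gram_of_mem_K hk, mul_one]

/-- If g = vak then gx = va(kx), and the bound for kx is that for x because k acts by isometries. -/
lemma powRho_aPart_mul_le (g x : G) :
    D.powRho (D.aPart (g * x)) ^ 4 ≤ D.powRho (D.aPart g) ^ 4 * D.gramBound x := by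
  obtain ⟨v, hv, k, hk, h⟩ := D.aPart_spec g
  rw [← gram_eq]
  conv_lhs => rw [h, mul_assoc, D.gram_mul hv]
  refine mul_le_mul_of_nonneg_left ?_ (by positivity)
  rw [← D.gramBound_mul hk]
  exact D.gram_le _

lemma continuous_gramBound : Continuous D.gramBound :=
  ((R.continuous_mat.norm.mul (R.continuous_mat.comp continuous_inv).norm).pow 2).pow _

/-- Right translation by a compact set changes `a(g) ^ ρ` by a bounded factor. -/
lemma exists_powRho_aPart_mul_le {Ω : Set G} (hΩ : IsCompact Ω) : ∃ C : ℝ, 1 ≤ C ∧ ∀ g, ∀ x ∈ Ω,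
    D.powRho (D.aPart (g * x)) ≤ C * D.powRho (D.aPart g) ∧
      D.powRho (D.aPart g) ≤ C * D.powRho (D.aPart (g * x)) := by
  obtain ⟨B, hB⟩ := hΩ.bddAbove_image D.continuous_gramBound.continuousOn
  obtain ⟨B', hB'⟩ := hΩ.bddAbove_image (D.continuous_gramBound.comp continuous_inv).continuousOn
  set C := max 1 (max B B')
  have hC : 1 ≤ C := le_max_left _ _
  have key : ∀ g x, D.gramBound x ≤ C →
      D.powRho (D.aPart (g * x)) ≤ C * D.powRho (D.aPart g) := by
    intro g x hx
    have h1 := D.powRho_aPart_mul_le g x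
    have h2 := D.powRho_pos (D.aPart g)
    refine le_of_pow_le_pow_left₀ (four_ne_zero) (by positivity) (h1.trans ?_)
    rw [mul_pow, mul_comm]
    refine mul_le_mul_of_nonneg_right (hx.trans ?_) (by positivity)
    exact le_self_pow₀ hC four_ne_zero
  refine ⟨C, hC, fun g x hx => ⟨key g x ?_, ?_⟩⟩
  · exact (hB ⟨x, hx, rfl⟩).trans ((le_max_left _ _).trans (le_max_right _ _))
  · have := key (g * x) x⁻¹ ((hB' ⟨x, hx, rfl⟩).trans ((le_max_right _ _).trans (le_max_right _ _)))
    rwa [mul_inv_cancel_right] at this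

/-! ### Growth on `N` -/

lemma powRho_aPart_pow_four {n : G} {X : Matrix (Fin m) (Fin m) ℝ} (hn : R.IsExp X n) :
    D.powRho (D.aPart n) ^ 4 = gramDet (D.expConj Xᵀ) := by
  rw [← gram_eq, gram, hn.mat_eq, hn.inv.mat_eq, ← Matrix.exp_transpose, ← Matrix.exp_transpose,
    Matrix.transpose_neg, expConj]

lemma one_le_powRho_aPart {n : G} (hn : n ∈ D.N) : 1 ≤ D.powRho (D.aPart n) := by
  obtain ⟨X, hX, hnX⟩ := D.mem_N_iff.mp hn
  have h1 := D.one_le_gramDet (D.transpose_mem_𝔫T.mpr hX)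
  rw [← D.powRho_aPart_pow_four hnX] at h1
  exact le_of_pow_le_pow_left₀ four_ne_zero (D.powRho_pos _).le (by simpa using h1)

lemma one_le_gnorm (g : G) : 1 ≤ D.gnorm g := by
  rw [gnorm]
  split_ifs with h
  · exact D.one_le_powRho h.choose_spec.1
  · exact le_rfl

/-- For g = k₁ak₂ the matrices of g and a have the same norm, and a^{4ρ} is the Gram determinant of
a. The default value 1 satisfies the bound as well, so the decomposition G = KA⁺K itself is not
needed. -/
lemma gnorm_pow_four_le {g : G} {B : ℝ} (hB : 1 ≤ B) (h1 : ‖R.mat g‖ ≤ B) (h2 : ‖R.mat g⁻¹‖ ≤ B) :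
    D.gnorm g ^ 4 ≤ B ^ (4 * Module.finrank ℝ D.𝔫) := by
  rw [gnorm]
  split_ifs with h
  · obtain ⟨-, k₁, hk₁, k₂, hk₂, e⟩ := h.choose_spec
    set a := h.choose
    have e1 : D.gram (a : G) = D.powRho a ^ 4 := by
      have := D.gram_mul (D.thetaN.one_mem) a 1
      rwa [one_mul, mul_one, D.gram_of_mem_K R.K.one_mem, mul_one] at this
    have e2 : ‖R.mat (a : G)‖ ≤ B := by
      rwa [e, mat_mul, norm_mul_mat hk₂, mat_mul, norm_mat_mul hk₁] at h1
    have e3 : ‖R.mat (a : G)⁻¹‖ ≤ B := by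
      rwa [e, mul_inv_rev, mul_inv_rev, mat_mul, norm_mat_mul (R.K.inv_mem hk₂), mat_mul,
        norm_mul_mat (R.K.inv_mem hk₁)] at h2
    rw [← e1, pow_mul]
    refine (D.gram_le _).trans (pow_le_pow_left₀ (by positivity) ?_ _)
    calc _ ≤ (B * B) ^ 2 := pow_le_pow_left₀ (by positivity)
          (mul_le_mul e2 e3 (norm_nonneg _) (by linarith)) 2
      _ = B ^ 4 := by ring
  · rw [one_pow]
    exact one_le_pow₀ hB

/-- On `N`, `log ‖n‖` is bounded by a multiple of `1 + log a(n) ^ ρ`. -/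
theorem exists_log_gnorm_le : ∃ C : ℝ, 0 ≤ C ∧ ∀ n ∈ D.N,
    Real.log (D.gnorm n) ≤ C * (1 + Real.log (D.powRho (D.aPart n))) := by
  obtain ⟨C₁, hC₁, h₁⟩ := norm_exp_le_of_isNilpotent m
  obtain ⟨C₂, hC₂, h₂⟩ := D.exists_log_norm_le
  have hl := Real.log_nonneg hC₁
  set d : ℝ := ((Module.finrank ℝ D.𝔫 : ℕ) : ℝ)
  have hd : 0 ≤ d := Nat.cast_nonneg _
  refine ⟨d * (Real.log C₁ + m * (C₂ * 4)), by positivity, fun n hn => ?_⟩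
  have hq := Real.log_nonneg (D.one_le_powRho_aPart hn)
  obtain ⟨X, hX, hnX⟩ := D.mem_N_iff.mp hn
  have hnil := D.isNilAlgebra_upper.isNilpotent (D.𝔫_le_upper hX)
  have hXT := D.transpose_mem_𝔫T.mpr hX
  have e1 := h₁ X hnil
  have e2 := h₁ (-X) hnil.neg
  rw [← hnX.mat_eq] at e1
  rw [← hnX.inv.mat_eq, norm_neg] at e2
  have hX1 : (1 : ℝ) ≤ 1 + ‖X‖ := by linarith [norm_nonneg X]
  have hB : 1 ≤ C₁ * (1 + ‖X‖) ^ m := one_le_mul_of_one_le_of_one_le hC₁ (one_le_pow₀ hX1)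
  have h3 := Real.log_le_log (by have := D.one_le_gnorm n; positivity) (D.gnorm_pow_four_le hB e1 e2)
  have h4 := h₂ _ hXT
  rw [Matrix.frobenius_norm_transpose, ← D.powRho_aPart_pow_four hnX, Real.log_pow] at h4
  rw [Real.log_pow, Real.log_pow, Real.log_mul (by positivity) (by positivity), Real.log_pow] at h3
  push_cast at h3 h4
  set l := Real.log (D.powRho (D.aPart n))
  have h5 : Real.log (D.gnorm n) ≤ d * (Real.log C₁ + m * Real.log (1 + ‖X‖)) := by
    simp only [d]; linarith
  refine h5.trans ?_
  rw [mul_assoc]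
  refine mul_le_mul_of_nonneg_left ?_ hd
  have h6 : (m : ℝ) * Real.log (1 + ‖X‖) ≤ m * (C₂ * 4) * (1 + l) := by
    rw [mul_assoc]
    refine mul_le_mul_of_nonneg_left (h4.trans ?_) (Nat.cast_nonneg m)
    rw [mul_assoc]
    exact mul_le_mul_of_nonneg_left (by linarith) hC₂
  nlinarith [mul_nonneg hl hq]

end IwasawaDatum

end RealReductiveGroup

namespace RealReductiveGroup

open scoped Matrix.Norms.Frobenius
open Polynomial Filter Topology Function

attribute [local instance] frobeniusInnerProductSpace

variable {m : ℕ}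

/-! ### Nilpotent algebras of matrices -/

lemma matrix_eq_zero_of_isIdempotentElem {e : Matrix (Fin m) (Fin m) ℝ} (he : e * e = e)
    (h : e.trace = 0) : e = 0 := by
  have h1 : IsIdempotentElem (Matrix.toLin' e) := by
    rw [IsIdempotentElem, Module.End.mul_eq_comp, ← Matrix.toLin'_mul, he]
  have h2 := LinearMap.IsIdempotentElem.eq_zero_of_trace_eq_zero h1 (by
    rw [Matrix.trace_toLin'_eq, h])
  exact Matrix.toLin'.map_eq_zero_iff.mp h2

/-- A matrix whose positive powers have trace zero is nilpotent. -/
lemma isNilpotent_of_trace_pow_eq_zero {x : Matrix (Fin m) (Fin m) ℝ}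
    (h : ∀ k : ℕ, (x ^ (k + 1)).trace = 0) : IsNilpotent x := by
  have hχ : x.charpoly ≠ 0 := x.charpoly_monic.ne_zero
  obtain ⟨q, hq, hq0⟩ := exists_eq_pow_rootMultiplicity_mul_and_not_dvd x.charpoly hχ 0
  rw [C_0, sub_zero] at hq hq0
  set r := rootMultiplicity 0 x.charpoly
  have hcop : IsCoprime (X ^ (r + 1)) q :=
    IsCoprime.pow_left ((irreducible_X.coprime_iff_not_dvd).mpr hq0)
  obtain ⟨a, b, hab⟩ := hcop
  have hCH : aeval x (X ^ r * q) = 0 := by rw [← hq]; exact Matrix.aeval_self_charpoly x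
  have hzero : ∀ p : ℝ[X], X ^ r * q ∣ p → aeval x p = 0 := by
    rintro _ ⟨p, rfl⟩
    rw [map_mul, hCH, zero_mul]
  -- This polynomial in x is the projection onto the Fitting component where x is invertible. It has
  -- no constant term, so its trace vanishes, and an idempotent of trace 0 is 0.
  have he0 : aeval x (a * X ^ (r + 1)) = 0 := by
    refine matrix_eq_zero_of_isIdempotentElem ?_ ?_
    · rw [← map_mul, ← sub_eq_zero, ← map_sub]
      refine hzero _ ⟨-(a * b * X), ?_⟩
      linear_combination (a * X ^ (r + 1)) * hab
    · have h1 : ∀ p : ℝ[X], (aeval x (p * X)).trace = 0 := by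
        intro p
        induction p using Polynomial.induction_on' with
        | add p q hp hq => rw [add_mul, map_add, Matrix.trace_add, hp, hq, add_zero]
        | monomial n c =>
          rw [monomial_mul_X, aeval_monomial, Algebra.algebraMap_eq_smul_one, smul_mul_assoc, one_mul,
            Matrix.trace_smul, h, smul_zero]
      rw [pow_succ, ← mul_assoc]
      exact h1 _
  refine ⟨r + 1, ?_⟩
  have h2 := congrArg (fun p => aeval x (X ^ (r + 1) * p)) hab
  simp only [mul_add, map_add, mul_one] at h2
  rw [map_mul, he0, mul_zero, zero_add, hzero _ ⟨X * b, by ring⟩] at h2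
  rw [map_pow, aeval_X] at h2
  exact h2.symm

lemma mem_mul_span_singleton {J : Submodule ℝ (Matrix (Fin m) (Fin m) ℝ)}
    {l z : Matrix (Fin m) (Fin m) ℝ} : z ∈ J * Submodule.span ℝ {l} ↔ ∃ j ∈ J, j * l = z :=
  Submodule.mem_mul_span_singleton

/-- A space of nilpotent matrices that is equal to its square is zero. -/
lemma eq_bot_of_mul_self_eq {J : Submodule ℝ (Matrix (Fin m) (Fin m) ℝ)} (hJ : J * J = J)
    (hnil : ∀ x ∈ J, IsNilpotent x) : J = ⊥ := by
  by_contra hne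
  -- A minimal L with JL ⊂ L and JL ≠ 0 has the form Jl with l in L. Then jl = l for some nilpotent
  -- j in J, which forces l = 0.
  obtain ⟨L, ⟨hL1, hL2⟩, hmin⟩ := WellFounded.has_min
    (wellFounded_lt (α := Submodule ℝ (Matrix (Fin m) (Fin m) ℝ)))
    {L | J * L ≤ L ∧ J * L ≠ ⊥} ⟨J, hJ.le, by rwa [hJ]⟩
  obtain ⟨l, hl, hl0⟩ : ∃ l ∈ L, J * Submodule.span ℝ {l} ≠ ⊥ := by
    by_contra! hcon
    refine hL2 (eq_bot_iff.mpr (Submodule.mul_le.mpr fun j hj l hl => ?_))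
    rw [← hcon l hl]
    exact mem_mul_span_singleton.mpr ⟨j, hj, rfl⟩
  have h1 : J * Submodule.span ℝ {l} ≤ L :=
    (mul_le_mul' le_rfl ((Submodule.span_singleton_le_iff_mem _ _).mpr hl)).trans hL1
  have h2 : J * (J * Submodule.span ℝ {l}) = J * Submodule.span ℝ {l} := by rw [← mul_assoc, hJ]
  have h3 : J * Submodule.span ℝ {l} = L := by
    by_contra h
    exact hmin _ ⟨h2.le, by rwa [h2]⟩ (lt_of_le_of_ne h1 h)
  obtain ⟨j, hj, hjl⟩ := mem_mul_span_singleton.mp (h3.symm ▸ hl)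
  obtain ⟨k, hk⟩ := hnil j hj
  have h4 : ∀ n : ℕ, j ^ n * l = l := fun n => by
    induction n with
    | zero => rw [pow_zero, one_mul]
    | succ n ih => rw [pow_succ, mul_assoc, hjl, ih]
  have h5 : l = 0 := by rw [← h4 k, hk, zero_mul]
  refine hl0 (eq_bot_iff.mpr fun z hz => ?_)
  obtain ⟨i, -, rfl⟩ := mem_mul_span_singleton.mp hz
  rw [h5, mul_zero]
  exact Submodule.zero_mem _

/-- A multiplicatively closed space of nilpotent matrices is nilpotent. -/
lemma isNilAlgebra_of_forall_isNilpotent {I : Submodule ℝ (Matrix (Fin m) (Fin m) ℝ)}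
    (hI : I * I ≤ I) (hnil : ∀ x ∈ I, IsNilpotent x) : IsNilAlgebra I := by
  have hanti : ∀ k, I ^ (k + 2) ≤ I ^ (k + 1) := fun k => by
    rw [pow_succ I (k + 1), pow_succ I k, mul_assoc]
    exact mul_le_mul' le_rfl hI
  -- The descending powers of I become constant, and the stable power equals its own square.
  obtain ⟨n, hn⟩ := WellFoundedGT.monotone_chain_condition (α := (Submodule ℝ (Matrix (Fin m) (Fin m) ℝ))ᵒᵈ)
    ⟨fun k => OrderDual.toDual (I ^ (k + 1)), monotone_nat_of_le_succ hanti⟩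
  have hn' : ∀ k, n ≤ k → I ^ (n + 1) = I ^ (k + 1) := fun k hk => hn k hk
  have h1 : I ^ (n + 1) = ⊥ := by
    refine eq_bot_of_mul_self_eq ?_ fun x hx => hnil x ?_
    · rw [← pow_add, hn' (n + n + 1) (by omega)]
      congr 1
      omega
    · have : ∀ k, I ^ (k + 1) ≤ I := fun k => by
        induction k with
        | zero => rw [zero_add, pow_one]
        | succ k ih => exact (hanti k).trans ih
      exact this n hx
  exact ⟨hI, n + 1, h1⟩

/-! ### Groups of unipotent matrices -/

section Unipotent

variable (U : Subgroup (GL (Fin m) ℝ))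

/-- The span of the `u - 1`, for `u` in a group of matrices. -/
def augmentation : Submodule ℝ (Matrix (Fin m) (Fin m) ℝ) :=
  Submodule.span ℝ {x | ∃ u ∈ U, x = u.val - 1}

lemma sub_one_mem_augmentation {u : GL (Fin m) ℝ} (hu : u ∈ U) : u.val - 1 ∈ augmentation U :=
  Submodule.subset_span ⟨u, hu, rfl⟩

lemma augmentation_mul_le : augmentation U * augmentation U ≤ augmentation U := by
  rw [augmentation, Submodule.span_mul_span, Submodule.span_le]
  rintro _ ⟨_, ⟨u, hu, rfl⟩, _, ⟨v, hv, rfl⟩, rfl⟩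
  have e : (u.val - 1) * (v.val - 1) = ((u * v).val - 1) - (u.val - 1) - (v.val - 1) := by
    rw [Units.val_mul]; noncomm_ring
  show (u.val - 1) * (v.val - 1) ∈ augmentation U
  rw [e]
  exact Submodule.sub_mem _ (Submodule.sub_mem _ (sub_one_mem_augmentation U (mul_mem hu hv))
    (sub_one_mem_augmentation U hu)) (sub_one_mem_augmentation U hv)

variable {U} (hU : ∀ u ∈ U, IsNilpotent (u.val - 1))

include hU in
/-- A group of unipotent matrices generates a nilpotent algebra. -/
lemma isNilAlgebra_augmentation : IsNilAlgebra (augmentation U) := by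
  -- The trace vanishes on the spanning set and so on the whole algebra; all powers of its elements
  -- are then traceless, which makes the elements nilpotent.
  have htr : ∀ x ∈ augmentation U, x.trace = 0 := by
    intro x hx
    induction hx using Submodule.span_induction with
    | mem x hx =>
      obtain ⟨u, hu, rfl⟩ := hx
      exact (Matrix.isNilpotent_trace_of_isNilpotent (hU u hu)).eq_zero
    | zero => exact Matrix.trace_zero _ _
    | add x y _ _ hx hy => rw [Matrix.trace_add, hx, hy, add_zero]
    | smul c x _ hx => rw [Matrix.trace_smul, hx, smul_zero]
  have hpow : ∀ x ∈ augmentation U, ∀ k : ℕ, x ^ (k + 1) ∈ augmentation U := by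
    intro x hx k
    induction k with
    | zero => simpa using hx
    | succ k ih => rw [pow_succ]; exact augmentation_mul_le U (Submodule.mul_mem_mul ih hx)
  exact isNilAlgebra_of_forall_isNilpotent (augmentation_mul_le U) fun x hx =>
    isNilpotent_of_trace_pow_eq_zero fun k => htr _ (hpow x hx k)

include hU in
-- Moving n to the right, (xn)^k is a product of k conjugates of x by powers of n, all in the
-- nilpotent algebra, times n^k.
lemma isNilpotent_mul_of_normalizes {N : Subgroup (GL (Fin m) ℝ)}
    (hN : ∀ n ∈ N, ∀ u ∈ U, n * u * n⁻¹ ∈ U) {x : Matrix (Fin m) (Fin m) ℝ}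
    (hx : x ∈ augmentation U) {n : GL (Fin m) ℝ} (hn : n ∈ N) : IsNilpotent (x * n.val) := by
  have hconj : ∀ n ∈ N, ∀ y ∈ augmentation U, n.val * y * n⁻¹.val ∈ augmentation U := by
    intro n hn y hy
    induction hy using Submodule.span_induction with
    | mem y hy =>
      obtain ⟨u, hu, rfl⟩ := hy
      have e : n.val * (u.val - 1) * n⁻¹.val = (n * u * n⁻¹).val - 1 := by
        rw [mul_sub, sub_mul, mul_one, Units.mul_inv]; rfl
      rw [e]
      exact sub_one_mem_augmentation U (hN n hn u hu)
    | zero => simp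
    | add x y _ _ hx hy => rw [mul_add, add_mul]; exact Submodule.add_mem _ hx hy
    | smul c x _ hx => rw [mul_smul_comm, smul_mul_assoc]; exact Submodule.smul_mem _ c hx
  have hpow : ∀ k : ℕ, ∃ y ∈ augmentation U ^ k, (x * n.val) ^ k = y * (n ^ k).val := by
    intro k
    induction k with
    | zero => exact ⟨1, Submodule.one_le.mp (by rw [pow_zero]), by simp⟩
    | succ k ih =>
      obtain ⟨y, hy, e⟩ := ih
      refine ⟨y * ((n ^ k).val * x * (n ^ k)⁻¹.val), ?_, ?_⟩
      · rw [pow_succ (augmentation U)]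
        exact Submodule.mul_mem_mul hy (hconj _ (pow_mem hn k) x hx)
      · have h1 : (n ^ k)⁻¹.val * (n ^ k).val = 1 := Units.inv_mul _
        rw [pow_succ, e, pow_succ n, Units.val_mul]
        calc _ = y * (n ^ k).val * x * 1 * n.val := by simp only [mul_assoc, one_mul]
          _ = _ := by rw [← h1]; simp only [mul_assoc]
  obtain ⟨k, hk⟩ := (isNilAlgebra_augmentation hU).nil
  obtain ⟨y, hy, e⟩ := hpow k
  rw [hk, Submodule.mem_bot] at hy
  exact ⟨k, by rw [e, hy, zero_mul]⟩

include hU in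
/-- A group `U` of unipotent matrices that is normalised by `exp (t Y)` is orthogonal to `Y`. -/
lemma trace_mul_eq_zero_of_normalizes {Y : Matrix (Fin m) (Fin m) ℝ}
    (hN : ∀ t : ℝ, ∀ u ∈ U, expGL (t • Y) * u * (expGL (t • Y))⁻¹ ∈ U)
    {x : Matrix (Fin m) (Fin m) ℝ} (hx : x ∈ augmentation U) : (x * Y).trace = 0 := by
  -- x exp(tY) is nilpotent for every t; the derivative of its vanishing trace at t = 0 is tr(xY).
  have h1 : ∀ t : ℝ, (x * NormedSpace.exp (t • Y)).trace = 0 := fun t => by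
    have := isNilpotent_mul_of_normalizes hU
      (N := Subgroup.normalizer (U : Set (GL (Fin m) ℝ))) (fun n hn u hu =>
        (Subgroup.mem_normalizer_iff.mp hn u).mp hu) hx (n := expGL (t • Y)) (by
        rw [Subgroup.mem_normalizer_iff]
        refine fun u => ⟨hN t u, fun h => ?_⟩
        have h2 := hN (-t) _ h
        rw [neg_smul, expGL_neg] at h2
        simpa [mul_assoc] using h2)
    exact (Matrix.isNilpotent_trace_of_isNilpotent this).eq_zero
  have h2 := (hasDerivAt_mexp Y 0).const_mul x
  rw [zero_smul, NormedSpace.exp_zero, one_mul] at h2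
  exact mem_of_hasDerivAt (W := LinearMap.ker (Matrix.traceLinearMap (Fin m) ℝ ℝ)) h1 h2

end Unipotent

/-! ### Normal nilpotent matrices -/

lemma eq_zero_of_isNilpotent_of_symm {T : Matrix (Fin m) (Fin m) ℝ} (hT : Tᵀ = T)
    (h : IsNilpotent T) : T = 0 := by
  have key : ∀ (k : ℕ) (S : Matrix (Fin m) (Fin m) ℝ), Sᵀ = S → S ^ 2 ^ k = 0 → S = 0 := by
    intro k
    induction k with
    | zero => intro S _ h; simpa using h
    | succ k ih =>
      intro S hS h
      have h1 : S ^ 2 = 0 := ih _ (by rw [Matrix.transpose_pow, hS]) (by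
        rw [← pow_mul, ← pow_succ']; exact h)
      have h2 := frobenius_norm_sq S
      rw [hS, ← sq, h1, Matrix.trace_zero] at h2
      exact norm_eq_zero.mp (pow_eq_zero_iff two_ne_zero |>.mp h2)
  exact key m T hT (pow_eq_zero_of_le (Nat.lt_two_pow_self).le (matrix_pow_eq_zero h))

/-- TᵀT is symmetric and, by normality, nilpotent; hence it is 0, and its trace is ‖T‖². -/
lemma eq_zero_of_isNilpotent_of_normal {T : Matrix (Fin m) (Fin m) ℝ} (hT : Tᵀ * T = T * Tᵀ)
    (h : IsNilpotent T) : T = 0 := by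
  have h1 : IsNilpotent (Tᵀ * T) := Commute.isNilpotent_mul_left hT h
  have h2 := eq_zero_of_isNilpotent_of_symm (by simp) h1
  have h3 := frobenius_norm_sq T
  rw [h2, Matrix.trace_zero] at h3
  exact norm_eq_zero.mp (pow_eq_zero_iff two_ne_zero |>.mp h3)

/-- The block diagonal part of a block upper triangular matrix is multiplicative. -/
lemma blockPart_zero_pow {O : Matrix (Fin m) (Fin m) ℝ} (hO : O * Oᵀ = 1) (hO' : Oᵀ * O = 1)
    {h : Fin m → ℝ} {X : Matrix (Fin m) (Fin m) ℝ}
    (hX : ∀ i j, h i < h j → (Oᵀ * X * O) i j = 0) (k : ℕ) :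
    (∀ i j, h i < h j → (Oᵀ * X ^ k * O) i j = 0) ∧
      blockPart O h (· = 0) X ^ k = blockPart O h (· = 0) (X ^ k) := by
  induction k with
  | zero =>
    have h1 : ∀ i j, h i ≠ h j → (Oᵀ * X ^ 0 * O) i j = 0 := fun i j hij => by
      rw [pow_zero, mul_one, hO', Matrix.one_apply_ne fun e => hij (by rw [e])]
    refine ⟨fun i j hij => h1 i j hij.ne, eq_of_conj_eq hO fun i j => ?_⟩
    rw [conj_blockPart hO']
    split_ifs with hij
    · simp only [pow_zero]
    · simpa using h1 i j (fun e => hij (by rw [e, sub_self]))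
  | succ k ih =>
    refine ⟨fun i j hij => ?_, eq_of_conj_eq hO fun i j => ?_⟩
    · rw [pow_succ, conj_mul_conj hO, Matrix.mul_apply]
      refine Finset.sum_eq_zero fun l _ => ?_
      rcases lt_or_ge (h i) (h l) with hl | hl
      · rw [ih.1 i l hl, zero_mul]
      · rw [hX l j (hl.trans_lt hij), mul_zero]
    · rw [pow_succ, ih.2, conj_blockPart hO', conj_mul_conj hO, pow_succ, conj_mul_conj hO,
        Matrix.mul_apply, Matrix.mul_apply]
      split_ifs with hij
      · refine Finset.sum_congr rfl fun l _ => ?_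
        rw [conj_blockPart hO', conj_blockPart hO']
        rw [sub_eq_zero] at hij
        rcases lt_trichotomy (h i) (h l) with hl | hl | hl
        · rw [if_neg (by linarith), ih.1 i l hl, zero_mul, zero_mul]
        · rw [if_pos (by linarith), if_pos (by linarith)]
        · rw [if_neg (by linarith), if_neg (by linarith), hX l j (by linarith), mul_zero, mul_zero]
      · refine Finset.sum_eq_zero fun l _ => ?_
        rw [conj_blockPart hO', conj_blockPart hO']
        by_cases hl : h i - h l = 0
        · rw [if_neg (fun e : h l - h j = 0 => hij (by linarith)), mul_zero]
        · rw [if_neg hl, zero_mul]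

end RealReductiveGroup

namespace RealReductiveGroup

open scoped Matrix.Norms.Frobenius
open Filter Topology commutatorElement Function

attribute [local instance] frobeniusInnerProductSpace

variable {m : ℕ} {G : Type*} [Group G] [TopologicalSpace G] [IsTopologicalGroup G]
  {R : RealReductiveGroup G m}

/-- The homomorphism of `G` to `GL(m, ℝ)`. -/
def toGL (R : RealReductiveGroup G m) : G →* GL (Fin m) ℝ := R.algGroup.subtype.comp R.proj

lemma toGL_val (g : G) : (R.toGL g).val = R.mat g := rfl

lemma toGL_eq_expGL {X : Matrix (Fin m) (Fin m) ℝ} {g : G} (h : R.IsExp X g) :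
    R.toGL g = expGL X := Units.ext h.mat_eq

lemma isNilpotent_conj {P Q C : Matrix (Fin m) (Fin m) ℝ} (hPQ : P * Q = 1) (hQP : Q * P = 1)
    (hC : IsNilpotent C) : IsNilpotent (P * C * Q) := by
  obtain ⟨k, hk⟩ := hC
  have : ∀ n : ℕ, (P * C * Q) ^ n = P * C ^ n * Q := fun n => by
    induction n with
    | zero => rw [pow_zero, pow_zero, mul_one, hPQ]
    | succ n ih =>
      rw [pow_succ, ih, pow_succ]
      calc _ = P * C ^ n * (Q * P) * C * Q := by simp only [mul_assoc]
        _ = _ := by rw [hQP, mul_one]; simp only [mul_assoc]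
  exact ⟨k, by rw [this, hk, mul_zero, zero_mul]⟩

/-! ### Unipotent groups normalised by N lie in N -/

namespace IwasawaDatum

variable (D : R.IwasawaDatum)

/-- The block diagonal part of a nilpotent block upper triangular element of `Lie(G)` is zero. -/
lemma blockPart_zero_eq_zero {X : Matrix (Fin m) (Fin m) ℝ} (hX : X ∈ R.lie) (hnil : IsNilpotent X)
    (htri : ∀ i j, D.h i < D.h j → (D.Oᵀ * X * D.O) i j = 0) :
    blockPart D.O D.h (· = 0) X = 0 := by
  set X₀ := blockPart D.O D.h (· = 0) X with hX₀
  have hmem : X₀ ∈ R.lieAlg := D.blockPart_mem_lie _ hX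
  have hcomm : ∀ Y ∈ D.𝔞, Y * X₀ = X₀ * Y := fun Y hY => D.blockPart_zero_comm hX hY
  have hcommT : ∀ Y ∈ D.𝔞, Y * X₀ᵀ = X₀ᵀ * Y := fun Y hY => by
    have := congrArg Matrix.transpose (hcomm Y hY)
    rw [Matrix.transpose_mul, Matrix.transpose_mul, D.symm Y hY] at this
    exact this.symm
  have hS : X₀ + X₀ᵀ ∈ D.𝔞 := by
    refine D.maximal _ (R.lieAlg.add_mem hmem (R.transpose_mem_lie hmem)) ?_ fun Y hY => ?_
    · rw [Matrix.transpose_add, Matrix.transpose_transpose, add_comm]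
    · rw [mul_add, add_mul, hcomm Y hY, hcommT Y hY]
  -- X₀ commutes with 𝔞, and X₀ + X₀ᵀ lies in 𝔞 by maximality; so X₀ commutes with its transpose.
  refine eq_zero_of_isNilpotent_of_normal ?_ ?_
  · have := hcomm _ hS
    rw [add_mul, mul_add] at this
    exact add_left_cancel this
  · obtain ⟨k, hk⟩ := hnil
    exact ⟨k, by rw [hX₀, (blockPart_zero_pow D.O_mul D.mul_O htri k).2, hk, map_zero]⟩

/-- The hypothesis says that Xᵀ is perpendicular to Lie(N), which makes X block upper triangular;
nilpotency then removes the diagonal blocks. -/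
lemma mem_𝔫_of_trace_eq_zero {X : Matrix (Fin m) (Fin m) ℝ} (hX : X ∈ R.lie) (hnil : IsNilpotent X)
    (h : ∀ Y ∈ D.𝔫, (X * Y).trace = 0) : X ∈ D.𝔫 := by
  have h1 := D.starProjection_eq_blockPart (R.transpose_mem_lie hX)
  have h2 : D.𝔫.starProjection Xᵀ = 0 :=
    (Submodule.eq_starProjection_of_mem_of_inner_eq_zero D.𝔫.zero_mem fun Y hY => by
      rw [sub_zero, inner_eq_trace, Matrix.transpose_transpose, h Y hY])
  have htri : ∀ i j, D.h i < D.h j → (D.Oᵀ * X * D.O) i j = 0 := by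
    intro i j hij
    have h3 := conj_blockPart D.mul_O (h := D.h) (0 < ·) Xᵀ j i
    rw [← h1, h2, if_pos (by linarith), mul_zero, zero_mul, Matrix.zero_apply] at h3
    have e : D.Oᵀ * Xᵀ * D.O = (D.Oᵀ * X * D.O)ᵀ := by simp [Matrix.transpose_mul, mul_assoc]
    rw [e, Matrix.transpose_apply] at h3
    exact h3.symm
  have h0 := D.blockPart_zero_eq_zero hX hnil htri
  refine D.𝔫_eq.ge ⟨hX, fun i j hij => ?_⟩
  rcases hij.lt_or_eq with hij | hij
  · exact htri i j hij
  · have h3 := conj_blockPart D.mul_O (h := D.h) (· = 0) X i j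
    rw [h0, if_pos (by linarith), mul_zero, zero_mul, Matrix.zero_apply] at h3
    exact h3.symm

/-- A group of unipotent elements that is normalised by `N` is contained in `N`. -/
lemma le_N_of_unipotent {U : Subgroup G} (hU : ∀ u ∈ U, R.IsUnipotent u)
    (hN : D.N ≤ Subgroup.normalizer (U : Set G)) : U ≤ D.N := by
  intro u hu
  obtain ⟨X, hX, hnil, huX⟩ := hU u hu
  refine D.mem_N_iff.mpr ⟨X, D.mem_𝔫_of_trace_eq_zero hX hnil fun Y hY => ?_, huX⟩
  have hU' : ∀ g ∈ U.map R.toGL, IsNilpotent (g.val - 1) := by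
    rintro _ ⟨v, hv, rfl⟩
    obtain ⟨Z, -, hZ, hvZ⟩ := hU v hv
    rw [toGL_val, hvZ.mat_eq]
    exact isNilpotent_exp_sub_one hZ
  have hmem : X ∈ augmentation (U.map R.toGL) := by
    rw [← logU_exp hnil]
    refine logU_mem (augmentation_mul_le _) ?_
    rw [← huX.mat_eq]
    exact sub_one_mem_augmentation _ ⟨u, hu, rfl⟩
  -- X lies in the algebra generated by the u - 1, and N contains exp(tY) and normalises U.
  refine trace_mul_eq_zero_of_normalizes hU' ?_ hmem
  rintro t _ ⟨v, hv, rfl⟩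
  obtain ⟨n, hn⟩ := exists_isExp (R := R) (D.𝔫_le_lieAlg (D.𝔫.smul_mem t hY))
  have hnN : n ∈ D.N := D.mem_N_iff.mpr ⟨_, D.𝔫.smul_mem t hY, hn⟩
  refine ⟨n * v * n⁻¹, (Subgroup.mem_normalizer_iff.mp (hN hnN) v).mp hv, ?_⟩
  rw [map_mul, map_mul, map_inv, toGL_eq_expGL hn]

/-! ### Subgroups of `N` with linear logarithm -/

section Saturated

variable {w : Submodule ℝ (Matrix (Fin m) (Fin m) ℝ)} (hw : IsSaturated D.upper w)
  (hwn : w ≤ D.𝔫)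

include hw hwn in
lemma mem_analyticSubgroup_iff' {g : G} :
    g ∈ R.analyticSubgroup (w : Set (Matrix (Fin m) (Fin m) ℝ)) ↔ ∃ X ∈ w, R.IsExp X g :=
  mem_analyticSubgroup_iff D.isNilAlgebra_upper hw (hwn.trans D.𝔫_le_lieAlg)

include hw hwn in
lemma analyticSubgroup_le_N : R.analyticSubgroup (w : Set (Matrix (Fin m) (Fin m) ℝ)) ≤ D.N := by
  intro g hg
  obtain ⟨X, hX, h⟩ := (D.mem_analyticSubgroup_iff' hw hwn).mp hg
  exact D.mem_N_iff.mpr ⟨X, hwn hX, h⟩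

/-- On N the map to GL(m, ℝ) is injective, so statements about matrix groups lift to N. -/
lemma isExp_of_toGL_eq {g : G} (hg : g ∈ D.N) {X : Matrix (Fin m) (Fin m) ℝ} (hX : X ∈ D.𝔫)
    (h : R.toGL g = expGL X) : R.IsExp X g := by
  obtain ⟨Y, hY, hgY⟩ := D.mem_N_iff.mp hg
  rw [toGL_eq_expGL hgY] at h
  rwa [D.isNilAlgebra_upper.expGL_injOn (D.𝔫_le_upper hY) (D.𝔫_le_upper hX) h] at hgY

include hw hwn in
lemma map_analyticSubgroup : (R.analyticSubgroup (w : Set (Matrix (Fin m) (Fin m) ℝ))).map R.toGL =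
    expSubgroup D.isNilAlgebra_upper hw := by
  ext g
  constructor
  · rintro ⟨x, hx, rfl⟩
    obtain ⟨X, hX, h⟩ := (D.mem_analyticSubgroup_iff' hw hwn).mp hx
    exact ⟨X, hX, (toGL_eq_expGL h).symm⟩
  · rintro ⟨X, hX, rfl⟩
    obtain ⟨x, hx⟩ := exists_isExp (R := R) (D.𝔫_le_lieAlg (hwn hX))
    exact ⟨x, (D.mem_analyticSubgroup_iff' hw hwn).mpr ⟨X, hX, hx⟩, toGL_eq_expGL hx⟩

include hw hwn in
/-- The commutator subgroup of a subgroup with linear logarithm has linear logarithm. -/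
lemma exists_commutator_eq : ∃ w' : Submodule ℝ (Matrix (Fin m) (Fin m) ℝ),
    IsSaturated D.upper w' ∧ w' ≤ D.𝔫 ∧
    ⁅R.analyticSubgroup (w : Set (Matrix (Fin m) (Fin m) ℝ)),
      R.analyticSubgroup (w : Set (Matrix (Fin m) (Fin m) ℝ))⁆ =
        R.analyticSubgroup (w' : Set (Matrix (Fin m) (Fin m) ℝ)) := by
  obtain ⟨w', hw', hle, e⟩ := exists_commutator_expSubgroup D.isNilAlgebra_upper hw
  set V := R.analyticSubgroup (w : Set (Matrix (Fin m) (Fin m) ℝ))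
  have hV : ⁅V, V⁆ ≤ D.N := Subgroup.commutator_le_self V |>.trans (D.analyticSubgroup_le_N hw hwn)
  have hmap : (⁅V, V⁆).map R.toGL = expSubgroup D.isNilAlgebra_upper hw' := by
    rw [Subgroup.map_commutator, D.map_analyticSubgroup hw hwn, e]
  have hw'n := hle.trans hwn
  refine ⟨w', hw', hw'n, ?_⟩
  ext g
  rw [D.mem_analyticSubgroup_iff' hw' hw'n]
  constructor
  · intro hg
    have h1 : R.toGL g ∈ expSubgroup D.isNilAlgebra_upper hw' := hmap ▸ ⟨g, hg, rfl⟩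
    obtain ⟨X, hX, h2⟩ := h1
    exact ⟨X, hX, D.isExp_of_toGL_eq (hV hg) (hw'n hX) h2.symm⟩
  · rintro ⟨X, hX, hg⟩
    have h1 : expGL X ∈ (⁅V, V⁆).map R.toGL := hmap ▸ ⟨X, hX, rfl⟩
    obtain ⟨g', hg', h2⟩ := h1
    rwa [hg.eq (D.isExp_of_toGL_eq (hV hg') (hw'n hX) h2)]

/-! ### The unipotent radical -/

include hw in
lemma isSaturated_comap_conj {P Q : Matrix (Fin m) (Fin m) ℝ} (hPQ : P * Q = 1) (hQP : Q * P = 1) :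
    IsSaturated D.upper (D.upper ⊓ w.comap (LinearMap.mulLeft ℝ P ∘ₗ LinearMap.mulRight ℝ Q)) where
  le := inf_le_left
  mul_mem A hA B hB := by
    have hU := D.isNilAlgebra_upper
    have hC := hU.isSaturated_self.mul_mem A hA.1 B hB.1
    refine ⟨hC, ?_⟩
    set C := logU (NormedSpace.exp A * NormedSpace.exp B)
    have hA2 : P * A * Q ∈ w := by rw [mul_assoc]; exact hA.2
    have hB2 : P * B * Q ∈ w := by rw [mul_assoc]; exact hB.2
    have h1 := hw.mul_mem _ hA2 _ hB2
    have h2 : NormedSpace.exp (P * A * Q) * NormedSpace.exp (P * B * Q) =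
        NormedSpace.exp (P * C * Q) := by
      rw [exp_conj_of_mul_eq_one hPQ hQP, exp_conj_of_mul_eq_one hPQ hQP,
        exp_conj_of_mul_eq_one hPQ hQP, hU.exp_logU_mul hA.1 hB.1]
      calc _ = P * NormedSpace.exp A * (Q * P) * NormedSpace.exp B * Q := by simp only [mul_assoc]
        _ = _ := by rw [hQP, mul_one]; simp only [mul_assoc]
    have hnil := isNilpotent_conj hPQ hQP (hU.isNilpotent hC)
    rw [h2, logU_exp hnil, mul_assoc] at h1
    exact h1

end Saturated

/-- The unipotent radical of a subgroup that contains `N` has linear logarithm. -/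
theorem exists_unipotentRadical_eq {P : Subgroup G} (hP : D.N ≤ P) :
    ∃ w : Submodule ℝ (Matrix (Fin m) (Fin m) ℝ), IsSaturated D.upper w ∧ w ≤ D.𝔫 ∧
      R.unipotentRadical P = R.analyticSubgroup (w : Set (Matrix (Fin m) (Fin m) ℝ)) := by
  set F : Set (Subgroup G) :=
    {U | U ≤ P ∧ P ≤ Subgroup.normalizer (U : Set G) ∧ ∀ u ∈ U, R.IsUnipotent u}
  -- The logarithms of all elements of all candidate subgroups. Conjugation by P permutes S and so
  -- preserves its saturated hull; the exponential of the hull is therefore itself a candidate, and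
  -- it contains all the others.
  set S : Set (Matrix (Fin m) (Fin m) ℝ) := {X | X ∈ D.𝔫 ∧ ∃ U ∈ F, ∃ u ∈ U, R.IsExp X u}
  have hFN : ∀ U ∈ F, U ≤ D.N := fun U hU => D.le_N_of_unipotent hU.2.2 (hP.trans hU.2.1)
  have hSn : S ⊆ D.𝔫 := fun X hX => hX.1
  have hw : IsSaturated D.upper (satHull D.upper S) :=
    isSaturated_satHull D.isNilAlgebra_upper fun X hX => D.𝔫_le_upper hX.1
  have hwn : satHull D.upper S ≤ D.𝔫 := satHull_le D.isSaturated_𝔫 hSn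
  refine ⟨satHull D.upper S, hw, hwn, le_antisymm (sSup_le fun U hU u hu => ?_) (le_sSup ⟨?_, ?_, ?_⟩)⟩
  · obtain ⟨X, hX, hu'⟩ := D.mem_N_iff.mp (hFN U hU hu)
    exact (D.mem_analyticSubgroup_iff' hw hwn).mpr ⟨X, subset_satHull ⟨hX, U, hU, u, hu, hu'⟩, hu'⟩
  · exact (D.analyticSubgroup_le_N hw hwn).trans hP
  · have key : ∀ p ∈ P, ∀ g ∈ R.analyticSubgroup (satHull D.upper S : Set (Matrix (Fin m) (Fin m) ℝ)),
        p * g * p⁻¹ ∈ R.analyticSubgroup (satHull D.upper S : Set (Matrix (Fin m) (Fin m) ℝ)) := by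
      intro p hp g hg
      obtain ⟨X, hX, hgX⟩ := (D.mem_analyticSubgroup_iff' hw hwn).mp hg
      have h1 : satHull D.upper S ≤ D.upper ⊓ (satHull D.upper S).comap
          (LinearMap.mulLeft ℝ (R.mat p) ∘ₗ LinearMap.mulRight ℝ (R.mat p⁻¹)) := by
        refine satHull_le (D.isSaturated_comap_conj hw (R.mat_mul_inv p) (R.mat_inv_mul p)) ?_
        rintro Y ⟨hY, U, hU, u, hu, hYu⟩
        refine ⟨D.𝔫_le_upper hY, ?_⟩
        have h2 : p * u * p⁻¹ ∈ U := (Subgroup.mem_normalizer_iff.mp (hU.2.1 hp) u).mp hu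
        have h3 := hYu.conj p
        obtain ⟨Z, hZ, h4⟩ := D.mem_N_iff.mp (hFN U hU h2)
        have h5 : R.mat p * Y * R.mat p⁻¹ = Z := by
          refine exp_injOn_nilpotent ?_ (D.isNilAlgebra_upper.isNilpotent (D.𝔫_le_upper hZ)) ?_
          · exact isNilpotent_conj (R.mat_mul_inv p) (R.mat_inv_mul p)
              (D.isNilAlgebra_upper.isNilpotent (D.𝔫_le_upper hY))
          · rw [← h3.mat_eq, h4.mat_eq]
        show R.mat p * (Y * R.mat p⁻¹) ∈ satHull D.upper S
        rw [← mul_assoc, h5]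
        exact subset_satHull ⟨hZ, U, hU, _, h2, h4⟩
      refine (D.mem_analyticSubgroup_iff' hw hwn).mpr ⟨R.mat p * X * R.mat p⁻¹, ?_, hgX.conj p⟩
      rw [mul_assoc]
      exact (h1 hX).2
    intro p hp
    rw [Subgroup.mem_normalizer_iff]
    refine fun g => ⟨key p hp g, fun h => ?_⟩
    have := key p⁻¹ (P.inv_mem hp) _ h
    simpa [mul_assoc] using this
  · intro u hu
    obtain ⟨X, hX, hu'⟩ := (D.mem_analyticSubgroup_iff' hw hwn).mp hu
    exact ⟨X, D.𝔫_le_lieAlg (hwn hX), D.isNilAlgebra_upper.isNilpotent (D.𝔫_le_upper (hwn hX)), hu'⟩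

end IwasawaDatum

end RealReductiveGroup

namespace RealReductiveGroup

open scoped Matrix.Norms.Frobenius Pointwise
open Filter Topology commutatorElement Function

/-! ### Comparison of integrals over a group and over a closed subgroup -/

lemma exists_maximal_pairwiseDisjoint {U M : Type*} (F : U → Set M) : ∃ S : Set U,
    S.PairwiseDisjoint F ∧ ∀ u, (F u).Nonempty → ∃ s ∈ S, ¬Disjoint (F u) (F s) := by
  obtain ⟨S, hS⟩ := zorn_subset {S : Set U | S.PairwiseDisjoint F} fun c hc hchain =>
    ⟨⋃₀ c, (Set.pairwiseDisjoint_sUnion hchain.directedOn).mpr fun s hs => hc hs,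
      fun s hs => Set.subset_sUnion_of_mem hs⟩
  refine ⟨S, hS.prop, fun u hu => ?_⟩
  by_contra! hcon
  have h1 : u ∈ S := by
    refine hS.le_of_ge (y := insert u S) ?_ (Set.subset_insert u S) (Set.mem_insert u S)
    exact hS.prop.insert fun s hs _ => hcon s hs
  exact hu.ne_empty (disjoint_self.mp (hcon u h1))

/-- If `f` changes by bounded factors under translation by a compact neighbourhood of `1`, then
integrability over a group implies integrability over a closed subgroup. -/
theorem lintegral_comp_lt_top_of_isClosedEmbedding {U M : Type*} [Group U] [TopologicalSpace U]
    [IsTopologicalGroup U] [MeasurableSpace U] [BorelSpace U] [T2Space U] [Group M] [TopologicalSpace M]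
    [IsTopologicalGroup M] [T2Space M] [MeasurableSpace M] [BorelSpace M] {φ : U →* M}
    (hφ : IsClosedEmbedding φ) (μ : Measure U) [μ.IsHaarMeasure] (ν : Measure M) [ν.IsHaarMeasure]
    {f : M → ℝ≥0∞} (hf0 : ∀ g, f g ≠ 0) {W : Set M} (hW : IsCompact W) (hW1 : W ∈ 𝓝 1) {C : ℝ≥0∞}
    (hC : C ≠ ∞) (hle : ∀ g, ∀ x ∈ W * W⁻¹, f (g * x) ≤ C * f g ∧ f g ≤ C * f (g * x))
    (hf : ∫⁻ g, f g ∂ν < ∞) : ∫⁻ u, f (φ u) ∂μ < ∞ := by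
  have hWsub : W ⊆ W * W⁻¹ := fun x hx =>
    ⟨x, hx, 1, by simpa using mem_of_mem_nhds hW1, mul_one x⟩
  -- A maximal family of points of U whose translates of W are disjoint in M. Disjointness bounds
  -- the sum of f over the family by the integral over M; maximality makes the translates of WW⁻¹
  -- cover U.
  obtain ⟨S, hS, hmax⟩ := exists_maximal_pairwiseDisjoint fun u : U => (φ u * ·) '' W
  set Q : Set U := φ ⁻¹' (W * W⁻¹)
  have hQ : IsCompact Q := hφ.isCompact_preimage (hW.mul hW.inv)
  have hcover : ⋃ s : S, (s.1⁻¹ * ·) ⁻¹' Q = Set.univ := by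
    refine Set.eq_univ_of_forall fun u => ?_
    obtain ⟨s, hs, hd⟩ := hmax u ⟨φ u * 1, 1, mem_of_mem_nhds hW1, rfl⟩
    obtain ⟨_, ⟨x, hx, rfl⟩, ⟨y, hy, e⟩⟩ := Set.not_disjoint_iff.mp hd
    refine Set.mem_iUnion.mpr ⟨⟨s, hs⟩, ?_⟩
    show φ (s⁻¹ * u) ∈ W * W⁻¹
    refine ⟨y, hy, x⁻¹, Set.inv_mem_inv.mpr hx, ?_⟩
    have e' : φ s * y = φ u * x := e
    show y * x⁻¹ = φ (s⁻¹ * u)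
    rw [map_mul, map_inv, eq_inv_mul_iff_mul_eq, ← mul_assoc, e', mul_inv_cancel_right]
  have hνW : 0 < ν W := ν.measure_pos_of_mem_nhds hW1
  have hlower : ∀ s : U, f (φ s) * ν W ≤ C * ∫⁻ g in (φ s * ·) '' W, f g ∂ν := by
    intro s
    have hm : MeasurableSet ((φ s * ·) '' W) := (hW.image (continuous_const_mul _)).measurableSet
    have h1 : ν ((φ s * ·) '' W) = ν W := by
      have : (φ s * ·) '' W = ((φ s)⁻¹ * ·) ⁻¹' W := by rw [Set.image_mul_left]
      rw [this, measure_preimage_mul]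
    calc f (φ s) * ν W = ∫⁻ _ in (φ s * ·) '' W, f (φ s) ∂ν := by rw [setLIntegral_const, h1]
      _ ≤ ∫⁻ g in (φ s * ·) '' W, C * f g ∂ν := by
          refine setLIntegral_mono' hm ?_
          rintro _ ⟨x, hx, rfl⟩
          exact (hle (φ s) x (hWsub hx)).2
      _ = _ := lintegral_const_mul' _ _ hC
  have hsum : ∑' s : S, f (φ s.1) * ν W < ∞ := by
    refine lt_of_le_of_lt (ENNReal.summable.tsum_le_of_sum_le fun t => ?_)
      (ENNReal.mul_lt_top hC.lt_top hf)
    calc ∑ s ∈ t, f (φ s.1) * ν W ≤ ∑ s ∈ t, C * ∫⁻ g in (φ s.1 * ·) '' W, f g ∂ν :=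
          Finset.sum_le_sum fun s _ => hlower s.1
      _ = C * ∫⁻ g in ⋃ s ∈ t, (φ s.1 * ·) '' W, f g ∂ν := by
          rw [← Finset.mul_sum, lintegral_biUnion_finset]
          · exact fun a _ b _ hab => hS a.2 b.2 fun e => hab (Subtype.ext e)
          · exact fun s _ => (hW.image (continuous_const_mul _)).measurableSet
      _ ≤ C * ∫⁻ g, f g ∂ν := mul_le_mul_right (setLIntegral_le_lintegral _ _) _
  -- A convergent sum of nonzero terms has countably many of them; countability is needed for
  -- subadditivity over the cover.
  have hcount : Countable S := by
    have h1 := Summable.countable_support_ennreal hsum.ne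
    have h2 : Function.support (fun s : S => f (φ s.1) * ν W) = Set.univ :=
      Set.eq_univ_of_forall fun s => mul_ne_zero (hf0 _) hνW.ne'
    rw [h2] at h1
    exact Set.countable_univ_iff.mp h1
  have hupper : ∀ s : S, ∫⁻ u in (s.1⁻¹ * ·) ⁻¹' Q, f (φ u) ∂μ ≤ C * f (φ s.1) * μ Q := by
    intro s
    have hm : MeasurableSet ((s.1⁻¹ * ·) ⁻¹' Q) :=
      (hQ.isClosed.preimage (continuous_const_mul _)).measurableSet
    calc _ ≤ ∫⁻ _ in (s.1⁻¹ * ·) ⁻¹' Q, C * f (φ s.1) ∂μ := by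
          refine setLIntegral_mono' hm fun u hu => ?_
          have := (hle (φ s.1) (φ (s.1⁻¹ * u)) hu).1
          rwa [← map_mul, mul_inv_cancel_left] at this
      _ = _ := by rw [setLIntegral_const, measure_preimage_mul]
  have hsum' : ∑' s : S, f (φ s.1) < ∞ := by
    rw [ENNReal.tsum_mul_right] at hsum
    exact lt_top_iff_ne_top.mpr fun h => by
      rw [h, ENNReal.top_mul hνW.ne'] at hsum
      exact lt_irrefl _ hsum
  calc ∫⁻ u, f (φ u) ∂μ = ∫⁻ u in ⋃ s : S, (s.1⁻¹ * ·) ⁻¹' Q, f (φ u) ∂μ := by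
        rw [hcover, Measure.restrict_univ]
    _ ≤ ∑' s : S, ∫⁻ u in (s.1⁻¹ * ·) ⁻¹' Q, f (φ u) ∂μ := lintegral_iUnion_le _ _
    _ ≤ ∑' s : S, C * f (φ s.1) * μ Q := ENNReal.tsum_le_tsum hupper
    _ = C * (∑' s : S, f (φ s.1)) * μ Q := by rw [ENNReal.tsum_mul_right, ENNReal.tsum_mul_left]
    _ < ∞ := ENNReal.mul_lt_top (ENNReal.mul_lt_top hC.lt_top hsum') hQ.measure_lt_top

/-! ### Topology of the subgroups of `N` -/

attribute [local instance] frobeniusInnerProductSpace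

variable {m : ℕ} {G : Type*} [Group G] [TopologicalSpace G] [IsTopologicalGroup G]
  {R : RealReductiveGroup G m}

namespace IwasawaDatum

variable (D : R.IwasawaDatum)

section Saturated

variable {w : Submodule ℝ (Matrix (Fin m) (Fin m) ℝ)} (hw : IsSaturated D.upper w)
  (hwn : w ≤ D.𝔫)

lemma logU_mat {g : G} {X : Matrix (Fin m) (Fin m) ℝ} (hX : X ∈ D.𝔫) (h : R.IsExp X g) :
    logU (R.mat g) = X := by
  rw [h.mat_eq, logU_exp (D.isNilAlgebra_upper.isNilpotent (D.𝔫_le_upper hX))]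

include hw hwn in
lemma mem_analyticSubgroup_iff_logU {g : G} (hg : g ∈ D.N) :
    g ∈ R.analyticSubgroup (w : Set (Matrix (Fin m) (Fin m) ℝ)) ↔ logU (R.mat g) ∈ w := by
  rw [D.mem_analyticSubgroup_iff' hw hwn]
  obtain ⟨Y, hY, hgY⟩ := D.mem_N_iff.mp hg
  constructor
  · rintro ⟨X, hX, h⟩
    rwa [D.logU_mat (hwn hX) h]
  · intro h
    rw [D.logU_mat hY hgY] at h
    exact ⟨Y, h, hgY⟩

include hw hwn in
lemma isClosed_analyticSubgroup {M : Subgroup G} (hM : M ≤ D.N) :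
    IsClosed {g : M | g.1 ∈ R.analyticSubgroup (w : Set (Matrix (Fin m) (Fin m) ℝ))} := by
  have h1 : {g : M | g.1 ∈ R.analyticSubgroup (w : Set (Matrix (Fin m) (Fin m) ℝ))} =
      (fun g : M => logU (R.mat g.1)) ⁻¹' (w : Set (Matrix (Fin m) (Fin m) ℝ)) :=
    Set.ext fun g => D.mem_analyticSubgroup_iff_logU hw hwn (hM g.2)
  rw [h1]
  exact IsClosed.preimage (continuous_logU.comp (R.continuous_mat.comp continuous_subtype_val))
    (Submodule.closed_of_finiteDimensional w)

include hw hwn in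
-- The lifted exponential and the continuous logarithm identify the subgroup, with its subspace
-- topology, with the vector space w.
lemma locallyCompactSpace_analyticSubgroup :
    LocallyCompactSpace (R.analyticSubgroup (w : Set (Matrix (Fin m) (Fin m) ℝ))) := by
  set V := R.analyticSubgroup (w : Set (Matrix (Fin m) (Fin m) ℝ))
  have hV := D.analyticSubgroup_le_N hw hwn
  let e : w ≃ₜ V :=
    { toFun := fun X => ⟨R.liftExp ⟨X.1, D.𝔫_le_lieAlg (hwn X.2)⟩,
        (D.mem_analyticSubgroup_iff' hw hwn).mpr ⟨X.1, X.2,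
            R.isExp_liftExp ⟨X.1, D.𝔫_le_lieAlg (hwn X.2)⟩⟩⟩
      invFun := fun g => ⟨logU (R.mat g.1), (D.mem_analyticSubgroup_iff_logU hw hwn (hV g.2)).mp g.2⟩
      left_inv := fun X => Subtype.ext
        (D.logU_mat (hwn X.2) (R.isExp_liftExp ⟨X.1, D.𝔫_le_lieAlg (hwn X.2)⟩))
      right_inv := fun g => by
        obtain ⟨X, hX, h⟩ := (D.mem_analyticSubgroup_iff' hw hwn).mp g.2
        refine Subtype.ext ?_
        have e1 := D.logU_mat (hwn hX) h
        refine IsExp.eq (X := X) ?_ h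
        have := R.isExp_liftExp ⟨X, D.𝔫_le_lieAlg (hwn hX)⟩
        convert this
      continuous_toFun := by
        refine Continuous.subtype_mk (R.liftExp.continuous.comp ?_) _
        exact Continuous.subtype_mk continuous_subtype_val _
      continuous_invFun := Continuous.subtype_mk
        (continuous_logU.comp (R.continuous_mat.comp continuous_subtype_val)) _ }
  have : LocallyCompactSpace (Matrix (Fin m) (Fin m) ℝ) :=
    inferInstanceAs (LocallyCompactSpace (Fin m → Fin m → ℝ))
  have : LocallyCompactSpace w :=
    (Submodule.closed_of_finiteDimensional w).isClosedEmbedding_subtypeVal.locallyCompactSpace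
  exact e.symm.isClosedEmbedding.locallyCompactSpace

end Saturated

/-! ### The integrals -/

lemma one_add_log_mul_le {c a : ℝ} (hc : 1 ≤ c) (ha : 1 ≤ a) :
    1 + Real.log (c * a) ≤ (1 + Real.log c) * (1 + Real.log a) := by
  rw [Real.log_mul (by linarith) (by linarith)]
  nlinarith [mul_nonneg (Real.log_nonneg hc) (Real.log_nonneg ha)]

/-- The integrand inherits bounded variation from a(g)^ρ; the logarithmic factor costs only a power
of 1 + log c. -/
lemma inv_mul_log_rpow_le {a b c d : ℝ} (ha : 1 ≤ a) (hb : 1 ≤ b) (hc : 1 ≤ c) (hd : 0 ≤ d)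
    (h1 : a ≤ c * b) (h2 : b ≤ c * a) : b⁻¹ * (1 + Real.log b) ^ d ≤
      c * (1 + Real.log c) ^ d * (a⁻¹ * (1 + Real.log a) ^ d) := by
  have hla := Real.log_nonneg ha
  have hlb := Real.log_nonneg hb
  have hlc := Real.log_nonneg hc
  have h3 : b⁻¹ ≤ c * a⁻¹ := by
    rw [← div_eq_mul_inv, le_div_iff₀ (by linarith), inv_mul_le_iff₀ (by linarith)]
    linarith
  have h4 : (1 + Real.log b) ^ d ≤ (1 + Real.log c) ^ d * (1 + Real.log a) ^ d := by
    rw [← Real.mul_rpow (by linarith) (by linarith)]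
    refine Real.rpow_le_rpow (by linarith) ?_ hd
    exact (add_le_add_right (Real.log_le_log (by linarith) h2) 1).trans (one_add_log_mul_le hc ha)
  calc _ ≤ (c * a⁻¹) * ((1 + Real.log c) ^ d * (1 + Real.log a) ^ d) :=
        mul_le_mul h3 h4 (by positivity) (by positivity)
    _ = _ := by ring

/-- Raising the exponent to max(d, 1) covers every real d, while tameness is available only for
positive exponents. -/
lemma rpow_le_of_log_le {g a C d : ℝ} (hg : 1 ≤ g) (ha : 1 ≤ a) (hC : 0 ≤ C)
    (h : Real.log g ≤ C * (1 + Real.log a)) :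
    (1 + Real.log g) ^ d ≤ (1 + C) ^ max d 1 * (1 + Real.log a) ^ max d 1 := by
  have hlg := Real.log_nonneg hg
  have hla := Real.log_nonneg ha
  calc (1 + Real.log g) ^ d ≤ (1 + Real.log g) ^ max d 1 :=
        Real.rpow_le_rpow_of_exponent_le (by linarith) (le_max_left _ _)
    _ ≤ ((1 + C) * (1 + Real.log a)) ^ max d 1 :=
        Real.rpow_le_rpow (by linarith) (by nlinarith) (zero_le_one.trans (le_max_right _ _))
    _ = _ := Real.mul_rpow (by linarith) (by linarith)

/-- The integrand of the tameness condition. -/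
def tameFun (d : ℝ) (g : G) : ℝ≥0∞ := ENNReal.ofReal ((D.powRho (D.aPart g))⁻¹ *
  (1 + Real.log (D.powRho (D.aPart g))) ^ d)

lemma lintegral_tameFun_lt_top_of_le [MeasurableSpace G] [BorelSpace G] {U M : Subgroup G}
    (hUM : U ≤ M) (hMN : M ≤ D.N) [LocallyCompactSpace M] (hcl : IsClosed {g : M | g.1 ∈ U})
    {d : ℝ} (hd : 0 ≤ d) (μ : Measure U) [μ.IsHaarMeasure] (ν : Measure M) [ν.IsHaarMeasure]
    (h : ∫⁻ n : M, D.tameFun d n ∂ν < ∞) : ∫⁻ n : U, D.tameFun d n ∂μ < ∞ := by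
  have := R.t2Space
  have hφ : IsClosedEmbedding (Subgroup.inclusion hUM) := by
    refine ⟨IsEmbedding.inclusion hUM, ?_⟩
    convert hcl
    ext g
    constructor
    · rintro ⟨u, rfl⟩
      exact u.2
    · intro hg
      exact ⟨⟨g.1, hg⟩, rfl⟩
  obtain ⟨W, hW, hW1⟩ := exists_compact_mem_nhds (1 : M)
  have hK : IsCompact (Subtype.val '' (W * W⁻¹)) := (hW.mul hW.inv).image continuous_subtype_val
  obtain ⟨c, hc, hc'⟩ := D.exists_powRho_aPart_mul_le hK
  have hone : ∀ g : M, 1 ≤ D.powRho (D.aPart (g : G)) := fun g => D.one_le_powRho_aPart (hMN g.2)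
  have hc0 : 0 ≤ c * (1 + Real.log c) ^ d := by
    have := Real.log_nonneg hc
    positivity
  refine lintegral_comp_lt_top_of_isClosedEmbedding hφ μ ν (f := fun g : M => D.tameFun d g)
    (fun g => ?_) hW hW1 (C := ENNReal.ofReal (c * (1 + Real.log c) ^ d)) ENNReal.ofReal_ne_top
    (fun g x hx => ?_) h
  · have h1 := Real.log_nonneg (hone g)
    have h2 := hone g
    exact (ENNReal.ofReal_pos.mpr (by positivity)).ne'
  · obtain ⟨h1, h2⟩ := hc' g.1 x.1 ⟨x, hx, rfl⟩
    rw [tameFun, tameFun, ← ENNReal.ofReal_mul hc0, ← ENNReal.ofReal_mul hc0]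
    exact ⟨ENNReal.ofReal_le_ofReal (inv_mul_log_rpow_le (hone g) (hone (g * x)) hc hd h2 h1),
      ENNReal.ofReal_le_ofReal (inv_mul_log_rpow_le (hone (g * x)) (hone g) hc hd h1 h2)⟩

/-- The integrand of the tameness condition is integrable over `[N_P, N_P]`. -/
theorem lintegral_tameFun_commutator_lt_top [MeasurableSpace G] [BorelSpace G]
    (hG : D.IsTame) {P : Subgroup G} (hP : D.N ≤ P)
    (μ : Measure ↥⁅R.unipotentRadical P, R.unipotentRadical P⁆) [μ.IsHaarMeasure] {d : ℝ}
    (hd : 0 < d) : ∫⁻ n, D.tameFun d (n : G) ∂μ < ∞ := by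
  have := R.t2Space
  obtain ⟨w, hw, hwn, e⟩ := D.exists_unipotentRadical_eq hP
  obtain ⟨w₁, hw₁, hwn₁, e₁⟩ := D.exists_commutator_eq hw hwn
  obtain ⟨w₂, hw₂, hwn₂, e₂⟩ := D.exists_commutator_eq D.isSaturated_𝔫 le_rfl
  rw [← e] at e₁
  change ⁅D.N, D.N⁆ = _ at e₂
  have hNP : R.unipotentRadical P ≤ D.N := e ▸ D.analyticSubgroup_le_N hw hwn
  have hMN : ⁅D.N, D.N⁆ ≤ D.N := Subgroup.commutator_le_self D.N
  have hcl := D.isClosed_analyticSubgroup hw₁ hwn₁ hMN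
  rw [← e₁] at hcl
  -- Local compactness provides a Haar measure on [N,N], to which tameness is applied.
  have : LocallyCompactSpace ↥⁅D.N, D.N⁆ := e₂ ▸ D.locallyCompactSpace_analyticSubgroup hw₂ hwn₂
  exact D.lintegral_tameFun_lt_top_of_le (Subgroup.commutator_mono hNP hNP) hMN hcl hd.le μ
    Measure.haar (hG _ inferInstance d hd)

lemma unipotentRadical_le_N {P : Subgroup G} (hP : D.N ≤ P) : R.unipotentRadical P ≤ D.N := by
  obtain ⟨w, hw, hwn, e⟩ := D.exists_unipotentRadical_eq hP
  exact e ▸ D.analyticSubgroup_le_N hw hwn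

end IwasawaDatum

end RealReductiveGroup

end

theorem mainTheorem7 {G : Type*} [Group G] [TopologicalSpace G] [IsTopologicalGroup G]
    [MeasurableSpace G] [BorelSpace G] {m : ℕ} (R : RealReductiveGroup G m)
    (D : R.IwasawaDatum) (hG : D.IsTame)
    (P : Subgroup G) (hP : D.IsStandardParabolic P)
    (μ : Measure ↥⁅R.unipotentRadical P, R.unipotentRadical P⁆) (hμ : μ.IsHaarMeasure) (d : ℝ) :
    ∫⁻ n, ENNReal.ofReal ((D.powRho (D.aPart (n : G)))⁻¹ *
      (1 + Real.log (D.gnorm (n : G))) ^ d) ∂μ < ∞ := by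
  obtain ⟨C, hC, h⟩ := D.exists_log_gnorm_le
  have hN := D.unipotentRadical_le_N hP.N_le
  have h1 := D.lintegral_tameFun_commutator_lt_top hG hP.N_le μ
    (zero_lt_one.trans_le (le_max_right d 1))
  -- On N the logarithm of ‖n‖ is dominated by 1 + log a(n)^ρ, which leaves a constant multiple of
  -- the tameness integrand.
  refine lt_of_le_of_lt (lintegral_mono fun n => ?_)
    (lt_of_eq_of_lt (lintegral_const_mul' (ENNReal.ofReal ((1 + C) ^ max d 1)) _
      ENNReal.ofReal_ne_top) (ENNReal.mul_lt_top ENNReal.ofReal_lt_top h1))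
  have hn : (n : G) ∈ D.N := hN (Subgroup.commutator_le_self _ n.2)
  have h2 := D.one_le_powRho_aPart hn
  rw [RealReductiveGroup.IwasawaDatum.tameFun, ← ENNReal.ofReal_mul (by positivity)]
  refine ENNReal.ofReal_le_ofReal ?_
  rw [mul_left_comm]
  exact mul_le_mul_of_nonneg_left
    (RealReductiveGroup.IwasawaDatum.rpow_le_of_log_le (D.one_le_gnorm _) h2 hC (h _ hn))
    (by positivity)
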